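/- Let $\mathbb{H}$ be the quaternions, $\mathbb{D}$ their open unit ball, $i\in\mathbb{H}$ an imaginary unit ($\mathrm{Re}\, i=0$, $|i|=1$), $\mathbb{C}_i=\mathbb{R}+i\mathbb{R}$, $\mathbb{D}_i=\mathbb{D}\cap\mathbb{C}_i$, and let $dm_i$ be the Lebesgue measure on $\mathbb{C}_i$. Let $\alpha>-1$, $dA_{\alpha,i}(z)=\frac{\alpha+1}{\pi}(1-|z|^2)^\alpha\,dm_i(z)$ and $d\mu_i(z)=\frac{1}{\pi(1-|z|^2)^2}\,dm_i(z)$ on $\mathbb{D}_i$. A real differentiable function $f:\mathbb{D}\to\mathbb{H}$ is left slice hyperholomorphic if $f(x_0+Ix_1)=a(x_0,x_1)+I\,b(x_0,x_1)$ for every imaginary unit $I$ and all real $x_0,x_1$ with $x_0+Ix_1\in\mathbb{D}$, where $a$ and $b$ are $\mathbb{H}$-valued, do not depend on $I$, are respectively even and odd in $x_1$, and satisfy $\partial_{x_0}a=\partial_{x_1}b$ and $\partial_{x_0}b=-\partial_{x_1}a$. Let $\mathcal{A}^2_{\alpha,i}(\mathbb{D})$ be the right quaternionic Hilbert space of all such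 $f$ with $\int_{\mathbb{D}_i}|f|^2\,dA_{\alpha,i}<\infty$, with the scalar product $\langle f,g\rangle=\int_{\mathbb{D}_i}\overline{f}\,g\,dA_{\alpha,i}$. Let $K_q$ be its reproducing kernel, i.e. $f(q)=\langle K_q,f\rangle$ for all $f$, and put $k_q=K_q/\sqrt{K_q(q)}$. Let $J$ be the unitary anti-selfadjoint operator that maps $f$ to the unique left slice hyperholomorphic function on $\mathbb{D}$ that coincides with $z\mapsto i f(z)$ on $\mathbb{D}_i$. For a bounded right linear operator $T$ on $\mathcal{A}^2_{\alpha,i}(\mathbb{D})$ with $TJ=JT$, the Berezin transform is $\widetilde T(q)=\langle k_q,Tk_q\rangle$, $q\in\mathbb{D}_i$. $T$ is positive if $\langle f,Tf\rangle\ge 0$ for all $f$. For $0<p<\infty$, $S_p(J)$ is the set of all compact right linear operators that commute with $J$ and whose sequence of singular values (the eigenvalues of $|T|=\sqrt{T^*T}$ in decreasing order, with multiplicity) is in $\ell^p$. Theorem. Let $T$ be a bounded positive operator on $\mathcal{A}^2_{\alpha,i}(\mathbb{D})$ that commutes with $J$. (i) If $1\le p<\infty$ and $T\in S_p(J)$,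 then $\widetilde T\in L^p(\mathbb{D}_i,d\mu_i)$. (ii) If $0<p\le 1$ and $\widetilde T\in L^p(\mathbb{D}_i,d\mu_i)$, then $T\in S_p(J)$. Moreover, if $1\le p<\infty$ and $T\in S_p(J)$ is not necessarily positive, then still $\widetilde T\in L^p(\mathbb{D}_i,d\mu_i)$. -/

import Mathlib

open scoped Quaternion ENNReal
open MeasureTheory MulOpposite

noncomputable section

namespace SliceBergman

/-! ### Slice hyperholomorphic functions -/

/-- The sphere of imaginary units of the quaternions. -/
abbrev ImUnit : Type := {q : ℍ // q.re = 0 ∧ ‖q‖ = 1}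

/-- The identification of the complex numbers with the slice spanned by `1` and `I`:
`x₀ + i x₁ ↦ x₀ + I x₁`. -/
def slicePt (I : ImUnit) (z : ℂ) : ℍ := (z.re : ℍ) + z.im • (I : ℍ)

/-- `f` is left slice hyperholomorphic on the (axially symmetric open) set `U`: it is real
differentiable and `f (x₀ + I x₁) = a x₀ x₁ + I b x₀ x₁`, where `a` is even and `b` is odd in `x₁`
and `a`, `b` satisfy the Cauchy-Riemann system
`∂a/∂x₀ = ∂b/∂x₁ = d`, `∂b/∂x₀ = - ∂a/∂x₁ = e`. -/
def IsLeftSliceHyperholomorphic (U : Set ℍ) (f : ℍ → ℍ) : Prop :=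
  DifferentiableOn ℝ f U ∧
  ∃ a b : ℝ → ℝ → ℍ, ∀ (I : ImUnit) (x₀ x₁ : ℝ), slicePt I ⟨x₀, x₁⟩ ∈ U →
    f (slicePt I ⟨x₀, x₁⟩) = a x₀ x₁ + I * b x₀ x₁ ∧
    a x₀ (-x₁) = a x₀ x₁ ∧ b x₀ (-x₁) = - b x₀ x₁ ∧
    ∃ d e : ℍ,
      HasDerivAt (fun t => a t x₁) d x₀ ∧ HasDerivAt (fun t => b x₀ t) d x₁ ∧
      HasDerivAt (fun t => b t x₁) e x₀ ∧ HasDerivAt (fun t => a x₀ t) (-e) x₁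

/-- The open unit ball of the quaternions. -/
abbrev unitBall : Set ℍ := Metric.ball 0 1

/-- The complex coordinate `x₀ + i |im x|` of a quaternion `x = x₀ + i_x |im x|`. -/
def sliceCoord (x : ℍ) : ℂ := ⟨x.re, ‖x.im‖⟩

/-- The imaginary unit `i_x = im x / |im x|` of a quaternion `x` (and `0` if `x` is real). -/
def unitOf (x : ℍ) : ℍ := ‖x.im‖⁻¹ • x.im

/-- The slice extension to the unit ball of a function `g` on the unit disk of the slice of `i`
(in the coordinate `z ↦ slicePt i z`), through the representation formula
`ext g (x) = (1 - i_x i)/2 * g (z) + (1 + i_x i)/2 * g (conj z)`, `z = x₀ + i |im x|`.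
For real `x` the factors `i_x` cancel. The extension is set to `0` outside of the unit ball. -/
def sliceExt (i : ImUnit) (g : ℂ → ℍ) (x : ℍ) : ℍ :=
  open Classical in
  if x ∈ unitBall then
    (2⁻¹ : ℝ) • ((1 - unitOf x * i) * g (sliceCoord x)) +
      (2⁻¹ : ℝ) • ((1 + unitOf x * i) * g (star (sliceCoord x)))
  else 0

/-! ### Measures on the disk -/

/-- The measure `(α+1)/π (1-|z|²)^α dm(z)` on the unit disk of a slice, in the coordinate of
`slicePt`. -/
def diskMeasure (α : ℝ) : Measure ℂ :=
  (volume.restrict (Metric.ball (0 : ℂ) 1)).withDensity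
    fun z => ENNReal.ofReal ((α + 1) / Real.pi * (1 - ‖z‖ ^ 2) ^ α)

/-- The Möbius invariant measure `dm(z) / (π (1-|z|²)²)` on the unit disk of a slice, in the
coordinate of `slicePt`. -/
def moebiusMeasure : Measure ℂ :=
  (volume.restrict (Metric.ball (0 : ℂ) 1)).withDensity
    fun z => ENNReal.ofReal (1 / (Real.pi * (1 - ‖z‖ ^ 2) ^ 2))

/-! ### Quaternionic inner product spaces and their operators -/

/-- A quaternionic scalar product on a right quaternionic vector space, which induces the norm.
(A quaternionic Hilbert space if the space is in addition complete.) -/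
class QInner (H : Type*) [NormedAddCommGroup H] [Module ℍᵐᵒᵖ H] where
  qinner : H → H → ℍ
  add_right : ∀ x y z, qinner x (y + z) = qinner x y + qinner x z
  smul_right : ∀ (x y : H) (a : ℍ), qinner x (op a • y) = qinner x y * a
  conj_symm : ∀ x y, star (qinner y x) = qinner x y
  inner_self : ∀ x, qinner x x = ((‖x‖ ^ 2 : ℝ) : ℍ)


section Operators

variable {H : Type*} [NormedAddCommGroup H] [Module ℍᵐᵒᵖ H] [QInner H]

/-- `T` is positive: `⟨x, T x⟩` is a nonnegative real for every `x`. -/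
def IsPositive (T : H →L[ℍᵐᵒᵖ] H) : Prop :=
  ∀ x, ∃ r : ℝ, 0 ≤ r ∧ QInner.qinner x (T x) = (r : ℍ)

/-- `S` is the adjoint of `T`. -/
def IsAdjoint (T S : H →L[ℍᵐᵒᵖ] H) : Prop :=
  ∀ x y, QInner.qinner (S x) y = QInner.qinner x (T y)

/-- `P` is `|T|`, the positive square root of `T* T`. -/
def IsAbs (T P : H →L[ℍᵐᵒᵖ] H) : Prop :=
  IsPositive P ∧ ∃ S, IsAdjoint T S ∧ P ∘L P = S ∘L T

/-- `s` is the sequence of singular values of `T`: the eigenvalues of `|T|`, with multiplicity, in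
decreasing order (continued by zeros if there are only finitely many nonzero ones). That is,
`|T| x = ∑ eₙ sₙ ⟨eₙ, x⟩` where the `eₙ` with `sₙ ≠ 0` are orthonormal. -/
def IsSingularValueSeq (T : H →L[ℍᵐᵒᵖ] H) (s : ℕ → ℝ) : Prop :=
  Antitone s ∧ (∀ n, 0 ≤ s n) ∧ ∃ P, IsAbs T P ∧ ∃ e : ℕ → H,
    (∀ m n, s m ≠ 0 → s n ≠ 0 → QInner.qinner (e m) (e n) = if m = n then 1 else 0) ∧
    ∀ x, HasSum (fun n => op ((s n : ℍ) * QInner.qinner (e n) x) • e n) (P x)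

/-- The `(J, p)`-Schatten class, for a unitary and anti-selfadjoint `J`: compact operators that commute with `J` and whose singular values
are in `ℓ^p`. -/
def Schatten (J : H →L[ℍᵐᵒᵖ] H) (p : ℝ≥0∞) : Set (H →L[ℍᵐᵒᵖ] H) :=
  {T | IsCompactOperator T ∧ T ∘L J = J ∘L T ∧ ∃ s : ℕ → ℝ, IsSingularValueSeq T s ∧ Memℓp s p}

end Operators

/-! ### The weighted slice Bergman space -/

theorem IsLeftSliceHyperholomorphic.zero (U : Set ℍ) :
    IsLeftSliceHyperholomorphic U (0 : ℍ → ℍ) := by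
  refine ⟨differentiableOn_const 0, fun _ _ => 0, fun _ _ => 0, fun I x₀ x₁ _ => ?_⟩
  refine ⟨by simp, by simp, by simp, 0, 0, ?_⟩
  rw [neg_zero]
  exact ⟨hasDerivAt_const x₀ (0 : ℍ), hasDerivAt_const x₁ (0 : ℍ), hasDerivAt_const x₀ (0 : ℍ),
    hasDerivAt_const x₁ (0 : ℍ)⟩

theorem IsLeftSliceHyperholomorphic.add {U : Set ℍ} {f g : ℍ → ℍ}
    (hf : IsLeftSliceHyperholomorphic U f) (hg : IsLeftSliceHyperholomorphic U g) :
    IsLeftSliceHyperholomorphic U (f + g) := by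
  obtain ⟨hfd, a, b, h⟩ := hf
  obtain ⟨hgd, a', b', h'⟩ := hg
  refine ⟨hfd.add hgd, fun s t => a s t + a' s t, fun s t => b s t + b' s t,
    fun I x₀ x₁ hx => ?_⟩
  obtain ⟨h1, h2, h3, d, e, h4, h5, h6, h7⟩ := h I x₀ x₁ hx
  obtain ⟨h1', h2', h3', d', e', h4', h5', h6', h7'⟩ := h' I x₀ x₁ hx
  refine ⟨?_, by simp only [h2, h2'], by simp only [h3, h3', neg_add], d + d', e + e', h4.add h4', h5.add h5',
    h6.add h6', ?_⟩
  · simp only [Pi.add_apply, h1, h1', mul_add]; abel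
  · rw [neg_add]; exact h7.add h7'

theorem IsLeftSliceHyperholomorphic.mul_right {U : Set ℍ} {f : ℍ → ℍ}
    (hf : IsLeftSliceHyperholomorphic U f) (c : ℍ) :
    IsLeftSliceHyperholomorphic U (fun x => f x * c) := by
  obtain ⟨hfd, a, b, h⟩ := hf
  refine ⟨hfd.mul_const c, fun s t => a s t * c, fun s t => b s t * c,
    fun I x₀ x₁ hx => ?_⟩
  obtain ⟨h1, h2, h3, d, e, h4, h5, h6, h7⟩ := h I x₀ x₁ hx
  refine ⟨?_, by simp only [h2], by simp only [h3, neg_mul], d * c, e * c, h4.mul_const c, h5.mul_const c,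
    h6.mul_const c, ?_⟩
  · simp only [h1, add_mul, mul_assoc]
  · rw [← neg_mul]; exact h7.mul_const c

/-- The left slice hyperholomorphic functions `f` on the unit ball with
`∫ |f|² dA_{α,i} < ∞` over the unit disk of the slice of `i`, as a right quaternionic vector
space. A function on the unit ball is represented by its extension by `0`. -/
def bergmanSubmodule (α : ℝ) (i : ImUnit) : Submodule ℍᵐᵒᵖ (ℍ → ℍ) where
  carrier := {f | (∀ x, x ∉ unitBall → f x = 0) ∧ IsLeftSliceHyperholomorphic unitBall f ∧
    MemLp (fun z => f (slicePt i z)) 2 (diskMeasure α)}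
  zero_mem' := ⟨fun _ _ => rfl, .zero _, MemLp.zero⟩
  add_mem' := by
    rintro f g ⟨h1, h2, h3⟩ ⟨h1', h2', h3'⟩
    exact ⟨fun x hx => by simp [h1 x hx, h1' x hx], h2.add h2', h3.add h3'⟩
  smul_mem' := by
    rintro c f ⟨h1, h2, h3⟩
    refine ⟨fun x hx => by simp [h1 x hx], h2.mul_right c.unop, ?_⟩
    exact ((ContinuousLinearMap.mul ℝ ℍ).flip c.unop).comp_memLp' h3

/-- The weighted slice Bergman space `A²_{α,i}` of the quaternionic unit ball. -/
def Bergman (α : ℝ) (i : ImUnit) : Type := bergmanSubmodule α i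

namespace Bergman

variable {α : ℝ} {i : ImUnit}

instance : AddCommGroup (Bergman α i) := inferInstanceAs (AddCommGroup (bergmanSubmodule α i))

instance : Module ℍᵐᵒᵖ (Bergman α i) := inferInstanceAs (Module ℍᵐᵒᵖ (bergmanSubmodule α i))

instance : Module ℝ (Bergman α i) := inferInstanceAs (Module ℝ (bergmanSubmodule α i))

instance : CoeFun (Bergman α i) (fun _ => ℍ → ℍ) := ⟨fun f => f.1⟩

@[ext] theorem ext {f g : Bergman α i} (h : ∀ x, f x = g x) : f = g := Subtype.ext (funext h)

theorem add_apply (f g : Bergman α i) (x : ℍ) : (f + g) x = f x + g x := rfl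

theorem smul_apply (c : ℍᵐᵒᵖ) (f : Bergman α i) (x : ℍ) : (c • f) x = f x * c.unop := rfl

theorem real_smul_apply (c : ℝ) (f : Bergman α i) (x : ℍ) : (c • f) x = c • f x := rfl

/-- The scalar product `∫ conj (f z) * g z dA_{α,i}(z)`. -/
def qinner (f g : Bergman α i) : ℍ :=
  ∫ z, star (f (slicePt i z)) * g (slicePt i z) ∂(diskMeasure α)

theorem integrable_qinner (f g : Bergman α i) :
    Integrable (fun z => star (f (slicePt i z)) * g (slicePt i z)) (diskMeasure α) := by
  have hf : MemLp (fun z => star (f (slicePt i z))) 2 (diskMeasure α) := by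
    refine f.2.2.2.of_le (continuous_star.comp_aestronglyMeasurable f.2.2.2.1) ?_
    exact Filter.Eventually.of_forall fun z => by simp
  exact memLp_one_iff_integrable.1 (g.2.2.2.mul' hf)

theorem qinner_add_right (f g h : Bergman α i) : qinner f (g + h) = qinner f g + qinner f h := by
  unfold qinner
  rw [← integral_add (integrable_qinner f g) (integrable_qinner f h)]
  simp only [add_apply, mul_add]

theorem qinner_smul_right (f g : Bergman α i) (a : ℍ) : qinner f (op a • g) = qinner f g * a := by
  have := ((ContinuousLinearMap.mul ℝ ℍ).flip a).integral_comp_comm (integrable_qinner f g)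
  simp only [ContinuousLinearMap.flip_apply, ContinuousLinearMap.mul_apply'] at this
  unfold qinner
  rw [← this]
  simp only [smul_apply, unop_op, mul_assoc]

theorem qinner_conj_symm (f g : Bergman α i) : star (qinner g f) = qinner f g := by
  let L : ℍ →L[ℝ] ℍ :=
    { toFun := star
      map_add' := star_add
      map_smul' := fun r x => Quaternion.star_smul r x
      cont := continuous_star }
  have h := L.integral_comp_comm (integrable_qinner g f)
  have hL : ∀ x, L x = star x := fun _ => rfl
  simp only [hL, star_mul, star_star] at h
  unfold qinner
  exact h.symm

theorem qinner_self (f : Bergman α i) :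
    qinner f f = ((∫ z, ‖f (slicePt i z)‖ ^ 2 ∂(diskMeasure α) : ℝ) : ℍ) := by
  unfold qinner
  have h : ∀ q : ℍ, star q * q = ((‖q‖ ^ 2 : ℝ) : ℍ) := fun q => by
    rw [Quaternion.star_mul_self, Quaternion.normSq_eq_norm_mul_self, sq]
  have h' : ∀ r : ℝ, (r : ℍ) = r • (1 : ℍ) := fun r => by ext <;> simp
  simp only [h, h']
  exact integral_smul_const _ _

theorem continuous_slicePt (I : ImUnit) : Continuous (slicePt I) := by
  unfold slicePt
  have : Continuous fun z : ℂ => ((z.re : ℝ) : ℍ) :=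
    Quaternion.continuous_coe.comp Complex.continuous_re
  fun_prop

theorem norm_slicePt (I : ImUnit) (z : ℂ) : ‖slicePt I z‖ = ‖z‖ := by
  have hI : (I : ℍ).re = 0 := I.2.1
  have h2 : Quaternion.normSq (I : ℍ) = 1 := by
    rw [Quaternion.normSq_eq_norm_mul_self, I.2.2, one_mul]
  rw [Quaternion.normSq_def', hI] at h2
  have h1 : Quaternion.normSq (slicePt I z) = ‖z‖ * ‖z‖ := by
    rw [Quaternion.normSq_def', Complex.norm_mul_self_eq_normSq, Complex.normSq_apply]
    simp only [slicePt, Quaternion.re_add, Quaternion.re_coe, Quaternion.re_smul, hI,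
      Quaternion.imI_add, Quaternion.imI_coe, Quaternion.imI_smul, Quaternion.imJ_add,
      Quaternion.imJ_coe, Quaternion.imJ_smul, Quaternion.imK_add,
      Quaternion.imK_coe, Quaternion.imK_smul, smul_eq_mul]
    linear_combination z.im ^ 2 * h2
  rw [Quaternion.normSq_eq_norm_mul_self] at h1
  exact (mul_self_inj_of_nonneg (norm_nonneg _) (norm_nonneg _)).1 h1

theorem slicePt_mem {I : ImUnit} {z : ℂ} : slicePt I z ∈ unitBall ↔ z ∈ Metric.ball (0 : ℂ) 1 := by
  simp [norm_slicePt]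

/-- Every quaternion lies on a slice. -/
theorem exists_slicePt (i : ImUnit) (x : ℍ) : ∃ I : ImUnit, x = slicePt I (sliceCoord x) ∧
    (x.im ≠ 0 → (I : ℍ) = unitOf x) := by
  by_cases h : x.im = 0
  · refine ⟨i, ?_, fun h' => absurd h h'⟩
    rw [slicePt, sliceCoord, h]
    simpa [h] using (Quaternion.re_add_im x).symm
  · have h' : ‖x.im‖ ≠ 0 := norm_ne_zero_iff.2 h
    refine ⟨⟨unitOf x, ?_, ?_⟩, ?_, fun _ => rfl⟩
    · simp [unitOf]
    · rw [unitOf, norm_smul, norm_inv, norm_norm, inv_mul_cancel₀ h']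
    · simp only [slicePt, sliceCoord, unitOf, smul_smul, mul_inv_cancel₀ h', one_smul]
      exact (Quaternion.re_add_im x).symm

theorem slice_conj {f : ℍ → ℍ} (hf : IsLeftSliceHyperholomorphic unitBall f) :
    ∃ a b : ℂ → ℍ, ∀ z ∈ Metric.ball (0 : ℂ) 1, b (star z) = - b z ∧ ∀ I : ImUnit,
      f (slicePt I z) = a z + I * b z ∧ f (slicePt I (star z)) = a z - I * b z := by
  obtain ⟨-, a, b, h⟩ := hf
  refine ⟨fun z => a z.re z.im, fun z => b z.re z.im, fun z hz => ?_⟩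
  have key : ∀ I : ImUnit, f (slicePt I z) = a z.re z.im + I * b z.re z.im ∧
      f (slicePt I (star z)) = a z.re z.im - I * b z.re z.im ∧
      b z.re (-z.im) = - b z.re z.im := fun I => by
    obtain ⟨h1, h2, h3, -⟩ := h I z.re z.im (slicePt_mem.2 hz)
    have hz' : star z ∈ Metric.ball (0 : ℂ) 1 := by simpa using hz
    obtain ⟨h4, -⟩ := h I (star z).re (star z).im (slicePt_mem.2 hz')
    have e : (star z).re = z.re := rfl
    have e' : (star z).im = -z.im := rfl
    refine ⟨h1, ?_, h3⟩
    calc f (slicePt I (star z)) = a (star z).re (star z).im + I * b (star z).re (star z).im := h4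
      _ = _ := by rw [e, e', h2, h3, mul_neg, sub_eq_add_neg]
  refine ⟨?_, fun I => ⟨(key I).1, (key I).2.1⟩⟩
  let q : ℍ := ⟨0, 1, 0, 0⟩
  have hq : ‖q‖ * ‖q‖ = 1 := by
    rw [← Quaternion.normSq_eq_norm_mul_self, Quaternion.normSq_def']; simp [q]
  exact (key ⟨q, rfl, by nlinarith [norm_nonneg q]⟩).2.2

theorem ImUnit.mul_self (I : ImUnit) : (I : ℍ) * I = -1 := by
  have h : star (I : ℍ) = -I := by
    have := I.2.1
    ext <;> simp [this]
  have h2 : (I : ℍ) * star (I : ℍ) = 1 := by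
    rw [Quaternion.self_mul_star, Quaternion.normSq_eq_norm_mul_self, I.2.2]; simp
  rw [h, mul_neg] at h2
  rw [← h2, neg_neg]

theorem eq_zero_of_slice (f : Bergman α i)
    (h : ∀ z ∈ Metric.ball (0 : ℂ) 1, f (slicePt i z) = 0) : f = 0 := by
  refine Bergman.ext fun x => ?_
  change f x = 0
  by_cases hx : x ∈ unitBall
  · obtain ⟨a, b, hab⟩ := slice_conj f.2.2.1
    obtain ⟨I, hI, -⟩ := exists_slicePt i x
    have hz : sliceCoord x ∈ Metric.ball (0 : ℂ) 1 := by rwa [hI, slicePt_mem] at hx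
    have hz' : star (sliceCoord x) ∈ Metric.ball (0 : ℂ) 1 := by simpa using hz
    obtain ⟨-, h1⟩ := hab _ hz
    have e1 := (h1 i).1.symm.trans (h _ hz)
    have e2 := (h1 i).2.symm.trans (h _ hz')
    have ea : a (sliceCoord x) = 0 := by
      have := congrArg₂ (· + ·) e1 e2
      simp only [add_zero, add_add_sub_cancel] at this
      rw [← two_smul ℝ] at this
      exact (smul_eq_zero.1 this).resolve_left two_ne_zero
    rw [ea, zero_add] at e1
    have hi : (i : ℍ) ≠ 0 := norm_ne_zero_iff.1 (by rw [i.2.2]; exact one_ne_zero)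
    have eb := (mul_eq_zero.1 e1).resolve_left hi
    have := (h1 I).1
    rw [← hI, ea, eb] at this
    simpa using this
  · exact f.2.1 x hx

theorem continuousOn_slice (f : Bergman α i) :
    ContinuousOn (fun z => f (slicePt i z)) (Metric.ball (0 : ℂ) 1) :=
  f.2.2.1.1.continuousOn.comp (continuous_slicePt i).continuousOn fun _ hz => slicePt_mem.2 hz

theorem eq_zero_of_integral (hα : -1 < α) (f : Bergman α i)
    (h : ∫ z, ‖f (slicePt i z)‖ ^ 2 ∂(diskMeasure α) = 0) : f = 0 := by
  have h1 : Integrable (fun z => ‖f (slicePt i z)‖ ^ 2) (diskMeasure α) :=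
    f.2.2.2.integrable_norm_pow two_ne_zero
  have h2 := (integral_eq_zero_iff_of_nonneg (fun z => by positivity) h1).1 h
  have hm : Measurable fun z : ℂ =>
      ENNReal.ofReal ((α + 1) / Real.pi * (1 - ‖z‖ ^ 2) ^ α) := by fun_prop
  have h3 := (ae_withDensity_iff hm).1 h2
  have h4 : ∀ᵐ z ∂(volume.restrict (Metric.ball (0 : ℂ) 1)), f (slicePt i z) = 0 := by
    filter_upwards [h3, ae_restrict_mem Metric.isOpen_ball.measurableSet] with z hz hz'
    have hz1 : ‖z‖ < 1 := by simpa using hz'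
    have : 0 < (α + 1) / Real.pi * (1 - ‖z‖ ^ 2) ^ α :=
      mul_pos (div_pos (by linarith) Real.pi_pos)
        (Real.rpow_pos_of_pos (by nlinarith [norm_nonneg z]) _)
    simpa using hz (by simpa using this)
  refine eq_zero_of_slice f ?_
  exact Measure.eqOn_open_of_ae_eq h4 Metric.isOpen_ball (continuousOn_slice f) continuousOn_const

section HilbertSpace

variable [hα : Fact (-1 < α)]

/-- The real inner product `Re ⟨f, g⟩`. -/
@[reducible]
def core : InnerProductSpace.Core ℝ (Bergman α i) where
  inner f g := (qinner f g).re
  conj_inner_symm f g := by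
    rw [← qinner_conj_symm f g]; simp
  re_inner_nonneg f := by
    rw [qinner_self]
    exact integral_nonneg fun z => by positivity
  add_left f g h := by
    rw [← qinner_conj_symm, qinner_add_right, ← qinner_conj_symm f, ← qinner_conj_symm g]; simp
  smul_left f g r := by
    have h : r • f = op (r : ℍ) • f := Bergman.ext fun x => by
      rw [real_smul_apply, smul_apply, unop_op, Quaternion.mul_coe_eq_smul]
    rw [h, ← qinner_conj_symm, qinner_smul_right, ← qinner_conj_symm f]
    simp
  definite f hf := by
    rw [qinner_self] at hf
    exact eq_zero_of_integral hα.out f hf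

/-- The norm `‖f‖ = ⟨f, f⟩^(1/2) = (∫ |f|² dA_{α,i})^(1/2)`. -/
instance : NormedAddCommGroup (Bergman α i) := core.toNormedAddCommGroup

theorem norm_sq (f : Bergman α i) : ‖f‖ ^ 2 = ∫ z, ‖f (slicePt i z)‖ ^ 2 ∂(diskMeasure α) := by
  have h : ‖f‖ = √((qinner f f).re) := rfl
  rw [h, qinner_self, Quaternion.re_coe, Real.sq_sqrt]
  exact integral_nonneg fun z => by positivity

instance : QInner (Bergman α i) where
  qinner := qinner
  add_right := qinner_add_right
  smul_right := qinner_smul_right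
  conj_symm := qinner_conj_symm
  inner_self f := by rw [qinner_self, norm_sq]

end HilbertSpace

/-! ### The left multiplication by `i` on a slice -/

theorem slicePt_im (I : ImUnit) (z : ℂ) : (slicePt I z).im = z.im • (I : ℍ) := by
  have := I.2.1
  ext <;> simp [slicePt, this]

theorem slicePt_re (I : ImUnit) (z : ℂ) : (slicePt I z).re = z.re := by
  simp [slicePt, I.2.1]

theorem star_slicePt (I : ImUnit) (z : ℂ) : star (slicePt I z) = slicePt I (star z) := by
  have := I.2.1
  ext <;> simp [slicePt, this]

theorem eq_zero_of_self_eq_neg {q : ℍ} (h : q = -q) : q = 0 := by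
  have h2 : (2 : ℝ) • q = 0 := by rw [two_smul]; nth_rewrite 1 [h]; exact neg_add_cancel q
  exact (smul_eq_zero.1 h2).resolve_left two_ne_zero

theorem sliceExt_left_mul (f : Bergman α i) {a b : ℂ → ℍ}
    (hab : ∀ z ∈ Metric.ball (0 : ℂ) 1, b (star z) = - b z ∧ ∀ I : ImUnit,
      f (slicePt I z) = a z + I * b z ∧ f (slicePt I (star z)) = a z - I * b z)
    (I : ImUnit) {z : ℂ} (hz : z ∈ Metric.ball (0 : ℂ) 1) :
    sliceExt i (fun w => i * f (slicePt i w)) (slicePt I z) = i * a z + I * (i * b z) := by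
  obtain ⟨hb, h⟩ := hab z hz
  have hii := ImUnit.mul_self i
  have key : ∀ u v : ℍ, (2⁻¹ : ℝ) • ((1 - u * i) * (i * (a z + i * v))) +
      (2⁻¹ : ℝ) • ((1 + u * i) * (i * (a z - i * v))) = i * a z + u * (i * v) := by
    intro u v
    have e1 : ∀ w : ℍ, (i : ℍ) * (i * w) = -w := fun w => by rw [← mul_assoc, hii, neg_one_mul]
    have e2 : (1 - u * i) * (i * (a z + i * v)) + (1 + u * i) * (i * (a z - i * v)) =
        (2 : ℝ) • (i * a z + u * (i * v)) := by
      simp only [sub_mul, add_mul, one_mul, mul_assoc, mul_add, mul_sub, e1, mul_neg, two_smul]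
      abel
    rw [← smul_add, e2, smul_smul, inv_mul_cancel₀ two_ne_zero, one_smul]
  have hn : ‖(slicePt I z).im‖ = |z.im| := by
    rw [slicePt_im, norm_smul, I.2.2, mul_one, Real.norm_eq_abs]
  rw [sliceExt, if_pos (slicePt_mem.2 hz)]
  rcases lt_trichotomy z.im 0 with h0 | h0 | h0
  · have hc : sliceCoord (slicePt I z) = star z := by
      apply Complex.ext
      · exact slicePt_re I z
      · change ‖(slicePt I z).im‖ = -z.im
        rw [hn, abs_of_neg h0]
    have hu : unitOf (slicePt I z) = -I := by
      rw [unitOf, hn, slicePt_im, smul_smul, abs_of_neg h0, inv_neg, neg_mul,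
        inv_mul_cancel₀ h0.ne, neg_one_smul]
    rw [hc, hu, star_star, (h i).1, (h i).2]
    have := key (-I) (-b z)
    simp only [mul_neg, ← sub_eq_add_neg, sub_neg_eq_add, neg_mul, neg_neg] at this
    simpa only [neg_mul, sub_neg_eq_add, ← sub_eq_add_neg] using this
  · have hz0 : star z = z := Complex.ext rfl (by simp [h0])
    have hb0 : b z = 0 := by
      rw [hz0] at hb
      exact eq_zero_of_self_eq_neg hb
    have hc : sliceCoord (slicePt I z) = z := by
      apply Complex.ext
      · exact slicePt_re I z
      · change ‖(slicePt I z).im‖ = z.im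
        rw [hn, h0, abs_zero]
    have hu : unitOf (slicePt I z) = 0 := by
      rw [unitOf, slicePt_im, h0, zero_smul, smul_zero]
    have := key 0 0
    rw [hc, hu, hz0, (h i).1, hb0]
    simpa only [mul_zero, add_zero, sub_zero, zero_mul] using this
  · have hc : sliceCoord (slicePt I z) = z := by
      apply Complex.ext
      · exact slicePt_re I z
      · change ‖(slicePt I z).im‖ = z.im
        rw [hn, abs_of_pos h0]
    have hu : unitOf (slicePt I z) = I := by
      rw [unitOf, hn, slicePt_im, smul_smul, abs_of_pos h0, inv_mul_cancel₀ h0.ne', one_smul]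
    rw [hc, hu, (h i).1, (h i).2]
    exact key I (b z)

/-- The imaginary part as a continuous linear map. -/
def imL : ℍ →L[ℝ] ℍ where
  toFun x := x.im
  map_add' x y := by ext <;> simp
  map_smul' r x := by ext <;> simp
  cont := Quaternion.continuous_im

/-- The real part as a continuous linear map. -/
def reL : ℍ →L[ℝ] ℝ where
  toFun x := x.re
  map_add' x y := by simp
  map_smul' r x := by simp
  cont := Quaternion.continuous_re

/-- Conjugation as a continuous linear map. -/
def starL : ℍ →L[ℝ] ℍ where
  toFun x := star x
  map_add' := star_add
  map_smul' r x := Quaternion.star_smul r x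
  cont := continuous_star

/-- The map `x₀ + i_x |im x| ↦ x₀ + i |im x|` onto the slice of `i`. -/
theorem slicePt_sliceCoord (i : ImUnit) (x : ℍ) :
    slicePt i (sliceCoord x) = reL x • (1 : ℍ) + ‖imL x‖ • (i : ℍ) := by
  have : ∀ r : ℝ, (r : ℍ) = r • (1 : ℍ) := fun r => by ext <;> simp
  rw [slicePt, this]; rfl

theorem differentiableOn_sliceExt (f : Bergman α i) :
    DifferentiableOn ℝ (sliceExt i (fun w => i * f (slicePt i w))) unitBall := by
  obtain ⟨a, b, hab⟩ := slice_conj f.2.2.1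
  have hfd : ∀ x ∈ unitBall, DifferentiableAt ℝ (f : ℍ → ℍ) x := fun x hx =>
    (f.2.2.1.1 x hx).differentiableAt (Metric.isOpen_ball.mem_nhds hx)
  have hstar : ∀ x : ℍ, x ∈ unitBall → starL x ∈ unitBall := fun x hx => by
    change star x ∈ unitBall
    simpa using hx
  have hfd' : ∀ x ∈ unitBall, DifferentiableAt ℝ (fun y => f (starL y)) x := fun x hx =>
    (hfd _ (hstar x hx)).comp x starL.differentiableAt
  let h : ℍ → ℍ := fun y => (2⁻¹ : ℝ) • (f y - f (starL y))
  have hh : ∀ x ∈ unitBall, DifferentiableAt ℝ h x := fun x hx =>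
    ((hfd x hx).sub (hfd' x hx)).const_smul (2⁻¹ : ℝ)
  let k : ℍ → ℍ := fun y => (2⁻¹ : ℝ) • (f y + f (starL y))
  have hk : ∀ x ∈ unitBall, DifferentiableAt ℝ k x := fun x hx =>
    ((hfd x hx).add (hfd' x hx)).const_smul (2⁻¹ : ℝ)
  let P : ℍ → ℍ := fun x => reL x • (1 : ℍ) + ‖imL x‖ • (i : ℍ)
  have hP : ∀ x ∈ unitBall, P x ∈ unitBall := fun x hx => by
    obtain ⟨I, hI, -⟩ := exists_slicePt i x
    rw [hI, slicePt_mem] at hx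
    have hPx : P x = slicePt i (sliceCoord x) := (slicePt_sliceCoord i x).symm
    rw [hPx]
    exact slicePt_mem.2 hx
  let G : ℍ → ℍ := fun x => (‖imL x‖⁻¹ • imL x) * h (P x)
  have hFG : ∀ x ∈ unitBall,
      sliceExt i (fun w => i * f (slicePt i w)) x = i * k x + G x := fun x hx => by
    obtain ⟨I, hI, hI'⟩ := exists_slicePt i x
    have hz : sliceCoord x ∈ Metric.ball (0 : ℂ) 1 := by rwa [hI, slicePt_mem] at hx
    obtain ⟨hb, h1⟩ := hab _ hz
    have e1 : sliceExt i (fun w => i * f (slicePt i w)) x =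
        i * a (sliceCoord x) + I * (i * b (sliceCoord x)) := by
      have := sliceExt_left_mul f hab I hz
      rwa [← hI] at this
    have e2 : k x = a (sliceCoord x) := by
      have hs : starL x = slicePt I (star (sliceCoord x)) := by
        rw [← star_slicePt, ← hI]; rfl
      have h3 := (h1 I).1
      rw [← hI] at h3
      change (2⁻¹ : ℝ) • (f x + f (starL x)) = _
      rw [hs, (h1 I).2, h3, add_add_sub_cancel, ← two_smul ℝ, smul_smul,
        inv_mul_cancel₀ two_ne_zero, one_smul]
    have e3 : h (P x) = i * b (sliceCoord x) := by
      have hPx : P x = slicePt i (sliceCoord x) := (slicePt_sliceCoord i x).symm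
      change (2⁻¹ : ℝ) • (f (P x) - f (star (P x))) = _
      rw [hPx, star_slicePt, (h1 i).1, (h1 i).2, add_sub_sub_cancel, ← two_smul ℝ, smul_smul,
        inv_mul_cancel₀ two_ne_zero, one_smul]
    have e4 : G x = I * (i * b (sliceCoord x)) := by
      change unitOf x * h (P x) = _
      rw [e3]
      by_cases h0 : x.im = 0
      · have hc : star (sliceCoord x) = sliceCoord x :=
          Complex.ext rfl (by simp [sliceCoord, h0])
        rw [hc] at hb
        rw [eq_zero_of_self_eq_neg hb]; simp
      · rw [hI' h0]
    rw [e1, e2, e4]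
  have hG : ∀ x ∈ unitBall, DifferentiableAt ℝ G x := fun x hx => by
    by_cases h0 : imL x = 0
    · have h0' : x.im = 0 := h0
      have hx' : ∀ y : ℍ, imL y = 0 → h y = 0 := fun y hy => by
        have hs : starL y = y := by
          have hy' : y.im = 0 := hy
          have := Quaternion.re_add_im y
          rw [hy', add_zero] at this
          change star y = y
          rw [← this, Quaternion.star_coe]
        change (2⁻¹ : ℝ) • (f y - f (starL y)) = 0
        rw [hs, sub_self, smul_zero]
      have hPx : P x = x := by
        have := Quaternion.re_add_im x
        rw [h0', add_zero] at this
        change reL x • (1 : ℍ) + ‖imL x‖ • (i : ℍ) = x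
        rw [h0, norm_zero, zero_smul, add_zero]
        conv_rhs => rw [← this]
        change x.re • (1 : ℍ) = _
        ext <;> simp
      obtain ⟨L, hL⟩ := hh x hx
      have hL1 : L 1 = 0 := by
        have hd : HasDerivAt (fun t : ℝ => h (x + t • (1 : ℍ))) (L 1) 0 := by
          have hc : HasDerivAt (fun t : ℝ => x + t • (1 : ℍ)) (1 : ℍ) 0 := by
            simpa using ((hasDerivAt_id (0 : ℝ)).smul_const (1 : ℍ)).const_add x
          have hL0 : HasFDerivAt h L ((fun t : ℝ => x + t • (1 : ℍ)) 0) := by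
            have : (fun t : ℝ => x + t • (1 : ℍ)) 0 = x := by simp
            rw [this]; exact hL
          exact HasFDerivAt.comp_hasDerivAt (l := h) (f := fun t : ℝ => x + t • (1 : ℍ)) (0 : ℝ)
            hL0 hc
        have hz : (fun t : ℝ => h (x + t • (1 : ℍ))) = fun _ => 0 := funext fun t => by
          apply hx'
          rw [map_add, h0, map_smul, zero_add]
          have : imL (1 : ℍ) = 0 := by
            change (1 : ℍ).im = 0
            ext <;> simp
          rw [this, smul_zero]
        rw [hz] at hd
        exact hd.unique (hasDerivAt_const _ _)
      refine ⟨((ContinuousLinearMap.mul ℝ ℍ).flip (L i)).comp imL, ?_⟩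
      have hPt : Filter.Tendsto P (nhds x) (nhds x) := by
        have : Continuous P := by
          change Continuous fun x => reL x • (1 : ℍ) + ‖imL x‖ • (i : ℍ)
          fun_prop
        simpa [hPx] using this.tendsto x
      have hPn : ∀ y, ‖P y - x‖ = ‖y - x‖ := fun y => by
        have e : P y - x = slicePt i ⟨reL (y - x), ‖imL (y - x)‖⟩ := by
          have e' := slicePt_sliceCoord i (y - x)
          change slicePt i (sliceCoord (y - x)) = _ at e'
          change _ = slicePt i (sliceCoord (y - x))
          rw [e', map_sub, map_sub, h0, sub_zero]
          conv_lhs => rw [← hPx]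
          change reL y • (1 : ℍ) + ‖imL y‖ • (i : ℍ) - (reL x • (1 : ℍ) + ‖imL x‖ • (i : ℍ)) = _
          rw [h0, norm_zero, zero_smul, add_zero, sub_smul]
          abel
        rw [e]
        obtain ⟨I, hI, -⟩ := exists_slicePt i (y - x)
        conv_rhs => rw [hI, norm_slicePt]
        rw [norm_slicePt]; rfl
      have hlo := hL.isLittleO.comp_tendsto hPt
      rw [hasFDerivAt_iff_isLittleO]
      have hlo2 : (fun y => h (P y) - h x - L (P y - x)) =o[nhds x] fun y => y - x :=
        hlo.trans_isBigO (Asymptotics.isBigO_of_le _ fun y => (hPn y).le)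
      refine Asymptotics.IsBigO.trans_isLittleO (Asymptotics.isBigO_of_le _ fun y => ?_) hlo2
      have hGx : G x = 0 := by
        change (‖imL x‖⁻¹ • imL x) * h (P x) = 0
        rw [h0, smul_zero, zero_mul]
      have hPy : P y - x = (reL (y - x)) • (1 : ℍ) + ‖imL y‖ • (i : ℍ) := by
        conv_lhs => rw [← hPx]
        change reL y • (1 : ℍ) + ‖imL y‖ • (i : ℍ) - (reL x • (1 : ℍ) + ‖imL x‖ • (i : ℍ)) = _
        rw [h0, norm_zero, zero_smul, add_zero, map_sub, sub_smul]
        abel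
      have e : G y - G x - (((ContinuousLinearMap.mul ℝ ℍ).flip (L i)).comp imL) (y - x) =
          (‖imL y‖⁻¹ • imL y) * (h (P y) - h x - L (P y - x)) := by
        rw [hGx, hx' x h0, hPy, map_add, map_smul, map_smul, hL1, smul_zero, zero_add, sub_zero,
          sub_zero, mul_sub]
        change G y - imL (y - x) * L i = G y - _
        rw [map_sub, h0, sub_zero, mul_smul_comm, smul_mul_assoc, smul_smul]
        by_cases hy : imL y = 0
        · simp [hy]
        · rw [mul_inv_cancel₀ (norm_ne_zero_iff.2 hy), one_smul]
      rw [e, norm_mul]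
      refine mul_le_of_le_one_left (norm_nonneg _) ?_
      rw [norm_smul, norm_inv, norm_norm]
      exact inv_mul_le_one
    · have hn : DifferentiableAt ℝ (fun y => ‖imL y‖) x :=
        (imL.differentiableAt (x := x)).norm ℝ h0
      have hPd : DifferentiableAt ℝ P x :=
        (reL.differentiableAt.smul_const _).add (hn.smul_const _)
      have h1 : DifferentiableAt ℝ (fun y => h (P y)) x :=
        (hh (P x) (hP x hx)).comp x hPd
      exact ((hn.inv (norm_ne_zero_iff.2 h0)).smul imL.differentiableAt).mul h1
  intro x hx
  refine DifferentiableWithinAt.congr (f := fun x => i * k x + G x) ?_ hFG (hFG x hx)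
  exact (((hk x hx).const_mul _).add (hG x hx)).differentiableWithinAt

theorem sliceExt_slicePt (f : Bergman α i) {z : ℂ} (hz : z ∈ Metric.ball (0 : ℂ) 1) :
    sliceExt i (fun w => i * f (slicePt i w)) (slicePt i z) = i * f (slicePt i z) := by
  obtain ⟨a, b, hab⟩ := slice_conj f.2.2.1
  rw [sliceExt_left_mul f hab i hz, ((hab z hz).2 i).1, mul_add]

theorem sliceExt_mem (f : Bergman α i) :
    sliceExt i (fun w => i * f (slicePt i w)) ∈ bergmanSubmodule α i := by
  refine ⟨fun x hx => if_neg hx, ⟨differentiableOn_sliceExt f, ?_⟩, ?_⟩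
  · obtain ⟨-, a, b, h⟩ := f.2.2.1
    have hab : ∀ z ∈ Metric.ball (0 : ℂ) 1, b z.re (-z.im) = - b z.re z.im ∧ ∀ I : ImUnit,
        f (slicePt I z) = a z.re z.im + I * b z.re z.im ∧
        f (slicePt I (star z)) = a z.re z.im - I * b z.re z.im := fun z hz => by
      have hz' : star z ∈ Metric.ball (0 : ℂ) 1 := by simpa using hz
      refine ⟨(h i z.re z.im (slicePt_mem.2 hz)).2.2.1, fun I => ?_⟩
      obtain ⟨h1, h2, h3, -⟩ := h I z.re z.im (slicePt_mem.2 hz)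
      obtain ⟨h4, -⟩ := h I z.re (-z.im) (slicePt_mem.2 hz')
      refine ⟨h1, ?_⟩
      rw [h2, h3, mul_neg, ← sub_eq_add_neg] at h4
      exact h4
    refine ⟨fun s t => i * a s t, fun s t => i * b s t, fun I x₀ x₁ hx => ?_⟩
    obtain ⟨h1, h2, h3, d, e, h4, h5, h6, h7⟩ := h I x₀ x₁ hx
    refine ⟨sliceExt_left_mul f (a := fun z => a z.re z.im) (b := fun z => b z.re z.im) hab I
      (slicePt_mem.1 hx), by simp only [h2], by simp only [h3, mul_neg], i * d, i * e,
      h4.const_mul _, h5.const_mul _, h6.const_mul _, ?_⟩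
    rw [← mul_neg]; exact h7.const_mul _
  · have h1 : MemLp (fun z => i * f (slicePt i z)) 2 (diskMeasure α) :=
      (ContinuousLinearMap.mul ℝ ℍ (i : ℍ)).comp_memLp' f.2.2.2
    refine h1.ae_eq ?_
    have hac : diskMeasure α ≪ volume.restrict (Metric.ball (0 : ℂ) 1) :=
      withDensity_absolutelyContinuous _ _
    refine hac.ae_le ?_
    filter_upwards [ae_restrict_mem Metric.isOpen_ball.measurableSet] with z hz
    exact (sliceExt_slicePt f hz).symm

theorem eq_of_slice {f g : Bergman α i}
    (h : ∀ z ∈ Metric.ball (0 : ℂ) 1, f (slicePt i z) = g (slicePt i z)) : f = g := by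
  rw [← sub_eq_zero]
  exact eq_zero_of_slice _ fun z hz => sub_eq_zero.2 (h z hz)

/-- The function `ext (i f_i)`: multiply the restriction of `f` to the slice of `i` by `i` from the
left, and extend. -/
def leftMul (f : Bergman α i) : Bergman α i :=
  ⟨sliceExt i (fun w => i * f (slicePt i w)), sliceExt_mem f⟩

theorem leftMul_slicePt (f : Bergman α i) {z : ℂ} (hz : z ∈ Metric.ball (0 : ℂ) 1) :
    leftMul f (slicePt i z) = i * f (slicePt i z) := sliceExt_slicePt f hz

theorem leftMul_add (f g : Bergman α i) : leftMul (f + g) = leftMul f + leftMul g :=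
  eq_of_slice fun z hz => by
    rw [add_apply, leftMul_slicePt _ hz, leftMul_slicePt _ hz, leftMul_slicePt _ hz, add_apply,
      mul_add]

theorem leftMul_smul (c : ℍᵐᵒᵖ) (f : Bergman α i) : leftMul (c • f) = c • leftMul f :=
  eq_of_slice fun z hz => by
    rw [smul_apply, leftMul_slicePt _ hz, leftMul_slicePt _ hz, smul_apply, mul_assoc]

theorem norm_leftMul [Fact (-1 < α)] (f : Bergman α i) : ‖leftMul f‖ = ‖f‖ := by
  refine (sq_eq_sq₀ (norm_nonneg _) (norm_nonneg _)).1 ?_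
  rw [norm_sq, norm_sq]
  refine integral_congr_ae ?_
  have hac : diskMeasure α ≪ volume.restrict (Metric.ball (0 : ℂ) 1) :=
    withDensity_absolutelyContinuous _ _
  refine hac.ae_le ?_
  filter_upwards [ae_restrict_mem Metric.isOpen_ball.measurableSet] with z hz
  rw [leftMul_slicePt _ hz, norm_mul, i.2.2, one_mul]

/-- The operator `J f = ext (i f_i)` on the Bergman space. -/
def J (α : ℝ) [Fact (-1 < α)] (i : ImUnit) : Bergman α i →L[ℍᵐᵒᵖ] Bergman α i where
  toFun := leftMul
  map_add' := leftMul_add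
  map_smul' := leftMul_smul
  cont := AddMonoidHomClass.continuous_of_bound (AddMonoidHom.mk' leftMul leftMul_add) 1
    fun f => by rw [one_mul]; exact (norm_leftMul f).le

/-- `J` is unitary and anti-selfadjoint. -/
theorem J_unitary_antiselfadjoint [Fact (-1 < α)] : IsAdjoint (J α i) (-J α i) ∧
    (J α i) ∘L (-J α i) = ContinuousLinearMap.id ℍᵐᵒᵖ (Bergman α i) := by
  have hstar : star (i : ℍ) = -i := by
    have := i.2.1
    ext <;> simp [this]
  have hac : diskMeasure α ≪ volume.restrict (Metric.ball (0 : ℂ) 1) :=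
    withDensity_absolutelyContinuous _ _
  constructor
  · intro f g
    refine integral_congr_ae (hac.ae_le ?_)
    filter_upwards [ae_restrict_mem Metric.isOpen_ball.measurableSet] with z hz
    change star (-(leftMul f (slicePt i z))) * g (slicePt i z) =
      star (f (slicePt i z)) * leftMul g (slicePt i z)
    rw [leftMul_slicePt _ hz, leftMul_slicePt _ hz, star_neg, star_mul, hstar]
    simp [mul_assoc]
  · refine ContinuousLinearMap.ext fun f => eq_of_slice fun z hz => ?_
    change leftMul (-leftMul f) (slicePt i z) = f (slicePt i z)
    rw [leftMul_slicePt _ hz]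
    change (i : ℍ) * -(leftMul f (slicePt i z)) = _
    rw [leftMul_slicePt _ hz, mul_neg, ← mul_assoc, ImUnit.mul_self]
    simp

/-! ### Berezin transform -/

section Berezin

variable [Fact (-1 < α)]

/-- The reproducing kernel `K_q` for `q` in the unit ball: the unique element of the Bergman space
that represents the evaluation at `q`, i.e. `f q = ⟨K_q, f⟩` for all `f`. It exists by the Riesz
representation theorem, because the evaluation at `q` is a bounded right linear functional. -/
def kernel (α : ℝ) [Fact (-1 < α)] (i : ImUnit) (q : ℍ) : Bergman α i :=
  Classical.epsilon fun K => ∀ f : Bergman α i, f q = QInner.qinner K f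

/-- The normalized reproducing kernel `k_q = K_q / √K_q(q)`. -/
def normalizedKernel (α : ℝ) [Fact (-1 < α)] (i : ImUnit) (q : ℍ) : Bergman α i :=
  (√(kernel α i q q).re)⁻¹ • kernel α i q

/-- The Berezin transform `T~ (q) = ⟨k_q, T k_q⟩` at the point `q` of the slice of `i` with
coordinate `z`. -/
def berezin (T : Bergman α i →L[ℍᵐᵒᵖ] Bergman α i) (z : ℂ) : ℍ :=
  QInner.qinner (normalizedKernel α i (slicePt i z)) (T (normalizedKernel α i (slicePt i z)))

end Berezin

end Bergman

end SliceBergman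

end

/-!
A singular value decomposition `T = ∑ sₙ fₙ ⟨eₙ, ·⟩` gives
`T~(z) = ∑ sₙ ⟨k_z, fₙ⟩ ⟨eₙ, k_z⟩` for the Berezin transform. For an orthonormal sequence, the
weights `|⟨k_z, eₙ⟩|²` have sum at most `‖k_z‖² = 1` by Bessel's inequality, and each of them has
the integral `‖eₙ‖² / (α + 1)` with respect to the Möbius invariant measure, because the reproducing
kernel is `(1 - |z|²)^(-(α + 2))` on the diagonal. By Jensen's inequality,
`∫ |T~|^p ≤ (α + 1)⁻¹ ∑ sₙ^p` for `p ≥ 1`, and the reverse for positive `T` and `p ≤ 1`.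

In the second case the decomposition has to be found first. The Berezin transform is bounded, so
that it is integrable when it is in `L^p` for some `p ≤ 1`. Integrating
`∑ |⟨k_z, T eₙ⟩|² ≤ ‖T k_z‖² ≤ ‖T‖ T~(z)` over `z` shows that `∑ ‖T eₙ‖²` is bounded: `T` is a
Hilbert-Schmidt operator, hence compact, and the spectral theorem applies.

The reproducing kernel is the power series whose coefficients are the reciprocals of the moments
`∫ |z|^(2n) dA_α`; these reciprocals are the Taylor coefficients of `(1 - t)^(-(α + 2))`.
-/

noncomputable section

namespace SliceBergman

/-! ### Quaternionic inner product spaces -/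

section QuaternionicHilbert

open QInner Filter Topology

variable {H : Type*} [NormedAddCommGroup H] [Module ℍᵐᵒᵖ H] [QInner H]

theorem star_mul_self_eq_norm_sq (a : ℍ) : star a * a = ((‖a‖ ^ 2 : ℝ) : ℍ) := by
  rw [Quaternion.star_mul_self, Quaternion.normSq_eq_norm_mul_self, sq]

theorem abs_re_le_norm (a : ℍ) : |a.re| ≤ ‖a‖ := by
  have h : ‖a‖ * ‖a‖ = a.re ^ 2 + a.imI ^ 2 + a.imJ ^ 2 + a.imK ^ 2 := by
    rw [← Quaternion.normSq_eq_norm_mul_self, Quaternion.normSq_def']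
  refine abs_le_of_sq_le_sq ?_ (norm_nonneg a)
  nlinarith [sq_nonneg a.imI, sq_nonneg a.imJ, sq_nonneg a.imK]

theorem qinner_add_left (x y z : H) : qinner (x + y) z = qinner x z + qinner y z := by
  rw [← conj_symm, add_right, star_add, conj_symm, conj_symm]

theorem qinner_smul_left (x y : H) (a : ℍ) : qinner (op a • x) y = star a * qinner x y := by
  rw [← conj_symm, smul_right, star_mul, conj_symm]

/-- The scalar product as an additive map in its second argument, which it is linear in. -/
def qinnerRight (x : H) : H →+ ℍ := AddMonoidHom.mk' (qinner x) (add_right x)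

/-- The scalar product as an additive map in its first argument, which it is conjugate linear in. -/
def qinnerLeft (y : H) : H →+ ℍ :=
  AddMonoidHom.mk' (fun x => qinner x y) fun x z => qinner_add_left x z y

@[simp] theorem qinner_zero_right (x : H) : qinner x 0 = 0 := map_zero (qinnerRight x)

@[simp] theorem qinner_zero_left (x : H) : qinner 0 x = 0 := map_zero (qinnerLeft x)

theorem qinner_sub_right (x y z : H) : qinner x (y - z) = qinner x y - qinner x z :=
  map_sub (qinnerRight x) y z

theorem qinner_sub_left (x y z : H) : qinner (x - y) z = qinner x z - qinner y z :=
  map_sub (qinnerLeft z) x y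

theorem qinner_sum_right {ι : Type*} (x : H) (F : Finset ι) (u : ι → H) :
    qinner x (∑ n ∈ F, u n) = ∑ n ∈ F, qinner x (u n) := map_sum (qinnerRight x) u F

theorem qinner_sum_left {ι : Type*} (x : H) (F : Finset ι) (u : ι → H) :
    qinner (∑ n ∈ F, u n) x = ∑ n ∈ F, qinner (u n) x := map_sum (qinnerLeft x) u F

theorem norm_sq_eq_re (x : H) : ‖x‖ ^ 2 = (qinner x x).re := by rw [inner_self, Quaternion.re_coe]

theorem re_qinner_comm (x y : H) : (qinner x y).re = (qinner y x).re := by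
  rw [← conj_symm, Quaternion.re_star]

theorem norm_qinner_comm (x y : H) : ‖qinner x y‖ = ‖qinner y x‖ := by
  rw [← conj_symm, norm_star]

theorem norm_add_sq (x y : H) : ‖x + y‖ ^ 2 = ‖x‖ ^ 2 + 2 * (qinner x y).re + ‖y‖ ^ 2 := by
  simp only [norm_sq_eq_re, add_right, qinner_add_left, Quaternion.re_add, re_qinner_comm y x]
  ring

theorem norm_sub_sq (x y : H) : ‖x - y‖ ^ 2 = ‖x‖ ^ 2 - 2 * (qinner x y).re + ‖y‖ ^ 2 := by
  simp only [norm_sq_eq_re, qinner_sub_right, qinner_sub_left, Quaternion.re_sub,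
    re_qinner_comm y x]
  ring

theorem norm_op_smul (a : ℍ) (x : H) : ‖op a • x‖ = ‖x‖ * ‖a‖ := by
  have h : qinner (op a • x) (op a • x) = (((‖x‖ * ‖a‖) ^ 2 : ℝ) : ℍ) := by
    rw [smul_right, qinner_smul_left, inner_self, mul_assoc, Quaternion.coe_commutes, ← mul_assoc,
      star_mul_self_eq_norm_sq, ← Quaternion.coe_mul, ← mul_pow, mul_comm]
  rw [← sq_eq_sq₀ (norm_nonneg _) (by positivity), norm_sq_eq_re, h, Quaternion.re_coe]

theorem continuous_op_smul (x : H) : Continuous fun a : ℍ => op a • x :=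
  AddMonoidHomClass.continuous_of_bound
    (AddMonoidHom.mk' (fun a : ℍ => op a • x) fun a b => by rw [op_add, add_smul]) ‖x‖
    fun a => (norm_op_smul a x).le

theorem exists_norm_apply_le (T : H →L[ℍᵐᵒᵖ] H) : ∃ M : ℝ, 0 ≤ M ∧ ∀ x, ‖T x‖ ≤ M * ‖x‖ := by
  obtain ⟨δ, hδ, h⟩ := Metric.continuousAt_iff.1 (T.continuous.continuousAt (x := 0)) 1 one_pos
  refine ⟨2 / δ, by positivity, fun x => ?_⟩
  rcases eq_or_ne x 0 with rfl | hx
  · simp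
  have hx' : 0 < ‖x‖ := norm_pos_iff.2 hx
  have hscaled := @h (op ((δ / 2 / ‖x‖ : ℝ) : ℍ) • x) (by
    rw [dist_zero_right, norm_op_smul, Quaternion.norm_coe, Real.norm_of_nonneg (by positivity),
      mul_div_cancel₀ _ hx'.ne']
    linarith)
  rw [map_zero, dist_zero_right, map_smul, norm_op_smul, Quaternion.norm_coe,
    Real.norm_of_nonneg (by positivity)] at hscaled
  calc ‖T x‖ = 2 / δ * ‖x‖ * (‖T x‖ * (δ / 2 / ‖x‖)) := by field_simp
    _ ≤ 2 / δ * ‖x‖ * 1 := by gcongr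
    _ = _ := mul_one _

/-! ### Positive operators -/

/-- Polarization: the form is real at `x + y a` for every quaternion `a`; `a = 1` shows that
`⟨y, T x⟩` and the conjugate of `⟨x, T y⟩` differ by a real number, which `a = i` shows to be
zero. -/
theorem IsPositive.symm {T : H →L[ℍᵐᵒᵖ] H} (hT : IsPositive T) (x y : H) :
    qinner (T x) y = qinner x (T y) := by
  have hreal (a : ℍ) : ∃ r : ℝ, qinner x (T y) * a + star a * qinner y (T x) = r := by
    obtain ⟨r, -, h⟩ := hT (x + op a • y)
    obtain ⟨r₁, -, h₁⟩ := hT x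
    obtain ⟨r₂, -, h₂⟩ := hT (op a • y)
    refine ⟨r - r₁ - r₂, ?_⟩
    rw [map_add, add_right, qinner_add_left, qinner_add_left, h₁, h₂, map_smul, smul_right,
      qinner_smul_left] at h
    push_cast
    rw [← h]
    abel
  rw [← conj_symm]
  set c := qinner x (T y)
  set d := qinner y (T x)
  obtain ⟨t, ht⟩ : ∃ t : ℝ, d = star c + t := by
    obtain ⟨r, hr⟩ := hreal 1
    refine ⟨r - 2 * c.re, ?_⟩
    rw [star_one, mul_one, one_mul] at hr
    have hc : c + star c = ((2 * c.re : ℝ) : ℍ) := by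
      ext <;> simp [two_mul]
    rw [Quaternion.coe_sub, ← hc, ← hr]
    abel
  have ht0 : t = 0 := by
    obtain ⟨q, hq0, hq1, hq2, hq3⟩ : ∃ q : ℍ, q.re = 0 ∧ q.imI = 1 ∧ q.imJ = 0 ∧ q.imK = 0 :=
      ⟨⟨0, 1, 0, 0⟩, rfl, rfl, rfl, rfl⟩
    obtain ⟨r, hr⟩ := hreal q
    have hI := congrArg QuaternionAlgebra.imI hr
    simpa [ht, hq0, hq1, hq2, hq3] using hI
  rw [ht, ht0, Quaternion.coe_zero, add_zero, star_star]

theorem IsPositive.re_nonneg {T : H →L[ℍᵐᵒᵖ] H} (hT : IsPositive T) (x : H) :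
    0 ≤ (qinner x (T x)).re := by
  obtain ⟨r, hr, h⟩ := hT x
  rwa [h, Quaternion.re_coe]

theorem IsPositive.qinner_self {T : H →L[ℍᵐᵒᵖ] H} (hT : IsPositive T) (x : H) :
    qinner x (T x) = ((qinner x (T x)).re : ℍ) := by
  obtain ⟨r, -, h⟩ := hT x
  rw [h, Quaternion.re_coe]

theorem IsPositive.sq_re_le {T : H →L[ℍᵐᵒᵖ] H} (hT : IsPositive T) (x y : H) :
    (qinner x (T y)).re ^ 2 ≤ (qinner x (T x)).re * (qinner y (T y)).re := by
  have hquad (t : ℝ) : 0 ≤ (qinner y (T y)).re * (t * t) + 2 * (qinner x (T y)).re * t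
      + (qinner x (T x)).re := by
    have h := hT.re_nonneg (x + op (t : ℍ) • y)
    have hyx : (qinner y (T x)).re = (qinner x (T y)).re := by rw [← hT.symm, re_qinner_comm]
    simp only [map_add, map_smul, add_right, qinner_add_left, smul_right, qinner_smul_left,
      Quaternion.star_coe, Quaternion.re_add, ← Quaternion.coe_commutes t,
      Quaternion.coe_mul_eq_smul, Quaternion.re_smul, smul_eq_mul, hyx] at h
    linarith
  have h := discrim_le_zero hquad
  rw [discrim] at h
  linarith

/-- The real version is applied to `x ⟨x, T y⟩` in place of `x`. -/
theorem IsPositive.cauchySchwarz {T : H →L[ℍᵐᵒᵖ] H} (hT : IsPositive T) (x y : H) :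
    ‖qinner x (T y)‖ ^ 2 ≤ (qinner x (T x)).re * (qinner y (T y)).re := by
  set a := qinner x (T y) with ha
  rcases eq_or_ne a 0 with h0 | h0
  · simpa [h0] using mul_nonneg (hT.re_nonneg x) (hT.re_nonneg y)
  have hxy : (qinner (op a • x) (T y)).re = ‖a‖ ^ 2 := by
    rw [qinner_smul_left, ← ha, star_mul_self_eq_norm_sq, Quaternion.re_coe]
  have hxx : (qinner (op a • x) (T (op a • x))).re = ‖a‖ ^ 2 * (qinner x (T x)).re := by
    rw [map_smul, smul_right, qinner_smul_left, hT.qinner_self, mul_assoc, Quaternion.coe_commutes,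
      ← mul_assoc, star_mul_self_eq_norm_sq, ← Quaternion.coe_mul, Quaternion.re_coe,
      Quaternion.re_coe]
  have h := hT.sq_re_le (op a • x) y
  rw [hxy, hxx, sq (‖a‖ ^ 2), mul_assoc] at h
  exact le_of_mul_le_mul_left h (by positivity)

theorem isPositive_id : IsPositive (ContinuousLinearMap.id ℍᵐᵒᵖ H) := fun x =>
  ⟨‖x‖ ^ 2, by positivity, inner_self x⟩

theorem norm_qinner_le (x y : H) : ‖qinner x y‖ ≤ ‖x‖ * ‖y‖ := by
  have h := (isPositive_id (H := H)).cauchySchwarz x y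
  simp only [ContinuousLinearMap.coe_id', id_eq, ← norm_sq_eq_re, ← mul_pow] at h
  exact (sq_le_sq₀ (norm_nonneg _) (by positivity)).1 h

theorem re_qinner_le (x y : H) : (qinner x y).re ≤ ‖x‖ * ‖y‖ :=
  (le_abs_self _).trans ((abs_re_le_norm _).trans (norm_qinner_le x y))

theorem continuous_qinner (x : H) : Continuous (qinner x) :=
  AddMonoidHomClass.continuous_of_bound (qinnerRight x) ‖x‖ (norm_qinner_le x)

theorem IsPositive.norm_sq_le {T : H →L[ℍᵐᵒᵖ] H} (hT : IsPositive T) {M : ℝ}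
    (hM : ∀ x, ‖T x‖ ≤ M * ‖x‖) (x : H) : ‖T x‖ ^ 2 ≤ M * (qinner x (T x)).re := by
  have hT2 : (qinner (T x) (T (T x))).re ≤ M * ‖T x‖ ^ 2 :=
    calc _ ≤ ‖T x‖ * ‖T (T x)‖ := re_qinner_le _ _
      _ ≤ ‖T x‖ * (M * ‖T x‖) := by gcongr; exact hM _
      _ = M * ‖T x‖ ^ 2 := by ring
  rcases eq_or_ne (T x) 0 with h0 | h0
  · simp [h0]
  have hpos : 0 < ‖T x‖ ^ 2 := by positivity
  refine le_of_mul_le_mul_left ?_ hpos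
  calc ‖T x‖ ^ 2 * ‖T x‖ ^ 2 = (qinner (T x) (T x)).re ^ 2 := by rw [norm_sq_eq_re]; ring
    _ ≤ (qinner (T x) (T (T x))).re * (qinner x (T x)).re := hT.sq_re_le _ _
    _ ≤ M * ‖T x‖ ^ 2 * (qinner x (T x)).re := by
        gcongr
        exact hT.re_nonneg x
    _ = _ := by ring

/-! ### Orthogonal families -/

/-- A family of pairwise orthogonal vectors, each of which is zero or has norm one; zero vectors
are admitted so that a finite orthonormal family can be indexed by the natural numbers. -/
def IsOrthoFamily {ι : Type*} (e : ι → H) : Prop :=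
  (∀ m n, m ≠ n → qinner (e m) (e n) = 0) ∧ ∀ n, e n = 0 ∨ ‖e n‖ = 1

/-- The orthogonal projection to the span of finitely many members of an orthogonal family. -/
def orthoProj {ι : Type*} (e : ι → H) (F : Finset ι) (x : H) : H :=
  ∑ n ∈ F, op (qinner (e n) x) • e n

theorem map_orthoProj {ι : Type*} (T : H →L[ℍᵐᵒᵖ] H) (e : ι → H) (F : Finset ι) (x : H) :
    T (orthoProj e F x) = ∑ n ∈ F, op (qinner (e n) x) • T (e n) := by
  rw [orthoProj, map_sum]
  simp only [map_smul]

namespace IsOrthoFamily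

variable {ι : Type*} {e : ι → H}

theorem norm_le_one (he : IsOrthoFamily e) (n : ι) : ‖e n‖ ≤ 1 := by
  rcases he.2 n with h | h <;> simp [h]

theorem op_self_smul (he : IsOrthoFamily e) (n : ι) : op (qinner (e n) (e n)) • e n = e n := by
  rcases he.2 n with h | h
  · rw [h, smul_zero]
  · rw [inner_self, h]; simp

theorem qinner_self_mul (he : IsOrthoFamily e) (n : ι) (x : H) :
    qinner (e n) (e n) * qinner (e n) x = qinner (e n) x := by
  rcases he.2 n with h | h
  · rw [h]; simp
  · rw [inner_self, h]; simp

theorem qinner_sub_orthoProj (he : IsOrthoFamily e) {F : Finset ι} {n : ι} (hn : n ∈ F) (x : H) :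
    qinner (e n) (x - orthoProj e F x) = 0 := by
  rw [qinner_sub_right, orthoProj, qinner_sum_right, Finset.sum_eq_single n, smul_right,
    he.qinner_self_mul, sub_self]
  · intro m _ hm
    rw [smul_right, he.1 n m hm.symm, zero_mul]
  · exact fun h => absurd hn h

theorem qinner_orthoProj_sub (he : IsOrthoFamily e) (F : Finset ι) (x : H) :
    qinner (orthoProj e F x) (x - orthoProj e F x) = 0 := by
  conv_lhs => rw [orthoProj.eq_def e F x, qinner_sum_left, ← orthoProj]
  refine Finset.sum_eq_zero fun n hn => ?_
  rw [qinner_smul_left, he.qinner_sub_orthoProj hn, mul_zero]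

theorem norm_orthoProj_sq (he : IsOrthoFamily e) (F : Finset ι) (x : H) :
    ‖orthoProj e F x‖ ^ 2 = ∑ n ∈ F, ‖qinner (e n) x‖ ^ 2 := by
  have h := he.qinner_orthoProj_sub F x
  rw [qinner_sub_right, sub_eq_zero] at h
  rw [norm_sq_eq_re, ← h, orthoProj, qinner_sum_left]
  refine (map_sum Bergman.reL _ _).trans (Finset.sum_congr rfl fun n _ => ?_)
  rw [qinner_smul_left, star_mul_self_eq_norm_sq]
  exact Quaternion.re_coe _

theorem norm_sq_eq (he : IsOrthoFamily e) (F : Finset ι) (x : H) :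
    ‖x‖ ^ 2 = ∑ n ∈ F, ‖qinner (e n) x‖ ^ 2 + ‖x - orthoProj e F x‖ ^ 2 := by
  have h := norm_add_sq (orthoProj e F x) (x - orthoProj e F x)
  rwa [he.qinner_orthoProj_sub, add_sub_cancel, he.norm_orthoProj_sq, Quaternion.re_zero, mul_zero,
    add_zero] at h

theorem bessel (he : IsOrthoFamily e) (F : Finset ι) (x : H) :
    ∑ n ∈ F, ‖qinner (e n) x‖ ^ 2 ≤ ‖x‖ ^ 2 := by
  rw [he.norm_sq_eq F x]
  exact le_add_of_nonneg_right (by positivity)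

theorem norm_sub_orthoProj_le (he : IsOrthoFamily e) (F : Finset ι) (x : H) :
    ‖x - orthoProj e F x‖ ≤ ‖x‖ := by
  refine (sq_le_sq₀ (norm_nonneg _) (norm_nonneg _)).1 ?_
  rw [he.norm_sq_eq F x]
  exact le_add_of_nonneg_left (Finset.sum_nonneg fun _ _ => by positivity)

end IsOrthoFamily

end QuaternionicHilbert

/-! ### Compact positive operators -/

section CompactOperators

open QInner Filter Topology

variable {H : Type*} [NormedAddCommGroup H] [Module ℍᵐᵒᵖ H] [QInner H]

theorem norm_op_coe_smul {r : ℝ} (hr : 0 ≤ r) (x : H) : ‖op (r : ℍ) • x‖ = r * ‖x‖ := by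
  rw [norm_op_smul, Quaternion.norm_coe, Real.norm_of_nonneg hr, mul_comm]

theorem norm_op_inv_norm_smul {x : H} (hx : x ≠ 0) : ‖op ((‖x‖⁻¹ : ℝ) : ℍ) • x‖ = 1 := by
  rw [norm_op_coe_smul (by positivity), inv_mul_cancel₀ (norm_ne_zero_iff.2 hx)]

theorem op_coe_smul_smul {V : Type*} [AddCommGroup V] [Module ℍᵐᵒᵖ V] (r t : ℝ) (x : V) :
    op (r : ℍ) • op (t : ℍ) • x = op ((r * t : ℝ) : ℍ) • x := by
  rw [smul_smul, ← op_mul, ← Quaternion.coe_mul, mul_comm]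

theorem op_coe_one_smul {V : Type*} [AddCommGroup V] [Module ℍᵐᵒᵖ V] (x : V) :
    op ((1 : ℝ) : ℍ) • x = x := by
  rw [Quaternion.coe_one, op_one, one_smul]

theorem norm_apply_le_of_closedBall {T : H →L[ℍᵐᵒᵖ] H} {W : Submodule ℍᵐᵒᵖ H} {s : ℝ}
    (h : ∀ v ∈ W, ‖v‖ ≤ 1 → ‖T v‖ ≤ s) {v : H} (hv : v ∈ W) : ‖T v‖ ≤ s * ‖v‖ := by
  rcases eq_or_ne v 0 with rfl | hv0
  · simp
  have h1 := h _ (W.smul_mem _ hv) (norm_op_inv_norm_smul hv0).le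
  rwa [map_smul, norm_op_coe_smul (by positivity), inv_mul_eq_div,
    div_le_iff₀ (norm_pos_iff.2 hv0)] at h1

/-- A Hilbert-Schmidt operator: the sums `∑ ‖T x‖²` over finite orthonormal sets are bounded. -/
def IsHilbertSchmidt (T : H →L[ℍᵐᵒᵖ] H) : Prop :=
  ∃ C : ℝ, ∀ A : Finset H, IsOrthoFamily (fun x : A => (x : H)) → ∑ x ∈ A, ‖T x‖ ^ 2 ≤ C

theorem IsOrthoFamily.insert [DecidableEq H] {A : Finset H}
    (hA : IsOrthoFamily (fun x : A => (x : H))) {y : H} (hy : ‖y‖ = 1)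
    (hAy : ∀ x ∈ A, qinner x y = 0) :
    IsOrthoFamily (fun x : ↥(insert y A) => (x : H)) := by
  refine ⟨?_, ?_⟩
  · rintro ⟨m, hm⟩ ⟨n, hn⟩ hmn
    have hmn' : m ≠ n := fun h => hmn (Subtype.ext h)
    rcases Finset.mem_insert.1 hm with rfl | hmA <;> rcases Finset.mem_insert.1 hn with rfl | hnA
    · exact absurd rfl hmn'
    · rw [← conj_symm, hAy n hnA, star_zero]
    · exact hAy m hmA
    · exact hA.1 ⟨m, hmA⟩ ⟨n, hnA⟩ fun h => hmn' (congrArg Subtype.val h)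
  · rintro ⟨n, hn⟩
    rcases Finset.mem_insert.1 hn with rfl | hn
    · exact .inr hy
    · exact hA.2 ⟨n, hn⟩

theorem exists_isOrthoFamily_card_eq {T : H →L[ℍᵐᵒᵖ] H} {ε : ℝ}
    (h : ∀ A : Finset H, IsOrthoFamily (fun x : A => (x : H)) →
      ∃ x, (∀ a ∈ A, qinner a x = 0) ∧ ε * ‖x‖ < ‖T x‖) (N : ℕ) :
    ∃ A : Finset H, IsOrthoFamily (fun x : A => (x : H)) ∧ A.card = N ∧ ∀ x ∈ A, ε ≤ ‖T x‖ := by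
  classical
  induction N with
  | zero => exact ⟨∅, ⟨fun m => absurd m.2 (Finset.notMem_empty _),
      fun m => absurd m.2 (Finset.notMem_empty _)⟩, rfl, by simp⟩
  | succ N ih =>
    obtain ⟨A, hA, hcard, hAT⟩ := ih
    obtain ⟨x, hAx, hTx⟩ := h A hA
    have hx0 : x ≠ 0 := by
      rintro rfl
      simp at hTx
    set y : H := op ((‖x‖⁻¹ : ℝ) : ℍ) • x with hy
    have hAy : ∀ a ∈ A, qinner a y = 0 := fun a ha => by rw [smul_right, hAx a ha, zero_mul]
    have hy1 : ‖y‖ = 1 := norm_op_inv_norm_smul hx0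
    have hyA : y ∉ A := fun hmem => by
      have h0 := norm_sq_eq_re y
      rw [hAy y hmem, hy1, Quaternion.re_zero] at h0
      norm_num at h0
    refine ⟨insert y A, hA.insert hy1 hAy, by rw [Finset.card_insert_of_notMem hyA, hcard], ?_⟩
    simp only [Finset.mem_insert, forall_eq_or_imp]
    refine ⟨?_, hAT⟩
    rw [hy, map_smul, norm_op_coe_smul (by positivity), inv_mul_eq_div,
      le_div_iff₀ (norm_pos_iff.2 hx0)]
    exact hTx.le

/-- Otherwise there would be arbitrarily large orthonormal sets on which `T` is at least `ε`. -/
theorem IsHilbertSchmidt.exists_finset_norm_apply_le {T : H →L[ℍᵐᵒᵖ] H} (hT : IsHilbertSchmidt T)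
    {ε : ℝ} (hε : 0 < ε) : ∃ A : Finset H, IsOrthoFamily (fun x : A => (x : H)) ∧
      ∀ x, (∀ a ∈ A, qinner a x = 0) → ‖T x‖ ≤ ε * ‖x‖ := by
  obtain ⟨C, hC⟩ := hT
  by_contra! hcon
  obtain ⟨N, hN⟩ := exists_nat_gt (C / ε ^ 2)
  obtain ⟨A, hA, hcard, hAT⟩ := exists_isOrthoFamily_card_eq hcon N
  have hsum : (N : ℝ) * ε ^ 2 ≤ C := by
    rw [← hcard, ← nsmul_eq_mul]
    refine (Finset.card_nsmul_le_sum A _ _ fun x hx => ?_).trans (hC A hA)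
    gcongr
    exact hAT x hx
  rw [div_lt_iff₀ (by positivity)] at hN
  linarith

/-- Up to `ε`, the image of the unit ball lies in the compact image of a finite-dimensional box. -/
theorem IsHilbertSchmidt.totallyBounded_image_closedBall {T : H →L[ℍᵐᵒᵖ] H}
    (hT : IsHilbertSchmidt T) : TotallyBounded (T '' Metric.closedBall 0 1) := by
  refine Metric.totallyBounded_iff.2 fun ε hε => ?_
  obtain ⟨A, hA, hsmall⟩ := hT.exists_finset_norm_apply_le (half_pos hε)
  let e : A → H := Subtype.val
  let g : (A → ℍ) → H := fun a => ∑ n, op (a n) • T (e n)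
  have hg : Continuous g := continuous_finsetSum _ fun n _ =>
    (continuous_op_smul (T (e n))).comp (continuous_apply n)
  obtain ⟨t, ht, hcov⟩ := Metric.totallyBounded_iff.1
    ((isCompact_closedBall (0 : A → ℍ) 1).image hg).totallyBounded (ε / 2) (half_pos hε)
  refine ⟨t, ht, ?_⟩
  rintro _ ⟨x, hx, rfl⟩
  rw [mem_closedBall_zero_iff] at hx
  have hclose : dist (T x) (T (orthoProj e Finset.univ x)) ≤ ε / 2 := by
    rw [dist_eq_norm, ← map_sub]
    refine (hsmall _ fun a ha =>
      hA.qinner_sub_orthoProj (Finset.mem_univ ⟨a, ha⟩) x).trans ?_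
    exact mul_le_of_le_one_right (by positivity) ((hA.norm_sub_orthoProj_le _ x).trans hx)
  have hbox : (fun n => qinner (e n) x) ∈ Metric.closedBall (0 : A → ℍ) 1 := by
    rw [mem_closedBall_zero_iff, pi_norm_le_iff_of_nonneg zero_le_one]
    exact fun n => (norm_qinner_le _ _).trans
      (mul_le_one₀ (hA.norm_le_one n) (norm_nonneg _) hx)
  obtain ⟨y, hy, hgy⟩ := Set.mem_iUnion₂.1 (hcov (Set.mem_image_of_mem g hbox))
  have hg_eq : g (fun n => qinner (e n) x) = T (orthoProj e Finset.univ x) :=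
    (map_orthoProj T e Finset.univ x).symm
  rw [hg_eq, Metric.mem_ball] at hgy
  refine Set.mem_iUnion₂.2 ⟨y, hy, Metric.mem_ball.2 ?_⟩
  linarith [dist_triangle (T x) (T (orthoProj e Finset.univ x)) y]

theorem IsHilbertSchmidt.isCompact_closure_image_closedBall [CompleteSpace H]
    {T : H →L[ℍᵐᵒᵖ] H} (hT : IsHilbertSchmidt T) :
    IsCompact (closure (T '' Metric.closedBall 0 1)) :=
  hT.totallyBounded_image_closedBall.closure.isCompact_of_isClosed isClosed_closure

/-- The closed submodule of all vectors orthogonal to `x`. -/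
def orthoCompl (x : H) : Submodule ℍᵐᵒᵖ H where
  carrier := {y | qinner x y = 0}
  add_mem' hy hz := by rw [Set.mem_ofPred_eq, add_right, hy, hz, add_zero]
  zero_mem' := qinner_zero_right x
  smul_mem' c y hy := by rw [Set.mem_ofPred_eq, ← op_unop c, smul_right, hy, zero_mul]

theorem isClosed_orthoCompl (x : H) : IsClosed (orthoCompl x : Set H) :=
  isClosed_singleton.preimage (continuous_qinner x)

theorem IsPositive.apply_mem_orthoCompl {T : H →L[ℍᵐᵒᵖ] H} (hT : IsPositive T) {x y : H}
    {s : ℝ} (hx : T x = op (s : ℍ) • x) (hy : y ∈ orthoCompl x) : T y ∈ orthoCompl x := by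
  change qinner x (T y) = 0
  rw [← hT.symm, hx, qinner_smul_left, hy, mul_zero]

/-- The vector `w = T x - s x` satisfies `T w = -s w`, so that it vanishes by positivity. -/
theorem IsPositive.apply_eq_of_apply_apply_eq {T : H →L[ℍᵐᵒᵖ] H} (hT : IsPositive T) {x : H}
    {s : ℝ} (hs : 0 < s) (hx : T (T x) = op ((s ^ 2 : ℝ) : ℍ) • x) : T x = op (s : ℍ) • x := by
  set w := T x - op (s : ℍ) • x with hw
  have hTw : T w = op ((-s : ℝ) : ℍ) • w := by
    rw [hw, map_sub, map_smul, hx, smul_sub, op_coe_smul_smul, Quaternion.coe_neg, op_neg,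
      neg_smul, neg_mul, Quaternion.coe_neg, op_neg, neg_smul, sq]
    abel
  have hneg := hT.re_nonneg w
  rw [hTw, smul_right, inner_self, ← Quaternion.coe_mul, Quaternion.re_coe] at hneg
  have hw0 : ‖w‖ ^ 2 = 0 := by nlinarith [sq_nonneg ‖w‖]
  rwa [sq_eq_zero_iff, norm_eq_zero, hw, sub_eq_zero] at hw0

theorem IsPositive.apply_apply_eq_of_norm_eq {T : H →L[ℍᵐᵒᵖ] H} (hT : IsPositive T) {x : H}
    {s : ℝ} (hx : ‖T x‖ = s * ‖x‖) (hTx : ‖T (T x)‖ ≤ s * ‖T x‖) :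
    T (T x) = op ((s ^ 2 : ℝ) : ℍ) • x := by
  have hre : (qinner (T (T x)) x).re = ‖T x‖ ^ 2 := by rw [hT.symm, ← norm_sq_eq_re]
  have hsq : ‖T (T x)‖ ^ 2 ≤ (s * ‖T x‖) ^ 2 := by gcongr
  have h := norm_sub_sq (T (T x)) (op ((s ^ 2 : ℝ) : ℍ) • x)
  rw [smul_right, Quaternion.mul_coe_eq_smul, Quaternion.re_smul, hre,
    norm_op_coe_smul (by positivity), smul_eq_mul] at h
  rw [hx] at h hsq
  rw [← sub_eq_zero, ← norm_eq_zero, ← sq_eq_zero_iff]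
  exact le_antisymm (by nlinarith) (by positivity)

/-- Let `y` have maximal norm `s` in the closure of the image of the unit ball of `W`. For `u = T v`
one has `‖u‖² = ⟨v, T u⟩ ≤ ‖T u‖`, and in the limit `s ‖y‖ ≤ ‖T y‖`: the norm is attained at `y`. -/
theorem IsPositive.exists_norm_eq_max {T : H →L[ℍᵐᵒᵖ] H} (hT : IsPositive T)
    (hK : IsCompact (closure (T '' Metric.closedBall 0 1))) {W : Submodule ℍᵐᵒᵖ H}
    (hW : IsClosed (W : Set H)) (hTW : ∀ y ∈ W, T y ∈ W) :
    ∃ y ∈ W, ‖T y‖ = ‖y‖ * ‖y‖ ∧ ∀ v ∈ W, ‖T v‖ ≤ ‖y‖ * ‖v‖ := by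
  set B : Set H := T '' (W ∩ Metric.closedBall 0 1)
  have hBc : IsCompact (closure B) :=
    hK.of_isClosed_subset isClosed_closure (closure_mono (Set.image_mono Set.inter_subset_right))
  have hB0 : (closure B).Nonempty := ⟨T 0, subset_closure ⟨0, ⟨W.zero_mem, by simp⟩, rfl⟩⟩
  obtain ⟨y, hyB, hmax⟩ := hBc.exists_isMaxOn hB0 continuous_norm.continuousOn
  have hyW : y ∈ W := closure_minimal (by rintro _ ⟨v, hv, rfl⟩; exact hTW v hv.1) hW hyB
  have hle : ∀ v ∈ W, ‖T v‖ ≤ ‖y‖ * ‖v‖ := fun v => norm_apply_le_of_closedBall fun v hv hv1 =>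
    hmax (subset_closure ⟨v, ⟨hv, mem_closedBall_zero_iff.2 hv1⟩, rfl⟩)
  have hge : ‖y‖ ^ 2 ≤ ‖T y‖ := by
    refine closure_minimal (t := {u | ‖u‖ ^ 2 ≤ ‖T u‖}) ?_
      (isClosed_le (continuous_norm.pow 2) T.continuous.norm) hyB
    rintro _ ⟨v, hv, rfl⟩
    calc ‖T v‖ ^ 2 = (qinner v (T (T v))).re := by rw [norm_sq_eq_re, hT.symm]
      _ ≤ ‖v‖ * ‖T (T v)‖ := re_qinner_le _ _
      _ ≤ ‖T (T v)‖ :=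
          mul_le_of_le_one_left (norm_nonneg _) (mem_closedBall_zero_iff.1 hv.2)
  exact ⟨y, hyW, le_antisymm (hle y hyW) (by rwa [← sq]), hle⟩

theorem IsPositive.exists_eigenvector {T : H →L[ℍᵐᵒᵖ] H} (hT : IsPositive T)
    (hK : IsCompact (closure (T '' Metric.closedBall 0 1))) {W : Submodule ℍᵐᵒᵖ H}
    (hW : IsClosed (W : Set H)) (hTW : ∀ y ∈ W, T y ∈ W) :
    ∃ x ∈ W, ∃ s : ℝ, 0 ≤ s ∧ (s = 0 → x = 0) ∧ (s ≠ 0 → ‖x‖ = 1) ∧ T x = op (s : ℍ) • x ∧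
      ∀ v ∈ W, ‖T v‖ ≤ s * ‖v‖ := by
  obtain ⟨y, hy, hTy, hmax⟩ := hT.exists_norm_eq_max hK hW hTW
  refine ⟨op ((‖y‖⁻¹ : ℝ) : ℍ) • y, W.smul_mem _ hy, ‖y‖, norm_nonneg y,
    fun h => by rw [norm_eq_zero.1 h, smul_zero],
    fun h => norm_op_inv_norm_smul (norm_ne_zero_iff.1 h), ?_, hmax⟩
  have hTy' : T y = op (‖y‖ : ℍ) • y := by
    rcases (norm_nonneg y).eq_or_lt with h | h
    · rw [norm_eq_zero.1 h.symm, map_zero, smul_zero]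
    · exact hT.apply_eq_of_apply_apply_eq h
        (hT.apply_apply_eq_of_norm_eq hTy (hmax _ (hTW y hy)))
  rw [map_smul, hTy', op_coe_smul_smul, op_coe_smul_smul, mul_comm]

/-- A sequence of orthonormal eigenvectors `e n` of `T` for eigenvalues `s n ≥ 0`, which is
continued by zero vectors when there are not enough positive eigenvalues. -/
structure IsEigenSequence (T : H →L[ℍᵐᵒᵖ] H) (s : ℕ → ℝ) (e : ℕ → H) : Prop where
  ortho : IsOrthoFamily e
  nonneg : ∀ n, 0 ≤ s n
  norm_eq_one : ∀ n, s n ≠ 0 → ‖e n‖ = 1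
  apply_eq : ∀ n, T (e n) = op (s n : ℍ) • e n

theorem IsEigenSequence.norm_apply {T : H →L[ℍᵐᵒᵖ] H} {s : ℕ → ℝ} {e : ℕ → H}
    (h : IsEigenSequence T s e) (n : ℕ) : ‖T (e n)‖ = s n := by
  rw [h.apply_eq, norm_op_coe_smul (h.nonneg n)]
  rcases eq_or_ne (s n) 0 with h0 | h0
  · rw [h0, zero_mul]
  · rw [h.norm_eq_one n h0, mul_one]

/-- The eigenvectors are chosen successively, `e n` in the intersection `W n` of the orthogonal
complements of the previous ones. -/
theorem IsPositive.exists_isEigenSequence {T : H →L[ℍᵐᵒᵖ] H} (hT : IsPositive T)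
    (hK : IsCompact (closure (T '' Metric.closedBall 0 1))) :
    ∃ (s : ℕ → ℝ) (e : ℕ → H), IsEigenSequence T s e ∧
      ∀ n x, (∀ m < n, qinner (e m) x = 0) → ‖T x‖ ≤ s n * ‖x‖ := by
  choose x hxW s hs0 hx0 hx1 hTx hmax using
    fun W : {W : Submodule ℍᵐᵒᵖ H // IsClosed (W : Set H) ∧ ∀ y ∈ W, T y ∈ W} =>
      hT.exists_eigenvector hK W.2.1 W.2.2
  let W : ℕ → {W : Submodule ℍᵐᵒᵖ H // IsClosed (W : Set H) ∧ ∀ y ∈ W, T y ∈ W} := fun n =>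
    n.rec ⟨⊤, isClosed_univ, fun _ _ => trivial⟩ fun _ V => ⟨V ⊓ orthoCompl (x V),
      V.2.1.inter (isClosed_orthoCompl _),
      fun y hy => ⟨V.2.2 y hy.1, hT.apply_mem_orthoCompl (hTx V) hy.2⟩⟩
  have hmemW (n : ℕ) (y : H) : y ∈ (W n).1 ↔ ∀ m < n, qinner (x (W m)) y = 0 := by
    induction n with
    | zero => simp [W]
    | succ n ih =>
      rw [Nat.forall_lt_succ_right, ← ih]
      exact Iff.rfl
  have hlt {m n : ℕ} (hmn : m < n) : qinner (x (W m)) (x (W n)) = 0 :=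
    (hmemW n _).1 (hxW (W n)) m hmn
  refine ⟨fun n => s (W n), fun n => x (W n), ⟨⟨fun m n hmn => ?_, fun n => ?_⟩,
    fun n => hs0 (W n), fun n => hx1 (W n), fun n => hTx (W n)⟩,
    fun n y hy => hmax (W n) y ((hmemW n y).2 hy)⟩
  · rcases lt_or_gt_of_ne hmn with h | h
    · exact hlt h
    · rw [← conj_symm, hlt h, star_zero]
  · rcases eq_or_ne (s (W n)) 0 with h | h
    · exact .inl (hx0 _ h)
    · exact .inr (hx1 _ h)

/-- The images `T (e n)` are orthogonal, so that `‖T (e m) - T (e n)‖² = (s m)² + (s n)²`, while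
some subsequence of them converges. -/
theorem IsEigenSequence.tendsto_zero {T : H →L[ℍᵐᵒᵖ] H} {s : ℕ → ℝ} {e : ℕ → H}
    (h : IsEigenSequence T s e) (hs : Antitone s)
    (hK : IsCompact (closure (T '' Metric.closedBall 0 1))) : Tendsto s atTop (𝓝 0) := by
  obtain ⟨y, -, φ, hφ, hy⟩ := hK.tendsto_subseq (x := fun n => T (e n)) fun n =>
    subset_closure ⟨e n, mem_closedBall_zero_iff.2 (h.ortho.norm_le_one n), rfl⟩
  have hdist {m n : ℕ} (hmn : m ≠ n) : ‖T (e m) - T (e n)‖ ^ 2 = s m ^ 2 + s n ^ 2 := by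
    have horth : qinner (T (e m)) (T (e n)) = 0 := by
      rw [h.apply_eq, h.apply_eq, smul_right, qinner_smul_left, h.ortho.1 m n hmn, mul_zero,
        zero_mul]
    rw [norm_sub_sq, horth, h.norm_apply, h.norm_apply, Quaternion.re_zero]
    ring
  have hle (n : ℕ) : s (φ n) ≤ ‖T (e (φ n)) - T (e (φ (n + 1)))‖ := by
    refine abs_le_of_sq_le_sq' ?_ (norm_nonneg _) |>.2
    rw [hdist (hφ n.lt_succ_self).ne]
    exact le_add_of_nonneg_right (sq_nonneg _)
  have hsub : Tendsto (s ∘ φ) atTop (𝓝 0) := by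
    refine squeeze_zero (fun n => h.nonneg (φ n)) hle ?_
    simpa using (hy.sub (hy.comp (tendsto_add_atTop_nat 1))).norm
  exact (tendsto_iff_tendsto_subseq_of_antitone hs hφ.tendsto_atTop).2 hsub

/-- The Schmidt expansion `T x = ∑ f n (s n) ⟨e n, x⟩` of an operator. -/
def HasSchmidtExpansion (T : H →L[ℍᵐᵒᵖ] H) (s : ℕ → ℝ) (e f : ℕ → H) : Prop :=
  ∀ x, HasSum (fun n => op ((s n : ℍ) * qinner (e n) x) • f n) (T x)

theorem hasSchmidtExpansion_iff {T : H →L[ℍᵐᵒᵖ] H} {s : ℕ → ℝ} {e f : ℕ → H}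
    (h : ∀ n, T (e n) = op (s n : ℍ) • f n) : HasSchmidtExpansion T s e f ↔
      ∀ x, Tendsto (fun F => ‖T (x - orthoProj e F x)‖) atTop (𝓝 0) := by
  refine forall_congr' fun x => ?_
  have hsum (F : Finset ℕ) :
      ∑ n ∈ F, op ((s n : ℍ) * qinner (e n) x) • f n = T (orthoProj e F x) := by
    rw [map_orthoProj]
    refine Finset.sum_congr rfl fun n _ => ?_
    rw [h, smul_smul, ← op_mul]
  rw [HasSum, tendsto_iff_norm_sub_tendsto_zero]
  simp only [hsum, norm_sub_rev _ (T x), map_sub, SummationFilter.unconditional_filter]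

theorem IsPositive.exists_hasSchmidtExpansion {T : H →L[ℍᵐᵒᵖ] H} (hT : IsPositive T)
    (hK : IsCompact (closure (T '' Metric.closedBall 0 1))) :
    ∃ (s : ℕ → ℝ) (e : ℕ → H), IsEigenSequence T s e ∧ Antitone s ∧
      HasSchmidtExpansion T s e e := by
  obtain ⟨s, e, he, hmax⟩ := hT.exists_isEigenSequence hK
  have hs : Antitone s := antitone_nat_of_succ_le fun n => by
    rw [← he.norm_apply (n + 1)]
    exact (hmax n _ fun m hm => he.ortho.1 m (n + 1) (by omega)).trans
      (mul_le_of_le_one_right (he.nonneg n) (he.ortho.norm_le_one _))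
  refine ⟨s, e, he, hs, (hasSchmidtExpansion_iff he.apply_eq).2 fun x => ?_⟩
  refine Metric.tendsto_atTop.2 fun ε hε => ?_
  have hlim : Tendsto (fun n => s n * ‖x‖) atTop (𝓝 0) := by
    simpa using (he.tendsto_zero hs hK).mul_const ‖x‖
  obtain ⟨N, hN⟩ := (hlim.eventually (gt_mem_nhds hε)).exists
  refine ⟨Finset.range N, fun F hF => ?_⟩
  rw [dist_zero_right, norm_norm]
  refine lt_of_le_of_lt (hmax N _ fun n hn =>
    he.ortho.qinner_sub_orthoProj (hF (Finset.mem_range.2 hn)) x) (lt_of_le_of_lt ?_ hN)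
  exact mul_le_mul_of_nonneg_left (he.ortho.norm_sub_orthoProj_le F x) (he.nonneg N)

/-! ### Singular values -/

theorem IsAbs.qinner_apply_apply {T P : H →L[ℍᵐᵒᵖ] H} (h : IsAbs T P) (x y : H) :
    qinner (T x) (T y) = qinner (P x) (P y) := by
  obtain ⟨hP, S, hTS, hPS⟩ := h
  have hS : S (T x) = P (P x) := (DFunLike.congr_fun hPS x).symm
  rw [← hTS, hS, hP.symm]

theorem IsAbs.norm_apply {T P : H →L[ℍᵐᵒᵖ] H} (h : IsAbs T P) (x : H) : ‖T x‖ = ‖P x‖ := by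
  rw [← sq_eq_sq₀ (norm_nonneg _) (norm_nonneg _), norm_sq_eq_re, norm_sq_eq_re,
    h.qinner_apply_apply]

theorem HasSchmidtExpansion.apply_eq {P : H →L[ℍᵐᵒᵖ] H} {s : ℕ → ℝ} {e : ℕ → H}
    (h : HasSchmidtExpansion P s e e) (he : IsOrthoFamily e) (n : ℕ) :
    P (e n) = op (s n : ℍ) • e n := by
  have hsingle : HasSum (fun m => op ((s m : ℍ) * qinner (e m) (e n)) • e m)
      (op ((s n : ℍ) * qinner (e n) (e n)) • e n) :=
    hasSum_single n fun m hm => by rw [he.1 m n hm, mul_zero, op_zero, zero_smul]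
  rw [(h (e n)).unique hsingle, Quaternion.coe_commutes, op_mul, mul_smul, he.op_self_smul]

theorem HasSchmidtExpansion.exists_isOrthoFamily {P : H →L[ℍᵐᵒᵖ] H} {s : ℕ → ℝ} {e₀ : ℕ → H}
    (h : HasSchmidtExpansion P s e₀ e₀)
    (he₀ : ∀ m n, s m ≠ 0 → s n ≠ 0 → qinner (e₀ m) (e₀ n) = if m = n then 1 else 0) :
    ∃ e, IsOrthoFamily e ∧ (∀ n, s n = 0 → e n = 0) ∧ HasSchmidtExpansion P s e e := by
  classical
  let e : ℕ → H := fun n => if s n = 0 then 0 else e₀ n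
  have hzero (n : ℕ) (hn : s n = 0) : e n = 0 := if_pos hn
  have hne (n : ℕ) (hn : s n ≠ 0) : e n = e₀ n := if_neg hn
  refine ⟨e, ⟨fun m n hmn => ?_, fun n => ?_⟩, hzero, fun x => ?_⟩
  · by_cases hm : s m = 0
    · rw [hzero m hm, qinner_zero_left]
    by_cases hn : s n = 0
    · rw [hzero n hn, qinner_zero_right]
    rw [hne m hm, hne n hn, he₀ m n hm hn, if_neg hmn]
  · by_cases hn : s n = 0
    · exact .inl (hzero n hn)
    right
    rw [hne n hn, ← sq_eq_sq₀ (norm_nonneg _) zero_le_one, norm_sq_eq_re, he₀ n n hn hn,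
      if_pos rfl, Quaternion.re_one, one_pow]
  · convert h x using 2 with n
    by_cases hn : s n = 0
    · simp [hn]
    · rw [hne n hn]

theorem IsPositive.isSingularValueSeq {T : H →L[ℍᵐᵒᵖ] H} (hT : IsPositive T) {s : ℕ → ℝ}
    {e : ℕ → H} (he : IsEigenSequence T s e) (hs : Antitone s)
    (hsum : HasSchmidtExpansion T s e e) : IsSingularValueSeq T s := by
  refine ⟨hs, he.nonneg, T, ⟨hT, T, hT.symm, rfl⟩, e, fun m n _ hn => ?_, hsum⟩
  split_ifs with h
  · rw [h, inner_self, he.norm_eq_one n hn, one_pow, Quaternion.coe_one]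
  · exact he.ortho.1 m n h

/-- The singular value decomposition: with `P = |T|` and its eigenvectors `e n`, one can take
`f n = T (e n) / s n`, because `‖T x‖ = ‖P x‖`. -/
theorem IsSingularValueSeq.exists_hasSchmidtExpansion {T : H →L[ℍᵐᵒᵖ] H} {s : ℕ → ℝ}
    (hs : IsSingularValueSeq T s) :
    ∃ e f : ℕ → H, IsOrthoFamily e ∧ IsOrthoFamily f ∧ HasSchmidtExpansion T s e f := by
  obtain ⟨-, hs0, P, hTP, e₀, he₀, hsum₀⟩ := hs
  obtain ⟨e, he, hzero, hP⟩ := HasSchmidtExpansion.exists_isOrthoFamily hsum₀ he₀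
  have hPe := hP.apply_eq he
  let f : ℕ → H := fun n => op (((s n)⁻¹ : ℝ) : ℍ) • T (e n)
  have hTe (n : ℕ) : T (e n) = op (s n : ℍ) • f n := by
    by_cases hn : s n = 0
    · simp [f, hzero n hn]
    · rw [op_coe_smul_smul, mul_inv_cancel₀ hn, op_coe_one_smul]
  have hf : IsOrthoFamily f := by
    refine ⟨fun m n hmn => ?_, fun n => ?_⟩
    · rw [smul_right, qinner_smul_left, hTP.qinner_apply_apply, hPe, hPe, smul_right,
        qinner_smul_left, he.1 m n hmn]
      simp only [mul_zero, zero_mul]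
    · by_cases hn : s n = 0
      · exact .inl (by simp [f, hzero n hn])
      · rw [← norm_eq_zero, norm_op_coe_smul (inv_nonneg.2 (hs0 n)), hTP.norm_apply, hPe,
          norm_op_coe_smul (hs0 n), inv_mul_cancel_left₀ hn, norm_eq_zero]
        exact he.2 n
  refine ⟨e, f, he, hf, (hasSchmidtExpansion_iff hTe).2 fun x => ?_⟩
  simp only [hTP.norm_apply]
  exact (hasSchmidtExpansion_iff hPe).1 hP x

end CompactOperators

/-! ### Moments of the weighted measure on the disk -/

section DiskMeasure

open Filter Topology

theorem diskMeasure_absolutelyContinuous (α : ℝ) :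
    diskMeasure α ≪ volume.restrict (Metric.ball (0 : ℂ) 1) :=
  withDensity_absolutelyContinuous _ _

theorem ae_diskMeasure_mem_ball (α : ℝ) : ∀ᵐ z ∂(diskMeasure α), z ∈ Metric.ball (0 : ℂ) 1 :=
  (diskMeasure_absolutelyContinuous α).ae_le (ae_restrict_mem Metric.isOpen_ball.measurableSet)

theorem continuous_one_sub_sq_rpow {β : ℝ} (hβ : 0 ≤ β) :
    Continuous fun y : ℝ => (1 - y ^ 2) ^ β :=
  (continuous_const.sub (continuous_pow 2)).rpow_const fun _ => .inr hβ

theorem hasDerivAt_one_sub_sq_rpow (β : ℝ) {y : ℝ} (hy : y ∈ Set.Ioo (0 : ℝ) 1) :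
    HasDerivAt (fun y : ℝ => (1 - y ^ 2) ^ (β + 1)) (-(2 * (β + 1) * y * (1 - y ^ 2) ^ β)) y := by
  have hne : 1 - y ^ 2 ≠ 0 := by nlinarith [hy.1, hy.2]
  have hbase : HasDerivAt (fun y : ℝ => 1 - y ^ 2) (-(2 * y)) y := by
    simpa using (hasDerivAt_pow 2 y).const_sub 1
  refine (hbase.rpow_const (p := β + 1) (.inl hne)).congr_deriv ?_
  rw [add_sub_cancel_right]
  ring

theorem intervalIntegrable_one_sub_sq_rpow {α : ℝ} (hα : -1 < α) :
    IntervalIntegrable (fun y : ℝ => 2 * (α + 1) * y * (1 - y ^ 2) ^ α) volume 0 1 := by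
  refine intervalIntegral.intervalIntegrable_deriv_of_nonneg
    (g := fun y : ℝ => -(1 - y ^ 2) ^ (α + 1))
    (continuous_one_sub_sq_rpow (by linarith)).neg.continuousOn (fun y hy => ?_) fun y hy => ?_
  · rw [min_eq_left zero_le_one, max_eq_right zero_le_one] at hy
    exact (hasDerivAt_one_sub_sq_rpow α hy).fun_neg.congr_deriv (neg_neg _)
  · rw [min_eq_left zero_le_one, max_eq_right zero_le_one] at hy
    have hrpow : 0 ≤ (1 - y ^ 2) ^ α := Real.rpow_nonneg (by nlinarith [hy.1, hy.2]) _
    have hconst : 0 ≤ 2 * (α + 1) := by linarith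
    exact mul_nonneg (mul_nonneg hconst hy.1.le) hrpow

theorem intervalIntegrable_one_sub_sq_rpow_mul_pow {α : ℝ} (hα : -1 < α) (n : ℕ) :
    IntervalIntegrable (fun y : ℝ => 2 * (α + 1) * y * (1 - y ^ 2) ^ α * y ^ (2 * n))
      volume 0 1 :=
  (intervalIntegrable_one_sub_sq_rpow hα).mul_continuousOn (by fun_prop)

theorem isFiniteMeasure_diskMeasure {α : ℝ} (hα : -1 < α) : IsFiniteMeasure (diskMeasure α) := by
  refine isFiniteMeasure_withDensity_ofReal (Integrable.hasFiniteIntegral ?_)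
  refine (integrableOn_fun_norm_addHaar (E := ℂ) volume
    (f := fun y : ℝ => (α + 1) / Real.pi * (1 - y ^ 2) ^ α) (r := 1)).2 ?_
  rw [← integrableOn_Ioc_iff_integrableOn_Ioo,
    ← intervalIntegrable_iff_integrableOn_Ioc_of_le zero_le_one, Complex.finrank_real_complex]
  refine ((intervalIntegrable_one_sub_sq_rpow hα).const_mul (2 * Real.pi)⁻¹).congr fun y _ => ?_
  simp only [smul_eq_mul, Nat.add_one_sub_one, pow_one]
  field_simp

instance {α : ℝ} [hα : Fact (-1 < α)] : IsFiniteMeasure (diskMeasure α) :=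
  isFiniteMeasure_diskMeasure hα.out

theorem measurePreserving_mul_left_diskMeasure (α : ℝ) {c : ℂ} (hc : ‖c‖ = 1) :
    MeasurePreserving (fun z => c * z) (diskMeasure α) (diskMeasure α) := by
  let R : ℂ ≃ₗᵢ[ℝ] ℂ := rotation ⟨c, mem_sphere_zero_iff_norm.2 hc⟩
  have hR : ∀ z, R z = c * z := fun z => rfl
  have hnorm : ∀ z, ‖c * z‖ = ‖z‖ := fun z => by rw [norm_mul, hc, one_mul]
  have hdensity : Measurable fun z : ℂ =>
      ENNReal.ofReal ((α + 1) / Real.pi * (1 - ‖z‖ ^ 2) ^ α) := by fun_prop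
  have hpreimage (s : Set ℂ) :
      R ⁻¹' (s ∩ Metric.ball 0 1) = (fun z => c * z) ⁻¹' s ∩ Metric.ball 0 1 := by
    ext z
    simp [hR]
  refine ⟨by fun_prop, Measure.ext fun s hs => ?_⟩
  rw [Measure.map_apply (by fun_prop) hs, diskMeasure, withDensity_apply _ hs,
    withDensity_apply _ (hs.preimage (by fun_prop)), Measure.restrict_restrict hs,
    Measure.restrict_restrict (hs.preimage (by fun_prop)),
    ← R.measurePreserving.setLIntegral_comp_preimage
      (hs.inter Metric.isOpen_ball.measurableSet) hdensity, hpreimage]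
  simp only [hR, hnorm]

theorem setIntegral_ball_fun_norm (f : ℝ → ℝ) :
    ∫ z in Metric.ball (0 : ℂ) 1, f ‖z‖ = ∫ y in (0 : ℝ)..1, 2 * Real.pi * y * f y := by
  have hball : ∫ z in Metric.ball (0 : ℂ) 1, f ‖z‖ =
      ∫ z : ℂ, (Set.Iio 1).indicator f ‖z‖ := by
    rw [← integral_indicator Metric.isOpen_ball.measurableSet]
    refine integral_congr_ae (Eventually.of_forall fun z => ?_)
    simp [Set.indicator]
  have hIoo : ∫ y in Set.Ioi (0 : ℝ), y ^ (2 - 1) • (Set.Iio 1).indicator f y =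
      ∫ y in (0 : ℝ)..1, y * f y := by
    rw [intervalIntegral.integral_of_le zero_le_one, integral_Ioc_eq_integral_Ioo,
      ← integral_indicator measurableSet_Ioi, ← integral_indicator measurableSet_Ioo]
    refine integral_congr_ae (Eventually.of_forall fun y => ?_)
    by_cases h0 : 0 < y <;> by_cases h1 : y < 1 <;> simp [Set.indicator, h0, h1]
  rw [hball, integral_fun_norm_addHaar, Complex.finrank_real_complex, Measure.real,
    Complex.volume_ball, hIoo, ← Nat.cast_smul_eq_nsmul ℝ, ← intervalIntegral.integral_smul,
    ← intervalIntegral.integral_smul]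
  refine intervalIntegral.integral_congr fun y _ => ?_
  simp only [ENNReal.ofReal_one, one_pow, one_mul, ENNReal.coe_toReal, NNReal.coe_real_pi,
    smul_eq_mul, Nat.cast_ofNat]
  ring

theorem integral_diskMeasure_fun_norm {α : ℝ} (hα : -1 < α) (f : ℝ → ℝ) :
    ∫ z, f ‖z‖ ∂(diskMeasure α) = ∫ y in (0 : ℝ)..1, 2 * (α + 1) * y * (1 - y ^ 2) ^ α * f y := by
  have hdensity : Measurable fun z : ℂ =>
      ENNReal.ofReal ((α + 1) / Real.pi * (1 - ‖z‖ ^ 2) ^ α) := by fun_prop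
  have htoReal : ∀ z ∈ Metric.ball (0 : ℂ) 1,
      (ENNReal.ofReal ((α + 1) / Real.pi * (1 - ‖z‖ ^ 2) ^ α)).toReal • f ‖z‖ =
        (α + 1) / Real.pi * (1 - ‖z‖ ^ 2) ^ α * f ‖z‖ := fun z hz => by
    rw [mem_ball_zero_iff] at hz
    rw [smul_eq_mul, ENNReal.toReal_ofReal (mul_nonneg (div_nonneg (by linarith) Real.pi_pos.le)
      (Real.rpow_nonneg (by nlinarith [norm_nonneg z]) _))]
  rw [diskMeasure, integral_withDensity_eq_integral_toReal_smul hdensity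
    (Eventually.of_forall fun _ => ENNReal.ofReal_lt_top),
    setIntegral_congr_fun Metric.isOpen_ball.measurableSet htoReal,
    setIntegral_ball_fun_norm fun y => (α + 1) / Real.pi * (1 - y ^ 2) ^ α * f y]
  refine intervalIntegral.integral_congr fun y _ => ?_
  field_simp

/-- The moment `∫ |z|^(2n) dA_α`, which is the squared norm of `zⁿ` in the Bergman space. -/
def moment (α : ℝ) (n : ℕ) : ℝ := ∫ z, ‖z‖ ^ (2 * n) ∂(diskMeasure α)

theorem moment_eq_intervalIntegral {α : ℝ} (hα : -1 < α) (n : ℕ) :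
    moment α n = ∫ y in (0 : ℝ)..1, 2 * (α + 1) * y * (1 - y ^ 2) ^ α * y ^ (2 * n) :=
  integral_diskMeasure_fun_norm hα fun y => y ^ (2 * n)

theorem moment_zero {α : ℝ} (hα : -1 < α) : moment α 0 = 1 := by
  have hprimitive : ∫ y in (0 : ℝ)..1, 2 * (α + 1) * y * (1 - y ^ 2) ^ α =
      -(1 - 1 ^ 2) ^ (α + 1) - -(1 - 0 ^ 2) ^ (α + 1) :=
    intervalIntegral.integral_eq_sub_of_hasDerivAt_of_le zero_le_one
      (continuous_one_sub_sq_rpow (β := α + 1) (by linarith)).neg.continuousOn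
      (fun y hy => (hasDerivAt_one_sub_sq_rpow α hy).fun_neg.congr_deriv (neg_neg _))
      (intervalIntegrable_one_sub_sq_rpow hα)
  simp only [moment_eq_intervalIntegral hα, mul_zero, pow_zero, mul_one, hprimitive]
  simp [Real.zero_rpow (show α + 1 ≠ 0 by linarith)]

/-- Integration of the derivative of `y ^ (2n+2) (1 - y²) ^ (α+1)`, which vanishes at both ends. -/
theorem moment_succ {α : ℝ} (hα : -1 < α) (n : ℕ) :
    (n + α + 2) * moment α (n + 1) = (n + 1) * moment α n := by
  have hα' : 0 < α + 1 := by linarith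
  have hcont : ContinuousOn (fun y : ℝ => y ^ (2 * n + 2) * (1 - y ^ 2) ^ (α + 1))
      (Set.Icc 0 1) :=
    ((continuous_pow _).mul (continuous_one_sub_sq_rpow hα'.le)).continuousOn
  have hint₀ := (intervalIntegrable_one_sub_sq_rpow_mul_pow hα n).const_mul ((n + 1) / (α + 1))
  have hint₁ := (intervalIntegrable_one_sub_sq_rpow_mul_pow hα (n + 1)).const_mul
    ((n + α + 2) / (α + 1))
  have hderiv : ∀ y ∈ Set.Ioo (0 : ℝ) 1,
      HasDerivAt (fun y : ℝ => y ^ (2 * n + 2) * (1 - y ^ 2) ^ (α + 1))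
        ((n + 1) / (α + 1) * (2 * (α + 1) * y * (1 - y ^ 2) ^ α * y ^ (2 * n)) -
          (n + α + 2) / (α + 1) * (2 * (α + 1) * y * (1 - y ^ 2) ^ α * y ^ (2 * (n + 1)))) y := by
    intro y hy
    have hpos : 0 < 1 - y ^ 2 := by nlinarith [hy.1, hy.2]
    refine ((hasDerivAt_pow (2 * n + 2) y).fun_mul (hasDerivAt_one_sub_sq_rpow α hy)).congr_deriv ?_
    rw [Real.rpow_add_one hpos.ne']
    push_cast
    simp only [mul_add, mul_one, pow_add]
    field_simp
    ring
  have hzero : (n + 1) / (α + 1) * moment α n - (n + α + 2) / (α + 1) * moment α (n + 1) = 0 := by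
    rw [moment_eq_intervalIntegral hα, moment_eq_intervalIntegral hα,
      ← intervalIntegral.integral_const_mul, ← intervalIntegral.integral_const_mul,
      ← intervalIntegral.integral_sub hint₀ hint₁,
      intervalIntegral.integral_eq_sub_of_hasDerivAt_of_le zero_le_one hcont hderiv
        (hint₀.sub hint₁)]
    simp [Real.zero_rpow hα'.ne']
  field_simp at hzero
  linarith

theorem moment_pos {α : ℝ} (hα : -1 < α) (n : ℕ) : 0 < moment α n := by
  induction n with
  | zero => rw [moment_zero hα]; exact one_pos
  | succ n ih =>
    have hn : 0 < (n + α + 2 : ℝ) := by linarith [n.cast_nonneg (α := ℝ)]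
    have hmul : 0 < (n + α + 2 : ℝ) * moment α (n + 1) := by
      rw [moment_succ hα]
      positivity
    exact (pos_iff_pos_of_mul_pos hmul).1 hn

theorem succ_mul_multichoose_succ (a : ℝ) (n : ℕ) :
    (n + 1 : ℝ) * Ring.multichoose a (n + 1) = (a + n) * Ring.multichoose a n := by
  have hn := Ring.factorial_nsmul_multichoose_eq_ascPochhammer a n
  have hn' := Ring.factorial_nsmul_multichoose_eq_ascPochhammer a (n + 1)
  rw [Polynomial.ascPochhammer_smeval_eq_eval] at hn hn'
  rw [ascPochhammer_succ_eval, ← hn] at hn'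
  simp only [nsmul_eq_mul, Nat.factorial_succ, Nat.cast_mul, Nat.cast_add, Nat.cast_one] at hn'
  have hfactorial : (n.factorial : ℝ) ≠ 0 := by positivity
  apply mul_left_cancel₀ hfactorial
  linear_combination hn'

theorem moment_mul_multichoose {α : ℝ} (hα : -1 < α) (n : ℕ) :
    moment α n * Ring.multichoose (α + 2) n = 1 := by
  induction n with
  | zero => rw [moment_zero hα, Ring.multichoose_zero_right, one_mul]
  | succ n ih =>
    have hn : (n + 1 : ℝ) ≠ 0 := by positivity
    apply mul_left_cancel₀ hn
    linear_combination moment α (n + 1) * succ_mul_multichoose_succ (α + 2) n +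
      Ring.multichoose (α + 2) n * moment_succ hα n + (n + 1) * ih

theorem hasSum_pow_div_moment {α : ℝ} (hα : -1 < α) {t : ℝ} (ht : |t| < 1) :
    HasSum (fun n => t ^ n / moment α n) ((1 - t) ^ (-(α + 2))) := by
  have hbinomial := (Real.one_div_one_sub_rpow_hasFPowerSeriesOnBall_zero (α + 2)).hasSum
    (y := t) (by rwa [← ENNReal.ofReal_one, Metric.eball_ofReal, mem_ball_zero_iff])
  rw [zero_add, one_div, ← Real.rpow_neg (by linarith [(abs_lt.1 ht).2])] at hbinomial
  refine (congrArg (HasSum · _) (funext fun n => ?_)).mpr hbinomial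
  rw [FormalMultilinearSeries.ofScalars_apply_eq, ← Ring.multichoose_eq, smul_eq_mul,
    div_eq_iff (moment_pos hα n).ne']
  linear_combination (-t ^ n) * moment_mul_multichoose hα n

end DiskMeasure

/-! ### Slices as complex structures on the quaternions -/

section Slices

open Bergman

variable (i : ImUnit)

/-- The identification of the complex numbers with a slice, as a homomorphism of algebras. -/
def sliceHom : ℂ →ₐ[ℝ] ℍ := Complex.liftAux (i : ℍ) (ImUnit.mul_self i)

theorem sliceHom_apply (z : ℂ) : sliceHom i z = slicePt i z := by
  rw [sliceHom, Complex.liftAux_apply]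
  rfl

theorem slicePt_mul (z w : ℂ) : slicePt i (z * w) = slicePt i z * slicePt i w := by
  simp only [← sliceHom_apply, map_mul]

theorem slicePt_pow (z : ℂ) (n : ℕ) : slicePt i (z ^ n) = slicePt i z ^ n := by
  simp only [← sliceHom_apply, map_pow]

theorem slicePt_ofReal (r : ℝ) : slicePt i (r : ℂ) = (r : ℍ) := by
  simp [slicePt]

theorem slicePt_one : slicePt i 1 = 1 := by
  simpa using slicePt_ofReal i 1

theorem slicePt_I : slicePt i Complex.I = i := by
  simp [slicePt]

/-- `slicePt` as a continuous real linear map. -/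
def slicePtL : ℂ →L[ℝ] ℍ := LinearMap.toContinuousLinearMap (sliceHom i).toLinearMap

theorem slicePtL_apply (z : ℂ) : slicePtL i z = slicePt i z := sliceHom_apply i z

theorem imUnit_mul_imUnit_mul (q : ℍ) : (i : ℍ) * (i * q) = -q := by
  rw [← mul_assoc, ImUnit.mul_self, neg_one_mul]

/-- The complex structure on the quaternions given by the left multiplication by `i`. It depends
on `i` and is therefore not an instance. -/
@[reducible] def sliceNormedSpace : NormedSpace ℂ ℍ :=
  { Module.compHom ℍ (sliceHom i).toRingHom with
    norm_smul_le := fun z q => by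
      change ‖sliceHom i z * q‖ ≤ _
      rw [norm_mul, sliceHom_apply, norm_slicePt] }

theorem sliceNormedSpace_smul_def (z : ℂ) (q : ℍ) :
    letI := sliceNormedSpace i
    z • q = slicePt i z * q := by
  change sliceHom i z * q = _
  rw [sliceHom_apply]

theorem isScalarTower_sliceNormedSpace :
    letI := sliceNormedSpace i
    IsScalarTower ℝ ℂ ℍ := by
  let := sliceNormedSpace i
  refine ⟨fun r z q => ?_⟩
  rw [sliceNormedSpace_smul_def, sliceNormedSpace_smul_def, Complex.real_smul, slicePt_mul,
    slicePt_ofReal, mul_assoc, Quaternion.coe_mul_eq_smul]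

variable {i}

theorem eq_flip_mul_comp_slicePtL {L : ℂ →L[ℝ] ℍ} (hL : L Complex.I = i * L 1) :
    L = (ContinuousLinearMap.mul ℝ ℍ).flip (L 1) ∘L slicePtL i := by
  refine ContinuousLinearMap.ext fun w => ?_
  have hw : w = w.re • (1 : ℂ) + w.im • Complex.I := by
    apply Complex.ext <;> simp
  calc L w = w.re • L 1 + w.im • (i * L 1) := by
        conv_lhs => rw [hw, map_add, map_smul, map_smul, hL]
    _ = slicePt i w * L 1 := by
        rw [slicePt, add_mul, Quaternion.coe_mul_eq_smul, smul_mul_assoc]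
    _ = slicePtL i w * L 1 := by rw [slicePtL_apply]

theorem hasDerivAt_slice_iff {S : ℂ → ℍ} {D : ℍ} {z : ℂ} :
    letI := sliceNormedSpace i
    HasDerivAt S D z ↔
      HasFDerivAt S ((ContinuousLinearMap.mul ℝ ℍ).flip D ∘L slicePtL i) z := by
  let := sliceNormedSpace i
  have := isScalarTower_sliceNormedSpace i
  have hsmul : (ContinuousLinearMap.toSpanSingleton ℂ D).restrictScalars ℝ =
      (ContinuousLinearMap.mul ℝ ℍ).flip D ∘L slicePtL i := by
    refine ContinuousLinearMap.ext fun w => ?_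
    change w • D = slicePtL i w * D
    rw [slicePtL_apply, sliceNormedSpace_smul_def]
  rw [← hsmul]
  exact ⟨fun h => h.hasFDerivAt.restrictScalars ℝ,
    fun h => hasDerivAt_iff_hasFDerivAt.2 (hasFDerivAt_of_restrictScalars ℝ h rfl)⟩

section PartialDerivatives

theorem hasDerivAt_mk_left (x₀ x₁ : ℝ) : HasDerivAt (fun t : ℝ => (⟨t, x₁⟩ : ℂ)) 1 x₀ := by
  have h := (Complex.ofRealCLM.hasDerivAt (x := x₀)).add_const (x₁ * Complex.I)
  have hmk : (fun t : ℝ => (⟨t, x₁⟩ : ℂ)) = fun t : ℝ => Complex.ofRealCLM t + x₁ * Complex.I :=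
    funext fun t => by apply Complex.ext <;> simp
  rw [hmk]
  exact h.congr_deriv (by simp)

theorem hasDerivAt_mk_right (x₀ x₁ : ℝ) :
    HasDerivAt (fun t : ℝ => (⟨x₀, t⟩ : ℂ)) Complex.I x₁ := by
  have h := ((Complex.ofRealCLM.hasDerivAt (x := x₁)).mul_const Complex.I).const_add (x₀ : ℂ)
  have hmk : (fun t : ℝ => (⟨x₀, t⟩ : ℂ)) =
      fun t : ℝ => (x₀ : ℂ) + Complex.ofRealCLM t * Complex.I :=
    funext fun t => by apply Complex.ext <;> simp
  rw [hmk]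
  exact h.congr_deriv (by simp)

variable {E : Type*} [NormedAddCommGroup E] [NormedSpace ℝ E] {S : ℂ → E} {L : ℂ →L[ℝ] E}
  {x₀ x₁ : ℝ}

theorem hasDerivAt_comp_mk_left (hS : HasFDerivAt S L ⟨x₀, x₁⟩) :
    HasDerivAt (fun t : ℝ => S ⟨t, x₁⟩) (L 1) x₀ :=
  HasFDerivAt.comp_hasDerivAt x₀ hS (hasDerivAt_mk_left x₀ x₁)

theorem hasDerivAt_comp_mk_right (hS : HasFDerivAt S L ⟨x₀, x₁⟩) :
    HasDerivAt (fun t : ℝ => S ⟨x₀, t⟩) (L Complex.I) x₁ :=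
  HasFDerivAt.comp_hasDerivAt x₁ hS (hasDerivAt_mk_right x₀ x₁)

end PartialDerivatives

theorem exists_hasDerivAt_mk {S : ℂ → ℍ}
    (hS : letI := sliceNormedSpace i; DifferentiableOn ℂ S (Metric.ball 0 1))
    {x₀ x₁ : ℝ} (hx : (⟨x₀, x₁⟩ : ℂ) ∈ Metric.ball (0 : ℂ) 1) :
    ∃ D : ℍ, HasDerivAt (fun t : ℝ => S ⟨t, x₁⟩) D x₀ ∧
      HasDerivAt (fun t : ℝ => S ⟨x₀, t⟩) (i * D) x₁ := by
  let := sliceNormedSpace i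
  have hderiv := (hS.differentiableAt (Metric.isOpen_ball.mem_nhds hx)).hasDerivAt
  have hfderiv := hasDerivAt_slice_iff.1 hderiv
  refine ⟨deriv S ⟨x₀, x₁⟩, (hasDerivAt_comp_mk_left hfderiv).congr_deriv ?_,
    (hasDerivAt_comp_mk_right hfderiv).congr_deriv ?_⟩
  · simp [slicePtL_apply, slicePt_one]
  · simp [slicePtL_apply, slicePt_I]

theorem IsLeftSliceHyperholomorphic.cauchyRiemann {f : ℍ → ℍ}
    (hf : IsLeftSliceHyperholomorphic unitBall f) {z : ℂ} (hz : z ∈ Metric.ball (0 : ℂ) 1)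
    {L : ℂ →L[ℝ] ℍ} (hL : HasFDerivAt (fun z => f (slicePt i z)) L z) :
    L Complex.I = i * L 1 := by
  obtain ⟨-, a, b, hab⟩ := hf
  obtain ⟨-, -, -, d, e, ha₀, hb₁, hb₀, ha₁⟩ := hab i z.re z.im (slicePt_mem.2 hz)
  have hball := Metric.isOpen_ball.mem_nhds hz
  have hone : L 1 = d + i * e := by
    refine (hasDerivAt_comp_mk_left hL).unique
      ((ha₀.add (hb₀.const_mul (i : ℍ))).congr_of_eventuallyEq ?_)
    filter_upwards [(hasDerivAt_mk_left z.re z.im).continuousAt.eventually_mem hball] with t ht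
    exact (hab i t z.im (slicePt_mem.2 ht)).1
  have hI : L Complex.I = -e + i * d := by
    refine (hasDerivAt_comp_mk_right hL).unique
      ((ha₁.add (hb₁.const_mul (i : ℍ))).congr_of_eventuallyEq ?_)
    filter_upwards [(hasDerivAt_mk_right z.re z.im).continuousAt.eventually_mem hball] with t ht
    exact (hab i z.re t (slicePt_mem.2 ht)).1
  rw [hI, hone, mul_add, imUnit_mul_imUnit_mul, add_comm]

theorem IsLeftSliceHyperholomorphic.differentiableOn_slice {f : ℍ → ℍ}
    (hf : IsLeftSliceHyperholomorphic unitBall f) :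
    letI := sliceNormedSpace i
    DifferentiableOn ℂ (fun z => f (slicePt i z)) (Metric.ball 0 1) := by
  let := sliceNormedSpace i
  intro z hz
  have hz' : slicePt i z ∈ unitBall := slicePt_mem.2 hz
  have hfz : HasFDerivAt f (fderiv ℝ f (slicePt i z)) (slicePtL i z) := by
    rw [slicePtL_apply]
    exact (hf.1.differentiableAt (Metric.isOpen_ball.mem_nhds hz')).hasFDerivAt
  have hcomp : f ∘ slicePtL i = fun z => f (slicePt i z) :=
    funext fun z => congrArg f (slicePtL_apply i z)
  have hfderiv := hfz.comp z (slicePtL i).hasFDerivAt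
  rw [hcomp] at hfderiv
  have hCR := hf.cauchyRiemann hz hfderiv
  exact (hasDerivAt_slice_iff.2
    (hfderiv.congr_fderiv (eq_flip_mul_comp_slicePtL hCR))).differentiableAt.differentiableWithinAt

/-- The values on the slice of `I` of the extension of `S` by the representation formula. -/
def sliceRepr (i I : ImUnit) (S : ℂ → ℍ) (z : ℂ) : ℍ :=
  (2⁻¹ : ℝ) • (S z + S (star z)) + I * (-i * ((2⁻¹ : ℝ) • (S z - S (star z))))

theorem slicePt_eq_sliceRepr (i I : ImUnit) (z : ℂ) :
    slicePt I z = sliceRepr i I (slicePt i) z := by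
  have hstar : slicePt i (star z) = (z.re : ℍ) - z.im • (i : ℍ) := by
    simp [slicePt, sub_eq_add_neg]
  have hadd : (2⁻¹ : ℝ) • (slicePt i z + slicePt i (star z)) = (z.re : ℍ) := by
    rw [hstar, slicePt, add_add_sub_cancel, ← two_smul ℝ, smul_smul,
      inv_mul_cancel₀ two_ne_zero, one_smul]
  have hsub : (2⁻¹ : ℝ) • (slicePt i z - slicePt i (star z)) = z.im • (i : ℍ) := by
    rw [hstar, slicePt, add_sub_sub_cancel, ← two_smul ℝ, smul_smul,
      inv_mul_cancel₀ two_ne_zero, one_smul]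
  rw [sliceRepr, hadd, hsub, mul_smul_comm, neg_mul, ImUnit.mul_self, neg_neg, mul_smul_comm,
    mul_one, slicePt]

theorem slicePt_pow_mul_eq_sliceRepr (i I : ImUnit) (z : ℂ) (n : ℕ) (c : ℍ) :
    slicePt I z ^ n * c = sliceRepr i I (fun w => slicePt i w ^ n * c) z := by
  rw [← slicePt_pow, slicePt_eq_sliceRepr i I]
  simp only [sliceRepr, star_pow, slicePt_pow, ← add_mul, ← sub_mul]
  simp only [add_mul, mul_assoc, smul_mul_assoc]

theorem hasSum_sliceRepr {S : ℕ → ℂ → ℍ} {T : ℂ → ℍ} {z : ℂ} (I : ImUnit)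
    (h : HasSum (fun n => S n z) (T z)) (hstar : HasSum (fun n => S n (star z)) (T (star z))) :
    HasSum (fun n => sliceRepr i I (S n) z) (sliceRepr i I T z) :=
  ((h.add hstar).const_smul (2⁻¹ : ℝ)).add
    ((((h.sub hstar).const_smul (2⁻¹ : ℝ)).mul_left (-(i : ℍ))).mul_left (I : ℍ))

theorem isLeftSliceHyperholomorphic_of_eq_sliceRepr {f : ℍ → ℍ} {S : ℂ → ℍ}
    (hf : DifferentiableOn ℝ f unitBall)
    (hS : letI := sliceNormedSpace i; DifferentiableOn ℂ S (Metric.ball 0 1))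
    (hfS : ∀ I, ∀ z ∈ Metric.ball (0 : ℂ) 1, f (slicePt I z) = sliceRepr i I S z) :
    IsLeftSliceHyperholomorphic unitBall f := by
  refine ⟨hf, fun x y => (2⁻¹ : ℝ) • (S ⟨x, y⟩ + S ⟨x, -y⟩),
    fun x y => -i * ((2⁻¹ : ℝ) • (S ⟨x, y⟩ - S ⟨x, -y⟩)), fun I x₀ x₁ hx => ?_⟩
  have hz : (⟨x₀, x₁⟩ : ℂ) ∈ Metric.ball (0 : ℂ) 1 := slicePt_mem.1 hx
  have hstar : star (⟨x₀, x₁⟩ : ℂ) ∈ Metric.ball (0 : ℂ) 1 := by simpa using hz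
  obtain ⟨D, hleft, hright⟩ := exists_hasDerivAt_mk hS hz
  obtain ⟨D', hleft', hright'⟩ := exists_hasDerivAt_mk (x₁ := -x₁) hS hstar
  have hneg : HasDerivAt (fun t : ℝ => S ⟨x₀, -t⟩) (-(i * D')) x₁ :=
    (HasDerivAt.scomp (g₁ := fun t : ℝ => S ⟨x₀, t⟩) x₁ hright'
      (hasDerivAt_neg x₁)).congr_deriv (by simp)
  refine ⟨hfS I _ hz, ?_, ?_, (2⁻¹ : ℝ) • (D + D'), -i * ((2⁻¹ : ℝ) • (D - D')),
    (hleft.fun_add hleft').fun_const_smul (2⁻¹ : ℝ), ?_,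
    ((hleft.fun_sub hleft').fun_const_smul (2⁻¹ : ℝ)).const_mul _, ?_⟩
  · simp only [neg_neg]
    rw [add_comm]
  · simp only [neg_neg]
    rw [← mul_neg, ← smul_neg, neg_sub]
  · refine (((hright.fun_sub hneg).fun_const_smul (2⁻¹ : ℝ)).const_mul (-(i : ℍ))).congr_deriv ?_
    rw [sub_neg_eq_add, ← mul_add, mul_smul_comm, neg_mul, imUnit_mul_imUnit_mul, neg_neg]
  · refine ((hright.fun_add hneg).fun_const_smul (2⁻¹ : ℝ)).congr_deriv ?_
    rw [neg_mul, neg_neg, mul_smul_comm, mul_sub, sub_eq_add_neg]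

end Slices

/-! ### Quaternionic power series -/

section PowerSeries

open Bergman

variable {i : ImUnit}

/-- `c` is the sequence of Taylor coefficients on the right of the restriction of `f` to the unit
disk of the slice of `i`. -/
def IsTaylorSeq (i : ImUnit) (f : ℍ → ℍ) (c : ℕ → ℍ) : Prop :=
  ∀ z ∈ Metric.ball (0 : ℂ) 1, HasSum (fun n => slicePt i z ^ n * c n) (f (slicePt i z))

theorem IsLeftSliceHyperholomorphic.exists_isTaylorSeq (i : ImUnit) {f : ℍ → ℍ}
    (hf : IsLeftSliceHyperholomorphic unitBall f) : ∃ c, IsTaylorSeq i f c := by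
  let := sliceNormedSpace i
  refine ⟨fun n => slicePt i ((n.factorial : ℂ)⁻¹) *
    iteratedDeriv n (fun z => f (slicePt i z)) 0, fun z hz => ?_⟩
  have hterm : ∀ n : ℕ, ((n.factorial : ℂ)⁻¹) • (z - 0) ^ n •
      iteratedDeriv n (fun z => f (slicePt i z)) 0 = slicePt i z ^ n *
        (slicePt i ((n.factorial : ℂ)⁻¹) * iteratedDeriv n (fun z => f (slicePt i z)) 0) :=
    fun n => by
      rw [smul_smul, sliceNormedSpace_smul_def, sub_zero, mul_comm, slicePt_mul, slicePt_pow,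
        mul_assoc]
  simpa only [hterm] using Complex.hasSum_taylorSeries_on_ball hf.differentiableOn_slice hz

/-- The power series with coefficients `c` converges absolutely on the open unit ball. -/
def PowerSummable (c : ℕ → ℍ) : Prop :=
  ∀ r : ℝ, 0 ≤ r → r < 1 → Summable fun n => ‖c n‖ * r ^ n

theorem IsTaylorSeq.powerSummable {f : ℍ → ℍ} {c : ℕ → ℍ} (h : IsTaylorSeq i f c) :
    PowerSummable c := fun r hr₀ hr => by
  have hz : (r : ℂ) ∈ Metric.ball (0 : ℂ) 1 := by
    rwa [mem_ball_zero_iff, Complex.norm_real, Real.norm_of_nonneg hr₀]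
  refine (summable_norm_iff.2 (h r hz).summable).congr fun n => ?_
  rw [norm_mul, norm_pow, norm_slicePt, Complex.norm_real, Real.norm_of_nonneg hr₀, mul_comm]

theorem PowerSummable.summable {c : ℕ → ℍ} (hc : PowerSummable c) {x : ℍ} (hx : x ∈ unitBall) :
    Summable fun n => x ^ n * c n := by
  refine Summable.of_norm ((hc ‖x‖ (norm_nonneg x) (by simpa using hx)).congr fun n => ?_)
  rw [norm_mul, norm_pow, mul_comm]

/-- The sum of a power series with coefficients on the right on the unit ball, extended by zero. -/
def powerSum (c : ℕ → ℍ) (x : ℍ) : ℍ :=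
  open Classical in if x ∈ unitBall then ∑' n, x ^ n * c n else 0

theorem powerSum_of_notMem (c : ℕ → ℍ) {x : ℍ} (hx : x ∉ unitBall) : powerSum c x = 0 := if_neg hx

theorem PowerSummable.hasSum {c : ℕ → ℍ} (hc : PowerSummable c) {x : ℍ} (hx : x ∈ unitBall) :
    HasSum (fun n => x ^ n * c n) (powerSum c x) := by
  rw [powerSum, if_pos hx]
  exact (hc.summable hx).hasSum

theorem PowerSummable.isTaylorSeq {c : ℕ → ℍ} (hc : PowerSummable c) (i : ImUnit) :
    IsTaylorSeq i (powerSum c) c := fun _ hz => hc.hasSum (slicePt_mem.2 hz)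

section FormalMultilinearSeries

variable {𝕜 E F : Type*} [NontriviallyNormedField 𝕜] [NormedAddCommGroup E] [NormedSpace 𝕜 E]
  [NormedAddCommGroup F] [NormedSpace 𝕜 F] {p : FormalMultilinearSeries 𝕜 E F} {c : ℕ → ℍ}

theorem PowerSummable.one_le_radius (hc : PowerSummable c) (hp : ∀ n, ‖p n‖ ≤ ‖c n‖) :
    1 ≤ p.radius := by
  refine le_of_forall_lt fun r hr => ?_
  lift r to NNReal using (hr.trans ENNReal.one_lt_top).ne
  obtain ⟨t, hrt, ht⟩ := exists_between hr
  lift t to NNReal using (ht.trans ENNReal.one_lt_top).ne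
  refine hrt.trans_le (p.le_radius_of_summable ?_)
  refine Summable.of_nonneg_of_le (fun n => by positivity)
    (fun n => mul_le_mul_of_nonneg_right (hp n) (by positivity)) (hc t t.2 ?_)
  exact_mod_cast ht

theorem PowerSummable.differentiableOn_sum [CompleteSpace F] (hc : PowerSummable c)
    (hp : ∀ n, ‖p n‖ ≤ ‖c n‖) : DifferentiableOn 𝕜 p.sum (Metric.ball 0 1) := by
  have hr := hc.one_le_radius hp
  have h := ((p.hasFPowerSeriesOnBall (zero_lt_one.trans_le hr)).mono one_pos hr).differentiableOn
  rwa [← ENNReal.ofReal_one, Metric.eball_ofReal] at h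

end FormalMultilinearSeries

theorem PowerSummable.differentiableOn {c : ℕ → ℍ} (hc : PowerSummable c) :
    DifferentiableOn ℝ (powerSum c) unitBall := by
  let p : FormalMultilinearSeries ℝ ℍ ℍ := fun n =>
    ((ContinuousLinearMap.mul ℝ ℍ).flip (c n)).compContinuousMultilinearMap
      (ContinuousMultilinearMap.mkPiAlgebraFin ℝ n ℍ)
  have hp_apply : ∀ n x, p n (fun _ => x) = x ^ n * c n := fun n x => by simp [p]
  have hp_norm : ∀ n, ‖p n‖ ≤ ‖c n‖ := fun n => by
    refine (ContinuousLinearMap.norm_compContinuousMultilinearMap_le _ _).trans ?_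
    rw [ContinuousMultilinearMap.norm_mkPiAlgebraFin, mul_one]
    exact ContinuousLinearMap.opNorm_le_bound _ (norm_nonneg _) fun x => by
      simp [mul_comm]
  refine (hc.differentiableOn_sum hp_norm).congr fun x hx => ?_
  simp only [powerSum, if_pos hx, FormalMultilinearSeries.sum, hp_apply]

theorem PowerSummable.differentiableOn_slice {c : ℕ → ℍ} (hc : PowerSummable c) :
    letI := sliceNormedSpace i
    DifferentiableOn ℂ (fun z => powerSum c (slicePt i z)) (Metric.ball 0 1) := by
  let := sliceNormedSpace i
  let p : FormalMultilinearSeries ℂ ℂ ℍ := fun n =>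
    ContinuousMultilinearMap.mkPiRing ℂ (Fin n) (c n)
  have hp_apply : ∀ n z, p n (fun _ => z) = slicePt i z ^ n * c n := fun n z => by
    simp [p, sliceNormedSpace_smul_def, slicePt_pow]
  refine (hc.differentiableOn_sum (p := p) fun n => by simp [p]).congr fun z hz => ?_
  simp only [powerSum, if_pos (slicePt_mem.2 hz), FormalMultilinearSeries.sum, hp_apply]

theorem PowerSummable.isLeftSliceHyperholomorphic (i : ImUnit) {c : ℕ → ℍ}
    (hc : PowerSummable c) : IsLeftSliceHyperholomorphic unitBall (powerSum c) := by
  refine isLeftSliceHyperholomorphic_of_eq_sliceRepr (i := i) hc.differentiableOn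
    hc.differentiableOn_slice fun I z hz => ?_
  have hsum := hc.isTaylorSeq I z hz
  simp only [slicePt_pow_mul_eq_sliceRepr i I] at hsum
  exact hsum.unique (hasSum_sliceRepr I (hc.isTaylorSeq i z hz)
    (hc.isTaylorSeq i (star z) (by simpa using hz)))

end PowerSeries

/-! ### The reproducing kernel -/

section Kernel

open Filter Topology QInner
open Bergman hiding qinner

theorem integral_eq_integral_circle {E : Type*} [NormedAddCommGroup E] [NormedSpace ℝ E]
    [CompleteSpace E] {μ : Measure ℂ} [SFinite μ]
    (hμ : ∀ c : ℂ, ‖c‖ = 1 → MeasurePreserving (c * ·) μ μ) {g : ℂ → E} (hg : Integrable g μ) :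
    (2 * Real.pi) • ∫ z, g z ∂μ =
      ∫ z, (∫ θ in (0 : ℝ)..2 * Real.pi, g (Complex.exp (θ * Complex.I) * z)) ∂μ := by
  let ν : Measure ℝ := volume.restrict (Set.Ioc 0 (2 * Real.pi))
  have hrot : ∀ θ : ℝ, MeasurePreserving (fun z => Complex.exp (θ * Complex.I) * z) μ μ :=
    fun θ => hμ _ (Complex.norm_exp_ofReal_mul_I θ)
  have hskew := (MeasurePreserving.id ν).skew_product (μc := μ) (μd := μ)
    (g := fun (θ : ℝ) z => Complex.exp (θ * Complex.I) * z)
    (by unfold Function.uncurry; fun_prop) (Eventually.of_forall fun θ => (hrot θ).map_eq)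
  have hint : Integrable (Function.uncurry fun (θ : ℝ) z => g (Complex.exp (θ * Complex.I) * z))
      (ν.prod μ) := hskew.integrable_comp_of_integrable (hg.comp_snd ν)
  have hinv : ∀ θ : ℝ, ∫ z, g (Complex.exp (θ * Complex.I) * z) ∂μ = ∫ z, g z ∂μ := fun θ => by
    have h := integral_map (μ := μ) (f := g) (hrot θ).measurable.aemeasurable
      (by rw [(hrot θ).map_eq]; exact hg.1)
    rw [(hrot θ).map_eq] at h
    exact h.symm
  have hswap := integral_integral_swap hint
  simp only [hinv] at hswap
  simp only [intervalIntegral.integral_of_le Real.two_pi_pos.le]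
  rw [← hswap, integral_const]
  congr 1
  simp [ν, Measure.real, Real.pi_pos.le]

theorem integral_star_exp_pow_mul_exp_pow (m n : ℕ) :
    ∫ θ in (0 : ℝ)..2 * Real.pi, star (Complex.exp (θ * Complex.I)) ^ m *
      Complex.exp (θ * Complex.I) ^ n = if n = m then 2 * Real.pi else 0 := by
  have hterm : ∀ θ : ℝ, star (Complex.exp (θ * Complex.I)) ^ m * Complex.exp (θ * Complex.I) ^ n =
      Complex.exp (((n : ℂ) - m) * Complex.I * θ) := fun θ => by
    have hstar : star (Complex.exp (θ * Complex.I)) = Complex.exp (-(θ * Complex.I)) := by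
      rw [← starRingEnd_apply, ← Complex.exp_conj]
      simp
    rw [hstar, ← Complex.exp_nat_mul, ← Complex.exp_nat_mul, ← Complex.exp_add]
    congr 1
    ring
  simp only [hterm]
  split_ifs with h
  · simp [h]
  · have hnm : ((n : ℂ) - m) * Complex.I ≠ 0 :=
      mul_ne_zero (sub_ne_zero.2 (by exact_mod_cast h)) Complex.I_ne_zero
    have hperiod : Complex.exp (((n : ℂ) - m) * Complex.I * ((2 * Real.pi : ℝ) : ℂ)) = 1 := by
      rw [Complex.exp_eq_one_iff]
      exact ⟨(n : ℤ) - m, by push_cast; ring⟩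
    rw [integral_exp_mul_complex hnm, hperiod]
    simp

variable {α : ℝ} {i : ImUnit}

theorem integral_circle_star_pow_mul_pow_mul (i : ImUnit) (m n : ℕ) (z : ℂ) (c : ℍ) :
    ∫ θ in (0 : ℝ)..2 * Real.pi, star (slicePt i (Complex.exp (θ * Complex.I) * z) ^ m) *
      (slicePt i (Complex.exp (θ * Complex.I) * z) ^ n * c) =
      if n = m then (2 * Real.pi * ‖z‖ ^ (2 * m)) • c else 0 := by
  let L : ℂ →L[ℝ] ℍ := (ContinuousLinearMap.mul ℝ ℍ).flip c ∘L slicePtL i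
  have hL : ∀ w, L w = slicePt i w * c := fun w => by simp [L, slicePtL_apply]
  have hterm : ∀ θ : ℝ, star (slicePt i (Complex.exp (θ * Complex.I) * z) ^ m) *
      (slicePt i (Complex.exp (θ * Complex.I) * z) ^ n * c) =
      L (star (Complex.exp (θ * Complex.I)) ^ m * Complex.exp (θ * Complex.I) ^ n *
        (star z ^ m * z ^ n)) := fun θ => by
    rw [mul_mul_mul_comm, ← mul_pow, ← mul_pow, ← star_mul', hL,
      slicePt_mul i (_ ^ m), slicePt_pow, slicePt_pow, star_pow, star_slicePt, mul_assoc]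
  simp only [hterm]
  rw [ContinuousLinearMap.intervalIntegral_comp_comm _
    (Continuous.intervalIntegrable (by fun_prop) _ _), intervalIntegral.integral_mul_const,
    integral_star_exp_pow_mul_exp_pow]
  split_ifs with h
  · have hnorm : star z ^ n * z ^ n = ((‖z‖ ^ (2 * n) : ℝ) : ℂ) := by
      rw [← mul_pow, ← starRingEnd_apply, Complex.conj_mul', pow_mul]
      push_cast; rfl
    rw [← h, hnorm, hL, ← Quaternion.coe_mul_eq_smul, ← slicePt_ofReal i]
    push_cast; rfl
  · rw [Complex.ofReal_zero, zero_mul, map_zero]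

theorem IsTaylorSeq.integral_circle {f : ℍ → ℍ} {c : ℕ → ℍ} (hc : IsTaylorSeq i f c)
    (m : ℕ) {z : ℂ} (hz : z ∈ Metric.ball (0 : ℂ) 1) :
    ∫ θ in (0 : ℝ)..2 * Real.pi, star (slicePt i (Complex.exp (θ * Complex.I) * z) ^ m) *
      f (slicePt i (Complex.exp (θ * Complex.I) * z)) =
      (2 * Real.pi * ‖z‖ ^ (2 * m)) • c m := by
  have hnorm : ∀ θ : ℝ, ‖Complex.exp (θ * Complex.I) * z‖ = ‖z‖ := fun θ => by
    rw [norm_mul, Complex.norm_exp_ofReal_mul_I, one_mul]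
  have hmem : ∀ θ : ℝ, Complex.exp (θ * Complex.I) * z ∈ Metric.ball (0 : ℂ) 1 := fun θ => by
    rwa [mem_ball_zero_iff, hnorm, ← mem_ball_zero_iff]
  have hsum := intervalIntegral.hasSum_integral_of_dominated_convergence (a := 0)
    (b := 2 * Real.pi) (μ := volume)
    (F := fun (n : ℕ) (θ : ℝ) => star (slicePt i (Complex.exp (θ * Complex.I) * z) ^ m) *
      (slicePt i (Complex.exp (θ * Complex.I) * z) ^ n * c n))
    (fun n _ => ‖z‖ ^ m * (‖c n‖ * ‖z‖ ^ n))
    (fun n => by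
      refine Continuous.aestronglyMeasurable ?_
      have := continuous_slicePt i
      fun_prop)
    (fun n => Eventually.of_forall fun θ _ => by
      rw [norm_mul, norm_mul, norm_star, norm_pow, norm_pow, norm_slicePt, hnorm, mul_comm ‖c n‖])
    (Eventually.of_forall fun θ _ =>
      (hc.powerSummable ‖z‖ (norm_nonneg z) (mem_ball_zero_iff.1 hz)).mul_left _)
    intervalIntegrable_const
    (Eventually.of_forall fun θ _ => (hc _ (hmem θ)).mul_left _)
  simp only [integral_circle_star_pow_mul_pow_mul] at hsum
  refine hsum.unique ((hasSum_ite_eq m _).congr_fun fun n => ?_)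
  split_ifs with h
  · rw [h]
  · rfl

theorem norm_slicePt_pow_le_one (i : ImUnit) {z : ℂ} (hz : z ∈ Metric.ball (0 : ℂ) 1) (n : ℕ) :
    ‖slicePt i z ^ n‖ ≤ 1 := by
  rw [norm_pow, norm_slicePt]
  exact pow_le_one₀ (norm_nonneg z) (mem_ball_zero_iff.1 hz).le

theorem integrable_star_slicePt_pow_mul (i : ImUnit) {g : ℂ → ℍ}
    (hg : Integrable g (diskMeasure α)) (m : ℕ) :
    Integrable (fun z => star (slicePt i z ^ m) * g z) (diskMeasure α) := by
  refine hg.bdd_mul (c := 1)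
    (continuous_star.comp ((continuous_slicePt i).pow m)).aestronglyMeasurable ?_
  filter_upwards [ae_diskMeasure_mem_ball α] with z hz
  simpa only [norm_star] using norm_slicePt_pow_le_one i hz m

theorem IsTaylorSeq.integral_star_pow_mul [Fact (-1 < α)] {f : ℍ → ℍ} {c : ℕ → ℍ}
    (hc : IsTaylorSeq i f c) (hf : Integrable (fun z => f (slicePt i z)) (diskMeasure α)) (m : ℕ) :
    ∫ z, star (slicePt i z ^ m) * f (slicePt i z) ∂(diskMeasure α) = moment α m • c m := by
  have hrot := integral_eq_integral_circle (fun _ h => measurePreserving_mul_left_diskMeasure α h)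
    (integrable_star_slicePt_pow_mul i hf m)
  have hcircle : ∫ z, (∫ θ in (0 : ℝ)..2 * Real.pi,
      star (slicePt i (Complex.exp (θ * Complex.I) * z) ^ m) *
        f (slicePt i (Complex.exp (θ * Complex.I) * z))) ∂(diskMeasure α) =
      ∫ z, (2 * Real.pi * ‖z‖ ^ (2 * m)) • c m ∂(diskMeasure α) := by
    refine integral_congr_ae ?_
    filter_upwards [ae_diskMeasure_mem_ball α] with z hz
    exact hc.integral_circle m hz
  rw [hcircle, integral_smul_const, integral_const_mul, mul_smul (2 * Real.pi)] at hrot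
  exact smul_right_injective ℍ Real.two_pi_pos.ne' hrot

section SummableCoefficients

variable {c : ℕ → ℍ}

theorem powerSummable_of_summable_norm (hc : Summable fun n => ‖c n‖) : PowerSummable c :=
  fun _ hr₀ hr => Summable.of_nonneg_of_le (fun _ => by positivity)
    (fun _ => mul_le_of_le_one_right (norm_nonneg _) (pow_le_one₀ hr₀ hr.le)) hc

theorem norm_slicePt_pow_mul_le (i : ImUnit) {z : ℂ} (hz : z ∈ Metric.ball (0 : ℂ) 1) (n : ℕ)
    (a : ℍ) : ‖slicePt i z ^ n * a‖ ≤ ‖a‖ := by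
  rw [norm_mul]
  exact mul_le_of_le_one_left (norm_nonneg a) (norm_slicePt_pow_le_one i hz n)

theorem norm_powerSum_slicePt_le (hc : Summable fun n => ‖c n‖) {z : ℂ}
    (hz : z ∈ Metric.ball (0 : ℂ) 1) : ‖powerSum c (slicePt i z)‖ ≤ ∑' n, ‖c n‖ := by
  rw [← ((powerSummable_of_summable_norm hc).isTaylorSeq i z hz).tsum_eq]
  exact tsum_of_norm_bounded hc.hasSum fun n => norm_slicePt_pow_mul_le i hz n (c n)

theorem hasSum_integral_star_powerSum_mul (hc : Summable fun n => ‖c n‖) {g : ℂ → ℍ}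
    (hg : Integrable g (diskMeasure α)) :
    HasSum (fun n => star (c n) * ∫ z, star (slicePt i z ^ n) * g z ∂(diskMeasure α))
      (∫ z, star (powerSum c (slicePt i z)) * g z ∂(diskMeasure α)) := by
  have hterm : ∀ n z, star (c n) * (star (slicePt i z ^ n) * g z) =
      star (slicePt i z ^ n * c n) * g z := fun n z => by rw [star_mul, mul_assoc]
  have hint := fun n => (integrable_star_slicePt_pow_mul i hg n).const_mul (star (c n))
  have hbound : ∀ n, ∫ z, ‖star (c n) * (star (slicePt i z ^ n) * g z)‖ ∂(diskMeasure α) ≤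
      ‖c n‖ * ∫ z, ‖g z‖ ∂(diskMeasure α) := fun n => by
    rw [← integral_const_mul]
    refine integral_mono_ae (hint n).norm (hg.norm.const_mul _) ?_
    filter_upwards [ae_diskMeasure_mem_ball α] with z hz
    rw [hterm, norm_mul, norm_star]
    exact mul_le_mul_of_nonneg_right (norm_slicePt_pow_mul_le i hz n _) (norm_nonneg _)
  have hsum := hasSum_integral_of_summable_integral_norm hint
    (Summable.of_nonneg_of_le (fun n => integral_nonneg fun z => norm_nonneg _) hbound
      (hc.mul_right _))
  have hlim : ∫ z, ∑' n, star (c n) * (star (slicePt i z ^ n) * g z) ∂(diskMeasure α) =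
      ∫ z, star (powerSum c (slicePt i z)) * g z ∂(diskMeasure α) := by
    refine integral_congr_ae ?_
    filter_upwards [ae_diskMeasure_mem_ball α] with z hz
    simp only [hterm]
    exact ((starL.hasSum ((powerSummable_of_summable_norm hc).isTaylorSeq i z hz)).mul_right
      (g z)).tsum_eq
  rw [hlim] at hsum
  refine hsum.congr_fun fun n => ?_
  exact (integral_const_mul_of_integrable (integrable_star_slicePt_pow_mul i hg n)).symm

end SummableCoefficients

theorem IsLeftSliceHyperholomorphic.aestronglyMeasurable_restrict {f : ℍ → ℍ}
    (hf : IsLeftSliceHyperholomorphic unitBall f) (i : ImUnit) :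
    AEStronglyMeasurable (fun z => f (slicePt i z)) (volume.restrict (Metric.ball (0 : ℂ) 1)) :=
  (hf.1.continuousOn.comp (continuous_slicePt i).continuousOn
    fun _ hz => slicePt_mem.2 hz).aestronglyMeasurable measurableSet_ball

theorem IsLeftSliceHyperholomorphic.aestronglyMeasurable {f : ℍ → ℍ}
    (hf : IsLeftSliceHyperholomorphic unitBall f) :
    AEStronglyMeasurable (fun z => f (slicePt i z)) (diskMeasure α) :=
  (hf.aestronglyMeasurable_restrict i).mono_ac (diskMeasure_absolutelyContinuous α)

/-- The Taylor coefficients of the reproducing kernel at the point `w` of the slice of `i`. -/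
def kernelCoeff (α : ℝ) (i : ImUnit) (w : ℂ) (n : ℕ) : ℍ :=
  (moment α n)⁻¹ • slicePt i (star w) ^ n

theorem star_kernelCoeff (w : ℂ) (n : ℕ) :
    star (kernelCoeff α i w n) = (moment α n)⁻¹ • slicePt i w ^ n := by
  rw [kernelCoeff, Quaternion.star_smul, star_pow, star_slicePt, star_star]

theorem slicePt_pow_mul_kernelCoeff_self (w : ℂ) (n : ℕ) :
    slicePt i w ^ n * kernelCoeff α i w n = (((‖w‖ ^ 2) ^ n / moment α n : ℝ) : ℍ) := by
  have hnorm : w * star w = ((‖w‖ ^ 2 : ℝ) : ℂ) := by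
    rw [← starRingEnd_apply, Complex.mul_conj']
    push_cast; rfl
  rw [kernelCoeff, mul_smul_comm, ← slicePt_pow, ← slicePt_pow, ← slicePt_mul, ← mul_pow, hnorm,
    ← Complex.ofReal_pow, slicePt_ofReal, Quaternion.smul_coe, inv_mul_eq_div]

variable [hα : Fact (-1 < α)]

theorem Bergman.integrable (f : Bergman α i) :
    Integrable (fun z => f (slicePt i z)) (diskMeasure α) :=
  f.2.2.2.integrable one_le_two

theorem norm_kernelCoeff (w : ℂ) (n : ℕ) : ‖kernelCoeff α i w n‖ = ‖w‖ ^ n / moment α n := by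
  rw [kernelCoeff, norm_smul, norm_pow, norm_slicePt, norm_star,
    Real.norm_of_nonneg (inv_nonneg.2 (moment_pos hα.out n).le), inv_mul_eq_div]

theorem summable_norm_kernelCoeff {w : ℂ} (hw : w ∈ Metric.ball (0 : ℂ) 1) :
    Summable fun n => ‖kernelCoeff α i w n‖ := by
  simp only [norm_kernelCoeff]
  exact (hasSum_pow_div_moment hα.out (by simpa using hw)).summable

/-- The reproducing kernel at the point `w` of the slice of `i`, as the sum of its power series. -/
def kernelSeries (α : ℝ) [hα : Fact (-1 < α)] (i : ImUnit) {w : ℂ}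
    (hw : w ∈ Metric.ball (0 : ℂ) 1) : Bergman α i :=
  ⟨powerSum (kernelCoeff α i w), fun _ hx => powerSum_of_notMem _ hx,
    (powerSummable_of_summable_norm (summable_norm_kernelCoeff hw)).isLeftSliceHyperholomorphic i,
    MemLp.of_bound ((powerSummable_of_summable_norm
      (summable_norm_kernelCoeff hw)).isLeftSliceHyperholomorphic i).aestronglyMeasurable
      (∑' n, ‖kernelCoeff α i w n‖) <| by
        filter_upwards [ae_diskMeasure_mem_ball α] with z hz
        exact norm_powerSum_slicePt_le (summable_norm_kernelCoeff hw) hz⟩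

theorem isTaylorSeq_kernelSeries {w : ℂ} (hw : w ∈ Metric.ball (0 : ℂ) 1) :
    IsTaylorSeq i (kernelSeries α i hw) (kernelCoeff α i w) :=
  (powerSummable_of_summable_norm (summable_norm_kernelCoeff hw)).isTaylorSeq i

theorem qinner_kernelSeries {w : ℂ} (hw : w ∈ Metric.ball (0 : ℂ) 1) (f : Bergman α i) :
    qinner (kernelSeries α i hw) f = f (slicePt i w) := by
  obtain ⟨c, hc⟩ := f.2.2.1.exists_isTaylorSeq i
  refine (hasSum_integral_star_powerSum_mul (summable_norm_kernelCoeff hw) f.integrable).unique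
    ((hc w hw).congr_fun fun n => ?_)
  rw [hc.integral_star_pow_mul f.integrable, star_kernelCoeff, smul_mul_smul_comm,
    inv_mul_cancel₀ (moment_pos hα.out n).ne', one_smul]

theorem kernel_spec {w : ℂ} (hw : w ∈ Metric.ball (0 : ℂ) 1) (f : Bergman α i) :
    f (slicePt i w) = qinner (kernel α i (slicePt i w)) f :=
  Classical.epsilon_spec (p := fun K : Bergman α i => ∀ f : Bergman α i,
    f (slicePt i w) = qinner K f) ⟨kernelSeries α i hw, fun f => (qinner_kernelSeries hw f).symm⟩ f

theorem kernel_eq_kernelSeries {w : ℂ} (hw : w ∈ Metric.ball (0 : ℂ) 1) :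
    kernel α i (slicePt i w) = kernelSeries α i hw := by
  have hzero : ∀ f, qinner (kernel α i (slicePt i w) - kernelSeries α i hw) f = 0 := fun f => by
    rw [qinner_sub_left, ← kernel_spec hw, qinner_kernelSeries, sub_self]
  rw [← sub_eq_zero, ← norm_eq_zero, ← sq_eq_zero_iff, norm_sq_eq_re, hzero, Quaternion.re_zero]

theorem kernel_self {w : ℂ} (hw : w ∈ Metric.ball (0 : ℂ) 1) :
    kernel α i (slicePt i w) (slicePt i w) = (((1 - ‖w‖ ^ 2) ^ (-(α + 2)) : ℝ) : ℍ) := by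
  rw [kernel_eq_kernelSeries hw]
  have hw₁ := mem_ball_zero_iff.1 hw
  have hdiag := hasSum_pow_div_moment hα.out (t := ‖w‖ ^ 2)
    (by rw [abs_of_nonneg (by positivity)]; nlinarith [norm_nonneg w])
  have hseries := isTaylorSeq_kernelSeries (α := α) (i := i) hw w hw
  simp only [slicePt_pow_mul_kernelCoeff_self] at hseries
  exact hseries.unique (Quaternion.hasSum_coe.2 hdiag)

end Kernel

/-! ### Completeness of the Bergman space -/

section Completeness

open Filter Topology QInner
open Bergman hiding qinner

variable {α : ℝ} {i : ImUnit}

theorem IsTaylorSeq.sub {f g : ℍ → ℍ} {c d : ℕ → ℍ} (hf : IsTaylorSeq i f c)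
    (hg : IsTaylorSeq i g d) : IsTaylorSeq i (f - g) (c - d) := fun z hz => by
  simpa only [Pi.sub_apply, mul_sub] using (hf z hz).sub (hg z hz)

variable [hα : Fact (-1 < α)]

instance : IsProbabilityMeasure (diskMeasure α) := by
  refine isProbabilityMeasure_iff_real.2 ?_
  simpa [moment] using moment_zero hα.out

theorem eLpNorm_slice (f : Bergman α i) :
    eLpNorm (fun z => f (slicePt i z)) 2 (diskMeasure α) = ENNReal.ofReal ‖f‖ := by
  rw [f.2.2.2.eLpNorm_eq_integral_rpow_norm two_ne_zero ENNReal.ofNat_ne_top]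
  simp only [ENNReal.toReal_ofNat, Real.rpow_ofNat]
  rw [← norm_sq f, ← one_div, ← Real.sqrt_eq_rpow, Real.sqrt_sq (norm_nonneg f)]

theorem integral_norm_slice_le (f : Bergman α i) :
    ∫ z, ‖f (slicePt i z)‖ ∂(diskMeasure α) ≤ ‖f‖ := by
  rw [integral_norm_eq_lintegral_enorm f.integrable.1, ← eLpNorm_one_eq_lintegral_enorm]
  refine ENNReal.toReal_le_of_le_ofReal (norm_nonneg f) ?_
  exact (eLpNorm_le_eLpNorm_of_exponent_le one_le_two f.integrable.1).trans_eq (eLpNorm_slice f)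

theorem IsTaylorSeq.norm_le {f : Bergman α i} {c : ℕ → ℍ} (hc : IsTaylorSeq i f c) (m : ℕ) :
    ‖c m‖ ≤ ‖f‖ / moment α m := by
  have hm := moment_pos hα.out m
  rw [le_div_iff₀' hm, ← Real.norm_of_nonneg hm.le, ← norm_smul,
    ← hc.integral_star_pow_mul f.integrable]
  refine (norm_integral_le_integral_norm _).trans (le_trans ?_ (integral_norm_slice_le f))
  refine integral_mono_ae (integrable_star_slicePt_pow_mul i f.integrable m).norm
    f.integrable.norm ?_
  filter_upwards [ae_diskMeasure_mem_ball α] with z hz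
  rw [norm_mul, norm_star]
  exact mul_le_of_le_one_left (norm_nonneg _) (norm_slicePt_pow_le_one i hz m)

theorem summable_div_moment_mul_pow (M : ℝ) {r : ℝ} (hr : |r| < 1) :
    Summable fun n => M / moment α n * r ^ n := by
  simpa only [div_mul_eq_mul_div, mul_div_assoc] using
    (hasSum_pow_div_moment hα.out hr).summable.mul_left M

theorem powerSummable_of_norm_le {c : ℕ → ℍ} {M : ℝ} (hc : ∀ n, ‖c n‖ ≤ M / moment α n) :
    PowerSummable c := fun r hr₀ hr =>
  Summable.of_nonneg_of_le (fun _ => by positivity)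
    (fun n => mul_le_mul_of_nonneg_right (hc n) (pow_nonneg hr₀ n))
    (summable_div_moment_mul_pow M (by rwa [abs_of_nonneg hr₀]))

theorem tendsto_slice_of_tendsto_coeff {f : ℕ → ℍ → ℍ} {c : ℕ → ℕ → ℍ} {d : ℕ → ℍ} {M : ℝ}
    (hf : ∀ k, IsTaylorSeq i (f k) (c k)) (hc : ∀ k n, ‖c k n‖ ≤ M / moment α n)
    (hd : ∀ n, Tendsto (fun k => c k n) atTop (𝓝 (d n))) {z : ℂ}
    (hz : z ∈ Metric.ball (0 : ℂ) 1) :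
    Tendsto (fun k => f k (slicePt i z)) atTop (𝓝 (∑' n, slicePt i z ^ n * d n)) := by
  refine (tendsto_tsum_of_dominated_convergence
    (summable_div_moment_mul_pow (α := α) M (r := ‖z‖) (by simpa using hz))
    (fun n => (hd n).const_mul (slicePt i z ^ n)) (Eventually.of_forall fun k n => ?_)).congr
    fun k => (hf k z hz).tsum_eq
  rw [norm_mul, norm_pow, norm_slicePt, mul_comm]
  exact mul_le_mul_of_nonneg_right (hc k n) (by positivity)

theorem exists_powerSummable_tendsto_of_cauchySeq {u : ℕ → Bergman α i} (hu : CauchySeq u) :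
    ∃ d, PowerSummable d ∧ ∀ z ∈ Metric.ball (0 : ℂ) 1,
      Tendsto (fun k => u k (slicePt i z)) atTop (𝓝 (powerSum d (slicePt i z))) := by
  choose c hc using fun k => (u k).2.2.1.exists_isTaylorSeq i
  have hcauchy : ∀ m, CauchySeq fun k => c k m := fun m => by
    refine Metric.cauchySeq_iff.2 fun ε hε => ?_
    have hm := moment_pos hα.out m
    obtain ⟨N, hN⟩ := Metric.cauchySeq_iff.1 hu (ε * moment α m) (by positivity)
    refine ⟨N, fun k hk l hl => ?_⟩
    have hkl := hN k hk l hl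
    rw [dist_eq_norm] at hkl ⊢
    exact (IsTaylorSeq.norm_le (f := u k - u l) ((hc k).sub (hc l)) m).trans_lt
      ((div_lt_iff₀ hm).2 hkl)
  choose d hd using fun m => cauchySeq_tendsto_of_complete (hcauchy m)
  obtain ⟨M, hM⟩ := isBounded_iff_forall_norm_le.1 hu.isBounded_range
  have hcM : ∀ k m, ‖c k m‖ ≤ M / moment α m := fun k m => ((hc k).norm_le m).trans
    (div_le_div_of_nonneg_right (hM _ ⟨k, rfl⟩) (moment_pos hα.out m).le)
  have hd' : PowerSummable d := powerSummable_of_norm_le (α := α) (M := M) fun m =>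
    le_of_tendsto (hd m).norm (Eventually.of_forall fun k => hcM k m)
  refine ⟨d, hd', fun z hz => ?_⟩
  rw [← (hd'.isTaylorSeq i z hz).tsum_eq]
  exact tendsto_slice_of_tendsto_coeff hc hcM hd hz

instance : CompleteSpace (Bergman α i) := by
  refine Metric.complete_of_convergent_controlled_sequences (fun n => (1 / 2 : ℝ) ^ n)
    (fun n => by positivity) fun u hu => ?_
  have hcauchy : CauchySeq u := cauchySeq_of_le_tendsto_0 _
    (fun n m N hn hm => (hu N n m hn hm).le)
    (tendsto_pow_atTop_nhds_zero_of_lt_one (by norm_num) (by norm_num))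
  obtain ⟨d, hd, hlim⟩ := exists_powerSummable_tendsto_of_cauchySeq hcauchy
  have hslice := hd.isLeftSliceHyperholomorphic i
  have hL2 : Tendsto (fun k => eLpNorm ((fun z => u k (slicePt i z)) -
      fun z => powerSum d (slicePt i z)) 2 (diskMeasure α)) atTop (𝓝 0) := by
    refine Lp.cauchy_tendsto_of_tendsto (fun k => (u k).2.2.2.1) _
      (B := fun n => ENNReal.ofReal ((1 / 2 : ℝ) ^ n))
      (summable_geometric_two.tsum_ofReal_ne_top) (fun N n m hn hm => ?_) ?_
    · refine (eLpNorm_slice (u n - u m)).trans_lt ?_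
      rw [ENNReal.ofReal_lt_ofReal_iff (by positivity), ← dist_eq_norm]
      exact hu N n m hn hm
    · filter_upwards [ae_diskMeasure_mem_ball α] with z hz using hlim z hz
  let g : Bergman α i := ⟨powerSum d, fun _ hx => powerSum_of_notMem _ hx, hslice,
    Lp.memLp_of_cauchy_tendsto one_le_two (fun k => (u k).2.2.2) _ hslice.aestronglyMeasurable hL2⟩
  refine ⟨g, tendsto_iff_norm_sub_tendsto_zero.2 ?_⟩
  refine ((ENNReal.tendsto_toReal ENNReal.zero_ne_top).comp hL2).congr fun k => ?_
  rw [Function.comp_apply, ← ENNReal.toReal_ofReal (norm_nonneg (u k - g)), ← eLpNorm_slice]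
  rfl

end Completeness

/-! ### Integrals of weighted sums -/

section WeightedSums

theorem tsum_mul_le_rpow_tsum {ι : Type*} {w s : ι → ℝ≥0∞} {p : ℝ} (hp : 1 ≤ p)
    (hw : ∑' n, w n ≤ 1) : ∑' n, w n * s n ≤ (∑' n, w n * s n ^ p) ^ p⁻¹ := by
  rw [ENNReal.tsum_eq_iSup_sum]
  refine iSup_le fun F => ?_
  have hp' : p⁻¹ ≤ 1 := inv_le_one_of_one_le₀ hp
  calc ∑ n ∈ F, w n * s n
      ≤ (∑ n ∈ F, w n) ^ (1 - p⁻¹) * (∑ n ∈ F, w n * s n ^ p) ^ p⁻¹ :=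
        ENNReal.inner_le_weight_mul_Lp_of_nonneg F hp w s
    _ ≤ 1 * (∑' n, w n * s n ^ p) ^ p⁻¹ := by
        gcongr
        · exact ENNReal.rpow_le_one ((ENNReal.sum_le_tsum F).trans hw) (by linarith)
        · exact ENNReal.sum_le_tsum F
    _ = _ := one_mul _

variable {X ι : Type*} [MeasurableSpace X] {μ : Measure X} [Countable ι] {w : ι → X → ℝ≥0∞}
  {p : ℝ} {C : ℝ≥0∞}

theorem lintegral_tsum_mul_const (hw : ∀ n, AEMeasurable (w n) μ) (s : ι → ℝ≥0∞) :
    ∫⁻ x, ∑' n, w n x * s n ∂μ = ∑' n, (∫⁻ x, w n x ∂μ) * s n := by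
  rw [lintegral_tsum fun n => (hw n).mul_const _]
  exact tsum_congr fun n => lintegral_mul_const'' _ (hw n)

theorem lintegral_rpow_tsum_mul_le (hw : ∀ n, AEMeasurable (w n) μ)
    (hsum : ∀ᵐ x ∂μ, ∑' n, w n x ≤ 1) (hC : ∀ n, ∫⁻ x, w n x ∂μ ≤ C) (hp : 1 ≤ p)
    (s : ι → ℝ≥0∞) : ∫⁻ x, (∑' n, w n x * s n) ^ p ∂μ ≤ C * ∑' n, s n ^ p := by
  have hp0 : 0 < p := one_pos.trans_le hp
  calc ∫⁻ x, (∑' n, w n x * s n) ^ p ∂μ ≤ ∫⁻ x, ∑' n, w n x * s n ^ p ∂μ := by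
        refine lintegral_mono_ae ?_
        filter_upwards [hsum] with x hx
        exact (ENNReal.rpow_le_rpow (tsum_mul_le_rpow_tsum hp hx) hp0.le).trans_eq
          (ENNReal.rpow_inv_rpow hp0.ne' _)
    _ = ∑' n, (∫⁻ x, w n x ∂μ) * s n ^ p := lintegral_tsum_mul_const hw _
    _ ≤ ∑' n, C * s n ^ p := ENNReal.tsum_le_tsum fun n => mul_le_mul_left (hC n) _
    _ = C * ∑' n, s n ^ p := ENNReal.tsum_mul_left

theorem mul_tsum_rpow_le_lintegral_rpow (hw : ∀ n, AEMeasurable (w n) μ)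
    (hsum : ∀ᵐ x ∂μ, ∑' n, w n x ≤ 1) {s : ι → ℝ≥0∞} (hC : ∀ n, s n ≠ 0 → C ≤ ∫⁻ x, w n x ∂μ)
    (hp0 : 0 < p) (hp1 : p ≤ 1) :
    C * ∑' n, s n ^ p ≤ ∫⁻ x, (∑' n, w n x * s n) ^ p ∂μ := by
  calc C * ∑' n, s n ^ p = ∑' n, C * s n ^ p := ENNReal.tsum_mul_left.symm
    _ ≤ ∑' n, (∫⁻ x, w n x ∂μ) * s n ^ p := by
        refine ENNReal.tsum_le_tsum fun n => ?_
        rcases eq_or_ne (s n) 0 with hn | hn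
        · simp [hn, hp0]
        · exact mul_le_mul_left (hC n hn) _
    _ = ∫⁻ x, ∑' n, w n x * s n ^ p ∂μ := (lintegral_tsum_mul_const hw _).symm
    _ ≤ ∫⁻ x, (∑' n, w n x * s n) ^ p ∂μ := by
        refine lintegral_mono_ae ?_
        filter_upwards [hsum] with x hx
        have hjensen := tsum_mul_le_rpow_tsum (s := fun n => s n ^ p) ((one_le_inv₀ hp0).2 hp1) hx
        simpa only [ENNReal.rpow_rpow_inv hp0.ne', inv_inv] using hjensen

end WeightedSums

theorem tsum_ofReal_rpow_ne_top_iff_memℓp {ι : Type*} {s : ι → ℝ} (hs : ∀ n, 0 ≤ s n) {p : ℝ≥0∞}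
    (hp : 0 < p.toReal) : ∑' n, ENNReal.ofReal (s n) ^ p.toReal ≠ ∞ ↔ Memℓp s p := by
  have hterm (n : ι) : ENNReal.ofReal (s n) ^ p.toReal = ENNReal.ofReal (‖s n‖ ^ p.toReal) := by
    rw [Real.norm_of_nonneg (hs n), ENNReal.ofReal_rpow_of_nonneg (hs n) hp.le]
  simp only [memℓp_gen_iff hp, hterm]
  refine ⟨fun h => (ENNReal.summable_toReal h).congr fun n => ?_, fun h => h.tsum_ofReal_ne_top⟩
  exact ENNReal.toReal_ofReal (by positivity)

theorem integrable_of_memLp_of_norm_le {X E : Type*} [MeasurableSpace X] {μ : Measure X}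
    [NormedAddCommGroup E] {f : X → E} {p : ℝ≥0∞} (hf : MemLp f p μ) (hp0 : p ≠ 0) (hp1 : p ≤ 1)
    {M : ℝ} (hM : ∀ᵐ x ∂μ, ‖f x‖ ≤ M) : Integrable f μ := by
  have hp : p ≠ ∞ := ne_top_of_le_ne_top ENNReal.one_ne_top hp1
  have hpr : 0 < p.toReal := ENNReal.toReal_pos hp0 hp
  have hpr1 : p.toReal ≤ 1 := ENNReal.toReal_mono ENNReal.one_ne_top hp1
  have hexp : 0 ≤ 1 - p.toReal := sub_nonneg.2 hpr1
  have hconst : ENNReal.ofReal M ^ (1 - p.toReal) ≠ ∞ :=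
    ENNReal.rpow_ne_top_of_nonneg hexp ENNReal.ofReal_ne_top
  refine ⟨hf.1, lt_of_le_of_lt ?_ (ENNReal.mul_lt_top hconst.lt_top
    ((eLpNorm_lt_top_iff_lintegral_rpow_enorm_lt_top hp0 hp).1 hf.2))⟩
  rw [← lintegral_const_mul' _ _ hconst]
  refine lintegral_mono_ae ?_
  filter_upwards [hM] with x hx
  calc ‖f x‖ₑ = ‖f x‖ₑ ^ (1 - p.toReal) * ‖f x‖ₑ ^ p.toReal := by
        rw [← ENNReal.rpow_add_of_nonneg _ _ hexp hpr.le, sub_add_cancel, ENNReal.rpow_one]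
    _ ≤ ENNReal.ofReal M ^ (1 - p.toReal) * ‖f x‖ₑ ^ p.toReal := by
        gcongr
        rw [← ofReal_norm]
        exact ENNReal.ofReal_le_ofReal hx

/-! ### The Berezin transform -/

section BerezinTransform

open Filter Topology QInner
open Bergman hiding qinner

theorem moebiusMeasure_absolutelyContinuous :
    moebiusMeasure ≪ volume.restrict (Metric.ball (0 : ℂ) 1) :=
  withDensity_absolutelyContinuous _ _

theorem ae_moebiusMeasure_mem_ball : ∀ᵐ z ∂moebiusMeasure, z ∈ Metric.ball (0 : ℂ) 1 :=
  moebiusMeasure_absolutelyContinuous.ae_le (ae_restrict_mem Metric.isOpen_ball.measurableSet)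

theorem one_sub_norm_sq_pos {z : ℂ} (hz : z ∈ Metric.ball (0 : ℂ) 1) : 0 < 1 - ‖z‖ ^ 2 := by
  nlinarith [mem_ball_zero_iff.1 hz, norm_nonneg z]

theorem lintegral_rpow_mul_moebiusMeasure {α : ℝ} (hα : -1 < α) {g : ℂ → ℝ≥0∞}
    (hg : AEMeasurable g (volume.restrict (Metric.ball (0 : ℂ) 1))) :
    ∫⁻ z, ENNReal.ofReal ((1 - ‖z‖ ^ 2) ^ (α + 2)) * g z ∂moebiusMeasure =
      ENNReal.ofReal (α + 1)⁻¹ * ∫⁻ z, g z ∂(diskMeasure α) := by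
  have hα1 : 0 < α + 1 := by linarith
  rw [moebiusMeasure, lintegral_withDensity_eq_lintegral_mul₀ (by fun_prop) (by fun_prop),
    diskMeasure, lintegral_withDensity_eq_lintegral_mul₀ (by fun_prop) hg,
    ← lintegral_const_mul' _ _ ENNReal.ofReal_ne_top]
  refine lintegral_congr_ae ?_
  filter_upwards [ae_restrict_mem Metric.isOpen_ball.measurableSet] with z hz
  have hpos := one_sub_norm_sq_pos hz
  simp only [Pi.mul_apply]
  rw [← mul_assoc, ← mul_assoc, ← ENNReal.ofReal_mul (by positivity),
    ← ENNReal.ofReal_mul (by positivity), Real.rpow_add hpos, Real.rpow_two]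
  congr 2
  field_simp

variable {α : ℝ} [hα : Fact (-1 < α)] {i : ImUnit}

theorem qinner_normalizedKernel {z : ℂ} (hz : z ∈ Metric.ball (0 : ℂ) 1) (f : Bergman α i) :
    qinner (normalizedKernel α i (slicePt i z)) f =
      √((1 - ‖z‖ ^ 2) ^ (α + 2)) • f (slicePt i z) := by
  have hreal (r : ℝ) (g : Bergman α i) : r • g = op (r : ℍ) • g := Bergman.ext fun x => by
    rw [real_smul_apply, smul_apply, unop_op, Quaternion.mul_coe_eq_smul]
  rw [normalizedKernel, hreal, qinner_smul_left, ← kernel_spec hz, kernel_self hz,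
    Quaternion.star_coe, Quaternion.coe_mul_eq_smul, Quaternion.re_coe,
    Real.rpow_neg (one_sub_norm_sq_pos hz).le, Real.sqrt_inv, inv_inv]

theorem norm_normalizedKernel {z : ℂ} (hz : z ∈ Metric.ball (0 : ℂ) 1) :
    ‖normalizedKernel α i (slicePt i z)‖ = 1 := by
  have hpos : 0 < (1 - ‖z‖ ^ 2) ^ (α + 2) := Real.rpow_pos_of_pos (one_sub_norm_sq_pos hz) _
  refine (sq_eq_sq₀ (norm_nonneg _) zero_le_one).1 ?_
  rw [norm_sq_eq_re, qinner_normalizedKernel hz, normalizedKernel, real_smul_apply, kernel_self hz,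
    Quaternion.re_smul, Quaternion.re_smul, Quaternion.re_coe,
    Real.rpow_neg (one_sub_norm_sq_pos hz).le, Real.sqrt_inv, inv_inv, smul_eq_mul, smul_eq_mul,
    ← mul_assoc, Real.mul_self_sqrt hpos.le, mul_inv_cancel₀ hpos.ne', one_pow]

theorem aestronglyMeasurable_qinner_normalizedKernel (f : Bergman α i) :
    AEStronglyMeasurable (fun z => qinner (normalizedKernel α i (slicePt i z)) f)
      moebiusMeasure := by
  have hf : AEStronglyMeasurable (fun z => f (slicePt i z)) moebiusMeasure :=
    (f.2.2.1.aestronglyMeasurable_restrict i).mono_ac moebiusMeasure_absolutelyContinuous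
  have hfactor : Measurable fun z : ℂ => √((1 - ‖z‖ ^ 2) ^ (α + 2)) := by fun_prop
  refine (hfactor.aestronglyMeasurable.smul hf).congr ?_
  filter_upwards [ae_moebiusMeasure_mem_ball] with z hz
  exact (qinner_normalizedKernel hz f).symm

theorem norm_berezin_le {T : Bergman α i →L[ℍᵐᵒᵖ] Bergman α i} {M : ℝ}
    (hM : ∀ f, ‖T f‖ ≤ M * ‖f‖) {z : ℂ} (hz : z ∈ Metric.ball (0 : ℂ) 1) : ‖berezin T z‖ ≤ M := by
  refine (norm_qinner_le _ _).trans ?_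
  simpa only [norm_normalizedKernel hz, one_mul, mul_one] using
    hM (normalizedKernel α i (slicePt i z))

/-- The function `z ↦ |⟨k_z, f⟩|²`, which is the Berezin transform of the operator `f ⟨f, ·⟩`. -/
def berezinWeight (f : Bergman α i) (z : ℂ) : ℝ≥0∞ :=
  ENNReal.ofReal (‖qinner (normalizedKernel α i (slicePt i z)) f‖ ^ 2)

theorem aemeasurable_berezinWeight (f : Bergman α i) :
    AEMeasurable (berezinWeight f) moebiusMeasure :=
  ((aestronglyMeasurable_qinner_normalizedKernel f).norm.aemeasurable.pow_const 2).ennreal_ofReal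

theorem berezinWeight_eq (f : Bergman α i) {z : ℂ} (hz : z ∈ Metric.ball (0 : ℂ) 1) :
    berezinWeight f z =
      ENNReal.ofReal ((1 - ‖z‖ ^ 2) ^ (α + 2)) * ENNReal.ofReal (‖f (slicePt i z)‖ ^ 2) := by
  have hrpow : 0 ≤ (1 - ‖z‖ ^ 2) ^ (α + 2) := Real.rpow_nonneg (one_sub_norm_sq_pos hz).le _
  rw [berezinWeight, qinner_normalizedKernel hz, norm_smul, mul_pow, Real.norm_eq_abs, sq_abs,
    Real.sq_sqrt hrpow, ENNReal.ofReal_mul hrpow]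

theorem lintegral_berezinWeight (f : Bergman α i) :
    ∫⁻ z, berezinWeight f z ∂moebiusMeasure = ENNReal.ofReal (‖f‖ ^ 2 / (α + 1)) := by
  have hα1 : 0 < α + 1 := by linarith [hα.out]
  have hf := (f.2.2.1.aestronglyMeasurable_restrict i).norm.aemeasurable.pow_const 2
  have hint : Integrable (fun z => ‖f (slicePt i z)‖ ^ 2) (diskMeasure α) :=
    f.2.2.2.integrable_norm_pow two_ne_zero
  calc ∫⁻ z, berezinWeight f z ∂moebiusMeasure
      = ∫⁻ z, ENNReal.ofReal ((1 - ‖z‖ ^ 2) ^ (α + 2)) * ENNReal.ofReal (‖f (slicePt i z)‖ ^ 2)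
          ∂moebiusMeasure :=
        lintegral_congr_ae (ae_moebiusMeasure_mem_ball.mono fun z hz => berezinWeight_eq f hz)
    _ = ENNReal.ofReal (α + 1)⁻¹ * ENNReal.ofReal (‖f‖ ^ 2) := by
        rw [lintegral_rpow_mul_moebiusMeasure hα.out hf.ennreal_ofReal, norm_sq,
          ofReal_integral_eq_lintegral_ofReal hint (.of_forall fun z => by positivity)]
    _ = ENNReal.ofReal (‖f‖ ^ 2 / (α + 1)) := by
        rw [← ENNReal.ofReal_mul (by positivity), inv_mul_eq_div]

theorem tsum_berezinWeight_le_one {ι : Type*} {e : ι → Bergman α i} (he : IsOrthoFamily e) {z : ℂ}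
    (hz : z ∈ Metric.ball (0 : ℂ) 1) : ∑' n, berezinWeight (e n) z ≤ 1 := by
  rw [ENNReal.tsum_eq_iSup_sum]
  refine iSup_le fun F => ?_
  simp only [berezinWeight]
  rw [← ENNReal.ofReal_sum_of_nonneg fun n _ => by positivity, ← ENNReal.ofReal_one]
  refine ENNReal.ofReal_le_ofReal ?_
  simpa only [norm_qinner_comm, norm_normalizedKernel hz, one_pow] using
    he.bessel F (normalizedKernel α i (slicePt i z))

theorem IsOrthoFamily.lintegral_berezinWeight_le {ι : Type*} {e : ι → Bergman α i}
    (he : IsOrthoFamily e) (n : ι) :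
    ∫⁻ z, berezinWeight (e n) z ∂moebiusMeasure ≤ ENNReal.ofReal (1 / (α + 1)) := by
  have hα1 : 0 < α + 1 := by linarith [hα.out]
  rw [lintegral_berezinWeight]
  gcongr
  exact pow_le_one₀ (norm_nonneg _) (he.norm_le_one n)

/-- The mean of two Berezin weights, which dominates `|⟨k_z, f⟩⟨e, k_z⟩|`. -/
def meanWeight (e f : Bergman α i) (z : ℂ) : ℝ≥0∞ :=
  (berezinWeight e z + berezinWeight f z) / 2

theorem aemeasurable_meanWeight (e f : Bergman α i) :
    AEMeasurable (meanWeight e f) moebiusMeasure :=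
  ((aemeasurable_berezinWeight e).add (aemeasurable_berezinWeight f)).div_const 2

theorem tsum_meanWeight_le_one {ι : Type*} {e f : ι → Bergman α i} (he : IsOrthoFamily e)
    (hf : IsOrthoFamily f) {z : ℂ} (hz : z ∈ Metric.ball (0 : ℂ) 1) :
    ∑' n, meanWeight (e n) (f n) z ≤ 1 := by
  simp only [meanWeight, div_eq_mul_inv]
  rw [ENNReal.tsum_mul_right, ENNReal.tsum_add, ← div_eq_mul_inv]
  refine ENNReal.div_le_of_le_mul ?_
  rw [one_mul, ← one_add_one_eq_two]
  exact add_le_add (tsum_berezinWeight_le_one he hz) (tsum_berezinWeight_le_one hf hz)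

theorem lintegral_meanWeight_le {ι : Type*} {e f : ι → Bergman α i} (he : IsOrthoFamily e)
    (hf : IsOrthoFamily f) (n : ι) :
    ∫⁻ z, meanWeight (e n) (f n) z ∂moebiusMeasure ≤ ENNReal.ofReal (1 / (α + 1)) := by
  simp only [meanWeight, div_eq_mul_inv _ (2 : ℝ≥0∞)]
  rw [lintegral_mul_const' _ _ (by simp), lintegral_add_left' (aemeasurable_berezinWeight (e n)),
    ← div_eq_mul_inv]
  refine ENNReal.div_le_of_le_mul ?_
  rw [mul_two]
  exact add_le_add (he.lintegral_berezinWeight_le n) (hf.lintegral_berezinWeight_le n)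

theorem enorm_mul_mul_star_le_meanWeight (e f : Bergman α i) {s : ℝ} (hs : 0 ≤ s) (z : ℂ) :
    ‖qinner (normalizedKernel α i (slicePt i z)) f *
      ((s : ℍ) * star (qinner (normalizedKernel α i (slicePt i z)) e))‖ₑ ≤
        meanWeight e f z * ENNReal.ofReal s := by
  rw [meanWeight, berezinWeight, berezinWeight]
  set x := qinner (normalizedKernel α i (slicePt i z)) f
  set y := qinner (normalizedKernel α i (slicePt i z)) e
  rw [← ENNReal.ofReal_add (by positivity) (by positivity), ← ENNReal.ofReal_ofNat,
    ← ENNReal.ofReal_div_of_pos two_pos, ← ENNReal.ofReal_mul (by positivity), ← ofReal_norm]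
  refine ENNReal.ofReal_le_ofReal ?_
  rw [norm_mul, norm_mul, norm_star, Quaternion.norm_coe, Real.norm_of_nonneg hs]
  nlinarith [mul_nonneg hs (sq_nonneg (‖x‖ - ‖y‖))]

namespace HasSchmidtExpansion

variable {T : Bergman α i →L[ℍᵐᵒᵖ] Bergman α i} {s : ℕ → ℝ} {e f : ℕ → Bergman α i}

theorem hasSum_berezin (h : HasSchmidtExpansion T s e f) (z : ℂ) :
    HasSum (fun n => qinner (normalizedKernel α i (slicePt i z)) (f n) *
      ((s n : ℍ) * star (qinner (normalizedKernel α i (slicePt i z)) (e n)))) (berezin T z) := by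
  set k := normalizedKernel α i (slicePt i z)
  refine ((h k).map (qinnerRight k) (continuous_qinner k)).congr_fun fun n => ?_
  change _ = qinner k (op ((s n : ℍ) * qinner (e n) k) • f n)
  rw [smul_right, conj_symm]

theorem aestronglyMeasurable_berezin (h : HasSchmidtExpansion T s e f) :
    AEStronglyMeasurable (berezin T) moebiusMeasure := by
  refine aestronglyMeasurable_of_tendsto_ae atTop (fun N => ?_)
    (Eventually.of_forall fun z => (h.hasSum_berezin z).tendsto_sum_nat)
  refine Finset.aestronglyMeasurable_fun_sum _ fun n _ => ?_
  exact (aestronglyMeasurable_qinner_normalizedKernel (f n)).mul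
    (aestronglyMeasurable_const.mul (continuous_star.comp_aestronglyMeasurable
      (aestronglyMeasurable_qinner_normalizedKernel (e n))))

theorem enorm_berezin_le (h : HasSchmidtExpansion T s e f) (hs : ∀ n, 0 ≤ s n) (z : ℂ) :
    ‖berezin T z‖ₑ ≤ ∑' n, meanWeight (e n) (f n) z * ENNReal.ofReal (s n) := by
  rw [← (h.hasSum_berezin z).tsum_eq]
  exact enorm_tsum_le_tsum_enorm.trans
    (ENNReal.tsum_le_tsum fun n => enorm_mul_mul_star_le_meanWeight (e n) (f n) (hs n) z)

theorem enorm_berezin_eq (h : HasSchmidtExpansion T s e e) (hs : ∀ n, 0 ≤ s n) (z : ℂ) :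
    ‖berezin T z‖ₑ = ∑' n, berezinWeight (e n) z * ENNReal.ofReal (s n) := by
  set k := normalizedKernel α i (slicePt i z)
  have hnonneg (n : ℕ) : 0 ≤ ‖qinner k (e n)‖ ^ 2 * s n := mul_nonneg (by positivity) (hs n)
  have hsum : HasSum (fun n => ((‖qinner k (e n)‖ ^ 2 * s n : ℝ) : ℍ)) (berezin T z) :=
    (h.hasSum_berezin z).congr_fun fun n => by
      rw [Quaternion.coe_commutes, ← mul_assoc, Quaternion.self_mul_star,
        Quaternion.normSq_eq_norm_mul_self, ← Quaternion.coe_mul, sq]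
  rw [← hsum.tsum_eq, Quaternion.tsum_coe, ← ofReal_norm, Quaternion.norm_coe,
    Real.norm_of_nonneg (tsum_nonneg hnonneg),
    ENNReal.ofReal_tsum_of_nonneg hnonneg (Quaternion.summable_coe.1 hsum.summable)]
  exact tsum_congr fun n => ENNReal.ofReal_mul (by positivity)

theorem memLp_berezin (h : HasSchmidtExpansion T s e f) (he : IsOrthoFamily e)
    (hf : IsOrthoFamily f) (hs : ∀ n, 0 ≤ s n) {p : ℝ≥0∞} (hp1 : 1 ≤ p) (hp : p ≠ ∞)
    (hsp : Memℓp s p) : MemLp (berezin T) p moebiusMeasure := by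
  have hpr1 : 1 ≤ p.toReal := ENNReal.toReal_mono hp hp1
  have hpr : 0 < p.toReal := one_pos.trans_le hpr1
  refine ⟨h.aestronglyMeasurable_berezin, ?_⟩
  rw [eLpNorm_lt_top_iff_lintegral_rpow_enorm_lt_top (one_pos.trans_le hp1).ne' hp]
  calc ∫⁻ z, ‖berezin T z‖ₑ ^ p.toReal ∂moebiusMeasure
      ≤ ∫⁻ z, (∑' n, meanWeight (e n) (f n) z * ENNReal.ofReal (s n)) ^ p.toReal
          ∂moebiusMeasure :=
        lintegral_mono fun z => ENNReal.rpow_le_rpow (h.enorm_berezin_le hs z) hpr.le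
    _ ≤ ENNReal.ofReal (1 / (α + 1)) * ∑' n, ENNReal.ofReal (s n) ^ p.toReal :=
        lintegral_rpow_tsum_mul_le (fun n => aemeasurable_meanWeight (e n) (f n))
          (ae_moebiusMeasure_mem_ball.mono fun z hz => tsum_meanWeight_le_one he hf hz)
          (lintegral_meanWeight_le he hf) hpr1 _
    _ < ∞ := ENNReal.mul_lt_top ENNReal.ofReal_lt_top
        ((tsum_ofReal_rpow_ne_top_iff_memℓp hs hpr).2 hsp).lt_top

theorem memℓp_of_memLp_berezin (h : HasSchmidtExpansion T s e e) (he : IsEigenSequence T s e)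
    {p : ℝ≥0∞} (hp0 : 0 < p) (hp1 : p ≤ 1) (hb : MemLp (berezin T) p moebiusMeasure) :
    Memℓp s p := by
  have hp : p ≠ ∞ := ne_top_of_le_ne_top ENNReal.one_ne_top hp1
  have hpr : 0 < p.toReal := ENNReal.toReal_pos hp0.ne' hp
  have hpr1 : p.toReal ≤ 1 := ENNReal.toReal_mono ENNReal.one_ne_top hp1
  have hα1 : 0 < 1 / (α + 1) := one_div_pos.2 (by linarith [hα.out])
  have hmass (n : ℕ) (hn : ENNReal.ofReal (s n) ≠ 0) :
      ENNReal.ofReal (1 / (α + 1)) ≤ ∫⁻ z, berezinWeight (e n) z ∂moebiusMeasure := by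
    have hsn : s n ≠ 0 := fun h0 => hn (by rw [h0, ENNReal.ofReal_zero])
    rw [lintegral_berezinWeight, he.norm_eq_one n hsn, one_pow]
  have hle := mul_tsum_rpow_le_lintegral_rpow (fun n => aemeasurable_berezinWeight (e n))
    (ae_moebiusMeasure_mem_ball.mono fun z hz => tsum_berezinWeight_le_one he.ortho hz)
    hmass hpr hpr1
  simp only [← h.enorm_berezin_eq he.nonneg] at hle
  have hfin := hle.trans_lt ((eLpNorm_lt_top_iff_lintegral_rpow_enorm_lt_top hp0.ne' hp).1 hb.2)
  exact (tsum_ofReal_rpow_ne_top_iff_memℓp he.nonneg hpr).1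
    (ENNReal.lt_top_of_mul_ne_top_right hfin.ne (ENNReal.ofReal_pos.2 hα1).ne').ne

end HasSchmidtExpansion

theorem memLp_berezin_of_mem_schatten {T : Bergman α i →L[ℍᵐᵒᵖ] Bergman α i} {p : ℝ≥0∞}
    (hp1 : 1 ≤ p) (hp : p ≠ ∞) (hT : T ∈ Schatten (J α i) p) :
    MemLp (berezin T) p moebiusMeasure := by
  obtain ⟨-, -, s, hs, hsp⟩ := hT
  obtain ⟨e, f, he, hf, hsum⟩ := hs.exists_hasSchmidtExpansion
  exact hsum.memLp_berezin he hf hs.2.1 hp1 hp hsp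

theorem IsPositive.sum_berezinWeight_apply_le {T : Bergman α i →L[ℍᵐᵒᵖ] Bergman α i}
    (hT : IsPositive T) {M : ℝ} (hM0 : 0 ≤ M) (hM : ∀ f, ‖T f‖ ≤ M * ‖f‖) {ι : Type*}
    {e : ι → Bergman α i} (he : IsOrthoFamily e) (F : Finset ι) (z : ℂ) :
    ∑ n ∈ F, berezinWeight (T (e n)) z ≤ ENNReal.ofReal M * ‖berezin T z‖ₑ := by
  simp only [berezinWeight]
  set k := normalizedKernel α i (slicePt i z)
  rw [← ENNReal.ofReal_sum_of_nonneg fun n _ => by positivity, ← ofReal_norm,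
    ← ENNReal.ofReal_mul hM0]
  refine ENNReal.ofReal_le_ofReal ?_
  calc ∑ n ∈ F, ‖qinner k (T (e n))‖ ^ 2 = ∑ n ∈ F, ‖qinner (e n) (T k)‖ ^ 2 :=
        Finset.sum_congr rfl fun n _ => by rw [← hT.symm, norm_qinner_comm]
    _ ≤ ‖T k‖ ^ 2 := he.bessel F (T k)
    _ ≤ M * (berezin T z).re := hT.norm_sq_le hM k
    _ ≤ M * ‖berezin T z‖ := by
        gcongr
        exact (le_abs_self _).trans (abs_re_le_norm _)

theorem IsPositive.isHilbertSchmidt {T : Bergman α i →L[ℍᵐᵒᵖ] Bergman α i} (hT : IsPositive T)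
    (hint : Integrable (berezin T) moebiusMeasure) : IsHilbertSchmidt T := by
  have hα1 : 0 < α + 1 := by linarith [hα.out]
  obtain ⟨M, hM0, hM⟩ := exists_norm_apply_le T
  refine ⟨M * (∫ z, ‖berezin T z‖ ∂moebiusMeasure) * (α + 1), fun A hA => ?_⟩
  have hle : ∑ x : A, ENNReal.ofReal (‖T x‖ ^ 2 / (α + 1)) ≤
      ENNReal.ofReal M * ∫⁻ z, ‖berezin T z‖ₑ ∂moebiusMeasure := by
    simp only [← lintegral_berezinWeight]
    rw [← lintegral_finsetSum' _ fun (x : A) _ => aemeasurable_berezinWeight (T x),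
      ← lintegral_const_mul' _ _ ENNReal.ofReal_ne_top]
    exact lintegral_mono fun z => hT.sum_berezinWeight_apply_le hM0 hM hA Finset.univ z
  rw [← ENNReal.ofReal_sum_of_nonneg fun n _ => by positivity, ← Finset.sum_div,
    ← ofReal_integral_norm_eq_lintegral_enorm hint, ← ENNReal.ofReal_mul hM0,
    ENNReal.ofReal_le_ofReal_iff (by positivity), div_le_iff₀ hα1,
    Finset.sum_coe_sort A fun x => ‖T x‖ ^ 2] at hle
  exact hle

theorem IsPositive.mem_schatten {T : Bergman α i →L[ℍᵐᵒᵖ] Bergman α i}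
    (hT : IsPositive T) (hTJ : T ∘L J α i = J α i ∘L T) {p : ℝ≥0∞} (hp0 : 0 < p) (hp1 : p ≤ 1)
    (hb : MemLp (berezin T) p moebiusMeasure) : T ∈ Schatten (J α i) p := by
  obtain ⟨M, -, hM⟩ := exists_norm_apply_le T
  have hint : Integrable (berezin T) moebiusMeasure :=
    integrable_of_memLp_of_norm_le hb hp0.ne' hp1
      (ae_moebiusMeasure_mem_ball.mono fun z hz => norm_berezin_le hM hz)
  have hK := (hT.isHilbertSchmidt hint).isCompact_closure_image_closedBall
  obtain ⟨s, e, he, hs, hsum⟩ := hT.exists_hasSchmidtExpansion hK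
  have hcompact : IsCompactOperator T :=
    ⟨_, hK, mem_of_superset (Metric.closedBall_mem_nhds 0 one_pos) fun x hx =>
      subset_closure (Set.mem_image_of_mem T hx)⟩
  exact ⟨hcompact, hTJ, s, hT.isSingularValueSeq he hs hsum,
    hsum.memℓp_of_memLp_berezin he hp0 hp1 hb⟩

end BerezinTransform

end SliceBergman

end

theorem mainTheorem5 (α : ℝ) [Fact (-1 < α)] (i : SliceBergman.ImUnit) :
    (∀ T : SliceBergman.Bergman α i →L[ℍᵐᵒᵖ] SliceBergman.Bergman α i,
      SliceBergman.IsPositive T →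
      T ∘L SliceBergman.Bergman.J α i = SliceBergman.Bergman.J α i ∘L T →
      (∀ p : ℝ≥0∞, 1 ≤ p → p ≠ ∞ →
        T ∈ SliceBergman.Schatten (SliceBergman.Bergman.J α i) p →
        MemLp (SliceBergman.Bergman.berezin T) p SliceBergman.moebiusMeasure) ∧
      (∀ p : ℝ≥0∞, 0 < p → p ≤ 1 →
        MemLp (SliceBergman.Bergman.berezin T) p SliceBergman.moebiusMeasure →
        T ∈ SliceBergman.Schatten (SliceBergman.Bergman.J α i) p)) ∧
    (∀ T : SliceBergman.Bergman α i →L[ℍᵐᵒᵖ] SliceBergman.Bergman α i,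
      ∀ p : ℝ≥0∞, 1 ≤ p → p ≠ ∞ →
        T ∈ SliceBergman.Schatten (SliceBergman.Bergman.J α i) p →
        MemLp (SliceBergman.Bergman.berezin T) p SliceBergman.moebiusMeasure) := by
  have berezin_mem : ∀ T : SliceBergman.Bergman α i →L[ℍᵐᵒᵖ] SliceBergman.Bergman α i,
      ∀ p : ℝ≥0∞, 1 ≤ p → p ≠ ∞ →
        T ∈ SliceBergman.Schatten (SliceBergman.Bergman.J α i) p →
        MemLp (SliceBergman.Bergman.berezin T) p SliceBergman.moebiusMeasure :=
    fun _ _ hp1 hp hT => SliceBergman.memLp_berezin_of_mem_schatten hp1 hp hT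
  exact ⟨fun T hT hTJ => ⟨berezin_mem T, fun _ hp0 hp1 hb => hT.mem_schatten hTJ hp0 hp1 hb⟩,
    berezin_mem⟩
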